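/- **Conventions.** A quantum circuit $C$ is a finite sequence of $|C|$ gates from $\{H, T, \mathrm{CNOT}, \mathrm{Toffoli}\}$ on a fixed number of qubits, and $U_C$ is its unitary. A quantum polynomial-time algorithm (QPT) is a family of such circuits, acting on an input and on ancillas that start in $|0\rangle$, with measurements and discarding of qubits at the end, whose descriptions are computed by a deterministic polynomial-time machine from the parameters of the family in unary. An oracle QPT may in addition query given unitaries (also their inverses and controlled versions). A function $\epsilon:\mathbb N\to\mathbb R$ is negligible if $n^c\,\epsilon(n)\to 0$ for every $c$. A *circuit-pair family* $\mathcal C$ is a sequence of probability distributions $\mathcal C_n$ on pairs of circuits of size polynomial in $n$; it is *poly-time* if a probabilistic polynomial-time machine, on input $1^n$, outputs a description of a pair drawn from $\mathcal C_n$. A *state-pair family* $\mathcal C'$ is a sequence of probability distributions $\mathcal C'_n$ on pairs of density operators on polynomially (in $n$) many qubits; it need not be efficiently samplable, nor even computable. $\mathcal C'$ is an *obfuscation* of $\mathcal C$ if there are a map $\mathcal O$ from circuits to density operators and a QPT $\mathcal J$ such that $\mathcal C'_n$ is the distribution of $(\mathcal O(C_1),\mathcal O(C_2))$ for $(C_1,C_2)\leftarrow\mathcal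 C_n$, for every $n$, and: 1. (polynomial expansion) there is a polynomial $p$ such that, for every circuit $C$ of the family on $k$ qubits, $\mathcal O(C)$ has at most $p(k+|C|)$ qubits; 2. (functional equivalence) there is a negligible $\epsilon$ such that, for every circuit $C$ of the family on $k$ qubits and every density operator $\rho$ on $k$ qubits, $\|\mathcal J(\mathcal O(C)\otimes\rho)-U_C\,\rho\,U_C^\dagger\|_{\mathrm{tr}}\le\epsilon(k)$, where $\mathcal J$ may destroy $\mathcal O(C)$ (the states are single-use); 3. (two-circuit virtual black-box) for every QPT $\mathcal A$ there are an oracle QPT $\mathcal S$ and a negligible $\epsilon$ such that, for every $n$ and every pair $(C_1,C_2)$ in the support of $\mathcal C_n$, $$\Bigl|\Pr\bigl[\mathcal A(\mathcal O(C_1)\otimes\mathcal O(C_2))=1\bigr]-\Pr\bigl[\mathcal S^{U_{C_1},U_{C_2}}(|0\cdots0\rangle)=1\bigr]\Bigr|\le\epsilon\bigl(\min\{n,|C_1|,|C_2|\}\bigr).$$ Here $\mathcal A$ is also given $1^n$ and the numbers of qubits of the two states, and $\mathcal S$ is given $1^n$ and the numbers of qubits and of gates of $C_1$ and $C_2$,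 all in unary. **Theorem.** There exists a poly-time quantum circuit-pair family $\mathcal C$ such that no state-pair family is an obfuscation of $\mathcal C$. -/

import Mathlib

open scoped Matrix ComplexOrder

noncomputable section

namespace QObf

/-! ### Machine model

Programs over finitely many stacks of bits (a multi-stack Turing machine with structured control).
Polynomial time for these programs is polynomial time for multi-tape Turing machines. Each stack operation and each test of the top of a stack costs one step. -/

/-- The contents of the stacks; the first element of a list is the top of the stack. -/
abbrev Store := ℕ → List Bool

inductive Prog : Type
  | nop : Prog
  | push (r : ℕ) (b : Bool) : Prog
  | pop (r : ℕ) : Prog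
  | seq (c d : Prog) : Prog
  /-- run `c` if the top of stack `r` is `true`, and `d` if it is `false` or the stack is empty -/
  | ifTop (r : ℕ) (c d : Prog) : Prog
  /-- run `c` as long as stack `r` is not empty -/
  | loop (r : ℕ) (c : Prog) : Prog

/-- `Exec c s t s'`: the program `c`, started on `s`, halts after exactly `t` steps in `s'`. -/
inductive Exec : Prog → Store → ℕ → Store → Prop
  | nop (s : Store) : Exec Prog.nop s 1 s
  | push (s : Store) (r : ℕ) (b : Bool) :
      Exec (Prog.push r b) s 1 (Function.update s r (b :: s r))
  | pop (s : Store) (r : ℕ) : Exec (Prog.pop r) s 1 (Function.update s r (s r).tail)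
  | seq {c d : Prog} {s s' s'' : Store} {t t' : ℕ} :
      Exec c s t s' → Exec d s' t' s'' → Exec (Prog.seq c d) s (t + t') s''
  | ifTrue {r : ℕ} {c d : Prog} {s s' : Store} {t : ℕ} :
      (s r).head? = some true → Exec c s t s' → Exec (Prog.ifTop r c d) s (t + 1) s'
  | ifFalse {r : ℕ} {c d : Prog} {s s' : Store} {t : ℕ} :
      (s r).head? ≠ some true → Exec d s t s' → Exec (Prog.ifTop r c d) s (t + 1) s'
  | loopDone {r : ℕ} {c : Prog} {s : Store} : s r = [] → Exec (Prog.loop r c) s 1 s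
  | loopStep {r : ℕ} {c : Prog} {s s' s'' : Store} {t t' : ℕ} :
      s r ≠ [] → Exec c s t s' → Exec (Prog.loop r c) s' t' s'' →
      Exec (Prog.loop r c) s (t + t' + 1) s''

/-- Stack `i` holds the `i`-th parameter in unary, for `i < d`; the other stacks are empty. -/
def unaryStore {d : ℕ} (v : Fin d → ℕ) : Store :=
  fun r => if h : r < d then List.replicate (v ⟨r, h⟩) true else []

/-- There is a deterministic machine that, on the parameters `v` in unary, outputs (on stack `0`)
the description of `F v`, in time polynomial in the length of its input. -/
def IsUniform {α : Type} {d : ℕ} (enc : α → List Bool) (F : (Fin d → ℕ) → α) : Prop :=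
  ∃ (c : Prog) (p : Polynomial ℕ), ∀ v : Fin d → ℕ, ∃ (t : ℕ) (s : Store),
    Exec c (unaryStore v) t s ∧ t ≤ p.eval (∑ i, v i) ∧ s 0 = enc (F v)

/-! ### Linear algebra of qubits -/

abbrev Bits (n : ℕ) := Fin n → Bool

/-- Operators on `n` qubits, written in the computational basis. -/
abbrev Op (n : ℕ) := Matrix (Bits n) (Bits n) ℂ

/-- `ρ ⊗ σ`, with the qubits of `ρ` first. -/
def tensor {m n : ℕ} (ρ : Op m) (σ : Op n) : Op (m + n) :=
  Matrix.of fun x y => ρ (fun i => x (Fin.castAdd n i)) (fun i => y (Fin.castAdd n i)) *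
    σ (fun i => x (Fin.natAdd m i)) (fun i => y (Fin.natAdd m i))

/-- The pure state `|0ⁿ⟩⟨0ⁿ|`. -/
def zeroState (n : ℕ) : Op n := Matrix.single (fun _ => false) (fun _ => false) 1

/-- Trace norm: the sum of the singular values. -/
def traceNorm {n : ℕ} (M : Op n) : ℝ :=
  ∑ i, Real.sqrt ((Matrix.isHermitian_conjTranspose_mul_self M).eigenvalues i)

open Classical in
/-- The operator on `N` qubits that applies the `k`-qubit operator `G` to the qubits
`w 0, …, w (k - 1)` and leaves the others alone. If the `w j` are not distinct qubits below `N`,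
the instruction is ignored. -/
def place (N : ℕ) {k : ℕ} (w : Fin k → ℕ) (G : Op k) : Op N :=
  if h : Function.Injective w ∧ ∀ j, w j < N then
    Matrix.of fun x y =>
      if ∀ i : Fin N, (∀ j, w j ≠ i) → x i = y i then
        G (fun j => x ⟨w j, h.2 j⟩) (fun j => y ⟨w j, h.2 j⟩)
      else 0
  else 1

/-- The controlled version of `U`; the first qubit is the control. -/
def controlled {k : ℕ} (U : Op k) : Op (k + 1) :=
  Matrix.of fun x y =>
    if x 0 = y 0 then (if x 0 = true then U else 1) (Fin.tail x) (Fin.tail y) else 0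

/-! ### Quantum circuits over the gate set Hadamard, `T`, CNOT, Toffoli -/

inductive Gate : Type
  | h (i : ℕ) : Gate
  | t (i : ℕ) : Gate
  | cx (i j : ℕ) : Gate
  | ccx (i j k : ℕ) : Gate

def hGate : Op 1 :=
  Matrix.of fun x y =>
    if x 0 = true ∧ y 0 = true then -(1 / (Real.sqrt 2 : ℂ)) else 1 / (Real.sqrt 2 : ℂ)

def tGate : Op 1 :=
  Matrix.diagonal fun x => if x 0 = true then Complex.exp (Complex.I * (Real.pi / 4)) else 1

def cnot : Op 2 :=
  Matrix.of fun x y => if x = ![y 0, xor (y 0) (y 1)] then 1 else 0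

def toffoli : Op 3 :=
  Matrix.of fun x y => if x = ![y 0, y 1, xor (y 0 && y 1) (y 2)] then 1 else 0

/-- The unitary of a gate of a circuit on `N` qubits. -/
def Gate.op (N : ℕ) : Gate → Op N
  | .h i => place N (k := 1) ![i] hGate
  | .t i => place N (k := 1) ![i] tGate
  | .cx i j => place N (k := 2) ![i, j] cnot
  | .ccx i j k => place N (k := 3) ![i, j, k] toffoli

/-- The unitary of a sequence of gates; the head of the list is applied first. -/
def gatesOp (N : ℕ) : List Gate → Op N
  | [] => 1
  | g :: gs => gatesOp N gs * g.op N

/-- A quantum circuit: a sequence of local unitary gates on a fixed number of qubits. -/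
structure Circuit where
  qubits : ℕ
  gates : List Gate

/-- `U_C`. -/
def Circuit.unitary (C : Circuit) : Op C.qubits := gatesOp C.qubits C.gates

/-- `|C|`, the number of gates. -/
def Circuit.size (C : Circuit) : ℕ := C.gates.length

/-! ### Classical descriptions -/

/-- Self-delimiting unary code. -/
def encNat (n : ℕ) : List Bool := List.replicate n true ++ [false]

/-- Self-delimiting code of a list. -/
def encList {α : Type} (enc : α → List Bool) : List α → List Bool
  | [] => [false]
  | a :: l => true :: (enc a ++ encList enc l)

def encGate : Gate → List Bool
  | .h i => false :: false :: encNat i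
  | .t i => false :: true :: encNat i
  | .cx i j => true :: false :: (encNat i ++ encNat j)
  | .ccx i j k => true :: true :: (encNat i ++ encNat j ++ encNat k)

def encCircuit (C : Circuit) : List Bool := encNat C.qubits ++ encList encGate C.gates

def encCircuitPair (P : Circuit × Circuit) : List Bool := encCircuit P.1 ++ encCircuit P.2

/-! ### Quantum polynomial-time algorithms

An algorithm runs, for each value of its parameters, a circuit on its input and on ancillas that
start in `|0⟩`; measurements and the discarding of qubits take place at the end. -/

structure QAlg where
  ancillas : ℕ
  gates : List Gate

def encQAlg (A : QAlg) : List Bool := encNat A.ancillas ++ encList encGate A.gates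

/-- A quantum polynomial-time algorithm with `d` unary parameters. -/
def IsQPT {d : ℕ} (A : (Fin d → ℕ) → QAlg) : Prop := IsUniform encQAlg A

/-- The joint state of all the qubits at the end of the run on the input `ρ`. -/
def QAlg.run (A : QAlg) {k : ℕ} (ρ : Op k) : Op (k + A.ancillas) :=
  gatesOp (k + A.ancillas) A.gates * tensor ρ (zeroState A.ancillas) *
    (gatesOp (k + A.ancillas) A.gates)ᴴ

/-- Probability that a measurement of the output qubit, qubit `0`, gives `1`
(zero if there is no qubit). -/
def prOne {N : ℕ} (ρ : Op N) : ℝ :=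
  ∑ x : Bits N, if ∃ h : 0 < N, x ⟨0, h⟩ = true then (ρ x x).re else 0

/-- An interpreter acts on an advice register of `m` qubits, an input register of `n` qubits and
ancillas. Its output is the final content of the input register; all the rest, in particular what
is left of the advice, is discarded. -/
def QAlg.interpret (J : QAlg) {m n : ℕ} (ρ : Op (m + n)) : Op n :=
  Matrix.of fun x y => ∑ u : Bits m, ∑ z : Bits J.ancillas,
    J.run ρ (Fin.append (Fin.append u x) z) (Fin.append (Fin.append u y) z)

/-! ### Algorithms with black-box access to two unitaries -/

inductive OGate : Type
  | gate (g : Gate) : OGate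
  /-- A query to the first (`second = false`) or second oracle on the listed qubits. Simulators may
  also query the inverse and the controlled unitary (the control is the first listed qubit). -/
  | query (second inverse ctrl : Bool) (w : List ℕ) : OGate

def encOGate : OGate → List Bool
  | .gate g => false :: encGate g
  | .query s i c w => true :: s :: i :: c :: encList encNat w

/-- One query to `U`; ignored if the number of listed qubits is wrong. -/
def queryOp (N : ℕ) {k : ℕ} (U : Op k) (inverse ctrl : Bool) (w : List ℕ) : Op N :=
  let V : Op k := if inverse = true then Uᴴ else U
  if ctrl = true then
    (if w.length = k + 1 then place N (fun j : Fin (k + 1) => w.getD j 0) (controlled V) else 1)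
  else
    (if w.length = k then place N (fun j : Fin k => w.getD j 0) V else 1)

def OGate.op (N : ℕ) {k₁ k₂ : ℕ} (U₁ : Op k₁) (U₂ : Op k₂) : OGate → Op N
  | .gate g => g.op N
  | .query second inverse ctrl w =>
      if second = true then queryOp N U₂ inverse ctrl w else queryOp N U₁ inverse ctrl w

def ogatesOp (N : ℕ) {k₁ k₂ : ℕ} (U₁ : Op k₁) (U₂ : Op k₂) : List OGate → Op N
  | [] => 1
  | g :: gs => ogatesOp N U₁ U₂ gs * g.op N U₁ U₂

/-- An oracle circuit; all its qubits start in `|0⟩`. -/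
structure OAlg where
  qubits : ℕ
  gates : List OGate

def encOAlg (S : OAlg) : List Bool := encNat S.qubits ++ encList encOGate S.gates

/-- A quantum polynomial-time oracle algorithm with `d` unary parameters. -/
def IsOracleQPT {d : ℕ} (S : (Fin d → ℕ) → OAlg) : Prop := IsUniform encOAlg S

/-- `Pr[S^{U₁,U₂}(|0…0⟩) = 1]`. -/
def OAlg.prAccept (S : OAlg) {k₁ k₂ : ℕ} (U₁ : Op k₁) (U₂ : Op k₂) : ℝ :=
  prOne (ogatesOp S.qubits U₁ U₂ S.gates * zeroState S.qubits *
    (ogatesOp S.qubits U₁ U₂ S.gates)ᴴ)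

/-! ### Obfuscation -/

def Negligible (ε : ℕ → ℝ) : Prop :=
  Asymptotics.SuperpolynomialDecay Filter.atTop (fun n : ℕ => (n : ℝ)) ε

/-- A density operator on some number of qubits. -/
structure QState where
  qubits : ℕ
  op : Op qubits
  posSemidef : op.PosSemidef
  trace_eq_one : op.trace = 1

/-- An ensemble of distributions on pairs of polynomial-size circuits. -/
structure CircuitPairFamily where
  dist : ℕ → PMF (Circuit × Circuit)
  poly_size : ∃ p : Polynomial ℕ, ∀ n, ∀ P ∈ (dist n).support,
    P.1.qubits + P.1.size ≤ p.eval n ∧ P.2.qubits + P.2.size ≤ p.eval n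

/-- A polynomial-time machine which is given `n` in unary and a polynomial number of fair coins
outputs a description of a pair of circuits drawn from the `n`-th distribution. -/
def CircuitPairFamily.IsPolyTime (C : CircuitPairFamily) : Prop :=
  ∃ (c : Prog) (p q : Polynomial ℕ) (sample : ∀ n : ℕ, Bits (q.eval n) → Circuit × Circuit),
    (∀ (n : ℕ) (r : Bits (q.eval n)), ∃ (t : ℕ) (s : Store),
      Exec c (fun i => if i = 0 then List.replicate n true else if i = 1 then List.ofFn r else [])
        t s ∧ t ≤ p.eval n ∧ s 0 = encCircuitPair (sample n r)) ∧
    ∀ n : ℕ, C.dist n = (PMF.uniformOfFintype (Bits (q.eval n))).map (sample n)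

/-- An ensemble of distributions on pairs of states on polynomially many qubits. No computability
is demanded of it. -/
structure StatePairFamily where
  dist : ℕ → PMF (QState × QState)
  poly_qubits : ∃ p : Polynomial ℕ, ∀ n, ∀ P ∈ (dist n).support,
    P.1.qubits ≤ p.eval n ∧ P.2.qubits ≤ p.eval n

/-- `D` is one of the circuits of the family. -/
def CircuitPairFamily.Mem (C : CircuitPairFamily) (D : Circuit) : Prop :=
  ∃ n, ∃ P ∈ (C.dist n).support, D = P.1 ∨ D = P.2

/-- The obfuscated states have polynomially many qubits. -/
def PolyExpansion (C : CircuitPairFamily) (O : Circuit → QState) : Prop :=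
  ∃ p : Polynomial ℕ, ∀ D, C.Mem D → (O D).qubits ≤ p.eval (D.qubits + D.size)

/-- Run once on the obfuscation of `D` and on an input `ρ`, the interpreter outputs `U_D ρ U_D†`
up to an error in trace norm that is negligible in the number of qubits of `D`. -/
def FunctionalEquivalence (C : CircuitPairFamily) (O : Circuit → QState)
    (J : (Fin 2 → ℕ) → QAlg) : Prop :=
  ∃ ε : ℕ → ℝ, Negligible ε ∧ ∀ D, C.Mem D → ∀ ρ : Op D.qubits, ρ.PosSemidef → ρ.trace = 1 →
    traceNorm ((J ![(O D).qubits, D.qubits]).interpret (tensor (O D).op ρ) -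
      D.unitary * ρ * D.unitaryᴴ) ≤ ε D.qubits

/-- Every polynomial-time adversary that gets the two obfuscated states, one copy of each, has a
polynomial-time simulator with black-box access to the two unitaries. All parties know the security
parameter `n`; the adversary knows the numbers of qubits of the two states, and the simulator the
numbers of qubits and of gates of the two circuits. The error may be any quantity negligible in `n`
and `min {|C₁|, |C₂|}`. -/
def TwoCircuitVBB (C : CircuitPairFamily) (O : Circuit → QState) : Prop :=
  ∀ A : (Fin 3 → ℕ) → QAlg, IsQPT A →
    ∃ S : (Fin 5 → ℕ) → OAlg, IsOracleQPT S ∧ ∃ ε : ℕ → ℝ, Negligible ε ∧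
      ∀ n, ∀ P ∈ (C.dist n).support,
        |prOne ((A ![n, (O P.1).qubits, (O P.2).qubits]).run (tensor (O P.1).op (O P.2).op)) -
          (S ![n, P.1.qubits, P.2.qubits, P.1.size, P.2.size]).prAccept P.1.unitary P.2.unitary|
        ≤ ε (min n (min P.1.size P.2.size))

/-- `C'` is an obfuscation of `C`: some map `O` from circuits to states carries `C` to `C'` and is,
with some polynomial-time interpreter, a two-circuit obfuscator for the circuits of `C`. -/
def StatePairFamily.IsObfuscationOf (C' : StatePairFamily) (C : CircuitPairFamily) : Prop :=
  ∃ (O : Circuit → QState) (J : (Fin 2 → ℕ) → QAlg),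
    (∀ n, C'.dist n = (C.dist n).map fun P => (O P.1, O P.2)) ∧
    IsQPT J ∧ PolyExpansion C O ∧ FunctionalEquivalence C O J ∧ TwoCircuitVBB C O

end QObf

end

open scoped Matrix ComplexOrder

noncomputable section

namespace QObf

/-! ### Measurement probabilities and the trace norm -/

/-! The witness is the family of all pairs of circuits: uniform coins are decoded as descriptions of
two circuits (`randomPairs`). The decoder is total and efficient, and every pair with at most n + 1
qubits and n gates, all on wires below n + 1, has positive probability
(`mem_support_randomPairs_of_le`). Black-box security is required of each pair in the support, so
the hard pairs may be chosen after the obfuscator and the simulator are fixed.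

Let m = j + 2. The circuit P(a,b) (`pointCircuit`) adds b to its third register of m qubits if the
first one contains a. The circuit T(a,b') (`testCircuit`) regards its first qubits as advice for the
interpreter J, runs J coherently with this advice on the input a, adds to its last qubit the truth
value of "the output register contains b'", and runs J backwards. It has polynomial size because J
is efficient and obfuscation expands only polynomially. The adversary (`attack`) runs J with O(T) as
advice on O(P), continued by zeros, and reads the last output qubit. Each state is consumed once.
Functional equivalence, applied to T and then to P, shows that it accepts with probability close to
1 if b' = b and close to 0 otherwise (`abs_prOne_attack_sub_le`).

The simulator has only the two unitaries. P(a,b) moves only basis states whose first register is a.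
T(a,b') is conjugate to an operator that moves only basis states with b' in a certain register.
Hence for a fixed vector ψ the sum of ‖Uψ - ψ‖² over all (a,b) is an exponentially small fraction of
the number of pairs (`spread_pointCircuit`, `spread_testCircuit`). A hybrid argument over the
queries (`sum_nsq_ogatesOp_sub_le`) then gives a single pair (a,b) for which the runs with b' = b
and with b' the complement of b both end near the run with identity oracles
(`OAlg.exists_prAccept_near`). The simulator cannot separate two cases that the attack separates
(`not_exists_obfuscator`).

Two constraints shape the circuits. The simulator has to be the same oracle circuit for all (a,b)
and both values of b', so qubit and gate counts must depend on j only; ignored gates serve as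
padding. The bounds on moved basis states concern the whole unitary, not just its action on clean
ancillas, so auxiliary qubits of the comparison are borrowed in arbitrary states and restored. -/

open Classical in
/-- The probability that a measurement of `ρ` in the computational basis gives a string in `S`. -/
def prob {N : ℕ} (S : Bits N → Prop) (ρ : Op N) : ℝ :=
  ∑ x, if S x then (ρ x x).re else 0

/-- An eigenbasis of `Mᴴ * M` is mapped by `M` to orthogonal vectors whose norms are the singular
values. This connects the definition of `traceNorm` with `M` itself. -/
lemma conjTranspose_mul_self_eigenvectorUnitary {n : Type*} [Fintype n] [DecidableEq n]
    (M : Matrix n n ℂ) :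
    (M * ((Matrix.isHermitian_conjTranspose_mul_self M).eigenvectorUnitary : Matrix n n ℂ))ᴴ *
      (M * ((Matrix.isHermitian_conjTranspose_mul_self M).eigenvectorUnitary : Matrix n n ℂ)) =
    Matrix.diagonal (RCLike.ofReal ∘ (Matrix.isHermitian_conjTranspose_mul_self M).eigenvalues) := by
  have h := (Matrix.isHermitian_conjTranspose_mul_self M).conjStarAlgAut_star_eigenvectorUnitary
  rw [← h]
  simp [Unitary.conjStarAlgAut_apply, Matrix.conjTranspose_mul, Matrix.mul_assoc,
    Matrix.star_eq_conjTranspose]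

lemma norm_sum_mul_le_sqrt {ι : Type*} [Fintype ι] (f g : ι → ℂ) :
    ‖∑ x, f x * g x‖ ≤ Real.sqrt (∑ x, ‖f x‖ ^ 2) * Real.sqrt (∑ x, ‖g x‖ ^ 2) := by
  calc ‖∑ x, f x * g x‖ ≤ ∑ x, ‖f x‖ * ‖g x‖ := by
        refine (norm_sum_le _ _).trans (le_of_eq ?_)
        simp
    _ ≤ _ := Real.sum_mul_le_sqrt_mul_sqrt _ _ _

lemma conjTranspose_mul_self_apply_self {m n : Type*} [Fintype m] (B : Matrix m n ℂ) (i : n) :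
    ((Bᴴ * B) i i) = ((∑ x, ‖B x i‖ ^ 2 : ℝ) : ℂ) := by
  rw [Matrix.mul_apply]
  push_cast
  refine Finset.sum_congr rfl fun x _ => ?_
  rw [Matrix.conjTranspose_apply]
  exact Complex.conj_mul' _

open Classical in
-- The left side is |tr(PM)| for a coordinate projection P. In an eigenbasis vᵢ of `Mᴴ * M` the
-- trace is Σ ⟨P vᵢ, M vᵢ⟩, and Cauchy–Schwarz bounds each term by ‖M vᵢ‖, the i-th singular value.
lemma norm_sum_diag_le_traceNorm {N : ℕ} (S : Bits N → Prop) (M : Op N) :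
    ‖∑ x, if S x then M x x else 0‖ ≤ traceNorm M := by
  set hA := Matrix.isHermitian_conjTranspose_mul_self M
  set V : Op N := (hA.eigenvectorUnitary : Op N) with hV
  have hVV : V * Vᴴ = 1 := Matrix.mem_unitaryGroup_iff.1 hA.eigenvectorUnitary.2
  have hVV' : Vᴴ * V = 1 := Matrix.mem_unitaryGroup_iff'.1 hA.eigenvectorUnitary.2
  set P : Op N := Matrix.diagonal fun x => if S x then 1 else 0 with hP
  have h1 : (∑ x, if S x then M x x else 0) = (Vᴴ * P * (M * V)).trace := by
    rw [Matrix.mul_assoc, Matrix.trace_mul_comm, Matrix.mul_assoc, Matrix.mul_assoc, hVV,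
      Matrix.mul_one, Matrix.trace]
    simp [hP, Matrix.diagonal_mul]
  rw [h1, Matrix.trace, traceNorm]
  refine (norm_sum_le _ _).trans (Finset.sum_le_sum fun i _ => ?_)
  have h2 : ((Vᴴ * P * (M * V)).diag i) =
      ∑ x, (star (V x i) * (if S x then 1 else 0)) * (M * V) x i := by
    rw [Matrix.diag_apply, Matrix.mul_apply]
    simp [hP, Matrix.mul_diagonal]
  rw [h2]
  refine (norm_sum_mul_le_sqrt _ _).trans ?_
  have h3 : ∑ x, ‖star (V x i) * (if S x then (1 : ℂ) else 0)‖ ^ 2 ≤ 1 := by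
    have := conjTranspose_mul_self_apply_self V i
    rw [hVV', Matrix.one_apply_eq] at this
    have h4 : ∑ x, ‖V x i‖ ^ 2 = 1 := by exact_mod_cast this.symm
    rw [← h4]
    refine Finset.sum_le_sum fun x _ => ?_
    split_ifs <;> simp
  have h5 : ∑ x, ‖(M * V) x i‖ ^ 2 = hA.eigenvalues i := by
    have := conjTranspose_mul_self_apply_self (M * V) i
    rw [conjTranspose_mul_self_eigenvectorUnitary M, Matrix.diagonal_apply_eq] at this
    exact Complex.ofReal_injective this.symm
  rw [h5]
  calc _ ≤ 1 * Real.sqrt (hA.eigenvalues i) := by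
        gcongr
        exact Real.sqrt_le_one.2 h3
    _ = _ := one_mul _

/-- The trace norm enters the argument only here: functional equivalence is used solely through
probabilities of measurement outcomes. -/
lemma abs_prob_sub_le_traceNorm {N : ℕ} (S : Bits N → Prop) (X Y : Op N) :
    |prob S X - prob S Y| ≤ traceNorm (X - Y) := by
  classical
  refine le_trans ?_ (norm_sum_diag_le_traceNorm S (X - Y))
  refine le_trans (le_of_eq ?_) (Complex.abs_re_le_norm _)
  congr 1
  rw [Complex.re_sum, prob, prob, ← Finset.sum_sub_distrib]
  refine Finset.sum_congr rfl fun x _ => ?_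
  split_ifs <;> simp

/-! ### Bit strings indexed by natural numbers -/

/-- The bits of `x`, continued by zeros. -/
def ext {N : ℕ} (x : Bits N) (i : ℕ) : Bool := if h : i < N then x ⟨i, h⟩ else false

lemma ext_of_lt {N : ℕ} (x : Bits N) {i : ℕ} (h : i < N) : ext x i = x ⟨i, h⟩ := dif_pos h

lemma ext_of_le {N : ℕ} (x : Bits N) {i : ℕ} (h : N ≤ i) : ext x i = false := dif_neg (by omega)

@[simp] lemma ext_val {N : ℕ} (x : Bits N) (i : Fin N) : ext x i = x i := ext_of_lt x i.2

lemma ext_injective {N : ℕ} : Function.Injective (ext (N := N)) := fun x y h => by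
  funext i
  rw [← ext_val x, h, ext_val]

/-- The first `N` bits of a sequence. -/
def cut (N : ℕ) (σ : ℕ → Bool) : Bits N := fun i => σ i

/-- The bits from position `o` on vanish. -/
def ZeroFrom (o : ℕ) (σ : ℕ → Bool) : Prop := ∀ i, o ≤ i → σ i = false

lemma zeroFrom_ext {N : ℕ} (x : Bits N) : ZeroFrom N (ext x) := fun _ h => ext_of_le x h

lemma ext_cut {N : ℕ} {σ : ℕ → Bool} (h : ZeroFrom N σ) : ext (cut N σ) = σ := by
  funext i
  by_cases hi : i < N
  · rw [ext_of_lt _ hi, cut]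
  · rw [ext_of_le _ (by omega), h i (by omega)]

lemma ext_append_left {m n : ℕ} (u : Bits m) (v : Bits n) {i : ℕ} (h : i < m) :
    ext (Fin.append u v) i = ext u i := by
  rw [ext_of_lt _ (by omega : i < m + n), ext_of_lt _ h]
  exact Fin.append_left u v ⟨i, h⟩

lemma ext_append_right {m n : ℕ} (u : Bits m) (v : Bits n) (i : ℕ) :
    ext (Fin.append u v) (m + i) = ext v i := by
  by_cases h : i < n
  · rw [ext_of_lt _ (by omega : m + i < m + n), ext_of_lt _ h]
    exact Fin.append_right u v ⟨i, h⟩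
  · rw [ext_of_le _ (by omega), ext_of_le _ (by omega)]

/-! ### Tensor products -/

lemma sum_bits_append {α : Type*} [AddCommMonoid α] {m n : ℕ} (f : Bits (m + n) → α) :
    ∑ x, f x = ∑ u : Bits m, ∑ v : Bits n, f (Fin.append u v) := by
  rw [← Fintype.sum_prod_type' (f := fun u v => f (Fin.append u v))]
  exact (Fintype.sum_equiv (Fin.appendEquiv m n) _ _ fun _ => rfl).symm

lemma tensor_append {m n : ℕ} (ρ : Op m) (σ : Op n) (u u' : Bits m) (v v' : Bits n) :
    tensor ρ σ (Fin.append u v) (Fin.append u' v') = ρ u u' * σ v v' := by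
  simp [tensor]

lemma exists_append {m n : ℕ} (x : Bits (m + n)) : ∃ u v, x = Fin.append u v :=
  ⟨_, _, (Fin.append_castAdd_natAdd (f := x)).symm⟩

lemma op_ext_append {m n : ℕ} {A B : Op (m + n)}
    (h : ∀ u v u' v', A (Fin.append u v) (Fin.append u' v') =
      B (Fin.append u v) (Fin.append u' v')) : A = B := by
  ext x y
  obtain ⟨u, v, rfl⟩ := exists_append x
  obtain ⟨u', v', rfl⟩ := exists_append y
  exact h _ _ _ _

lemma tensor_mul_tensor {m n : ℕ} (A C : Op m) (B D : Op n) :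
    tensor A B * tensor C D = tensor (A * C) (B * D) := by
  refine op_ext_append fun u v u' v' => ?_
  rw [Matrix.mul_apply, sum_bits_append, tensor_append, Matrix.mul_apply, Matrix.mul_apply,
    Finset.sum_mul_sum]
  refine Finset.sum_congr rfl fun _ _ => Finset.sum_congr rfl fun _ _ => ?_
  rw [tensor_append, tensor_append]
  ring

lemma conjTranspose_tensor {m n : ℕ} (A : Op m) (B : Op n) : (tensor A B)ᴴ = tensor Aᴴ Bᴴ := by
  ext x y
  simp [tensor]

lemma append_inj_iff {m n : ℕ} (u u' : Bits m) (v v' : Bits n) :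
    Fin.append u v = Fin.append u' v' ↔ u = u' ∧ v = v' :=
  ((Fin.appendEquiv m n).injective.eq_iff (a := (u, v)) (b := (u', v'))).trans Prod.mk_inj

lemma tensor_one_one (m n : ℕ) : tensor (1 : Op m) (1 : Op n) = 1 := by
  refine op_ext_append fun u v u' v' => ?_
  rw [tensor_append, Matrix.one_apply, Matrix.one_apply, Matrix.one_apply]
  simp only [append_inj_iff]
  split_ifs <;> simp_all

lemma trace_tensor {m n : ℕ} (A : Op m) (B : Op n) :
    (tensor A B).trace = A.trace * B.trace := by
  simp only [Matrix.trace, sum_bits_append, Matrix.diag_apply, tensor_append, Finset.sum_mul_sum]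

lemma posSemidef_tensor {m n : ℕ} {A : Op m} {B : Op n} (hA : A.PosSemidef) (hB : B.PosSemidef) :
    (tensor A B).PosSemidef :=
  (hA.kronecker hB).submatrix (Fin.appendEquiv m n).symm

lemma posSemidef_single {N : ℕ} (α : Bits N) : (Matrix.single α α 1 : Op N).PosSemidef := by
  have : (Matrix.single α α 1 : Op N) = Matrix.diagonal fun x => if x = α then 1 else 0 := by
    ext x y
    simp only [Matrix.single_apply, Matrix.diagonal_apply]
    grind
  rw [this]
  refine Matrix.PosSemidef.diagonal fun x => ?_
  dsimp
  split_ifs <;> simp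

lemma trace_single {N : ℕ} (α : Bits N) : (Matrix.single α α 1 : Op N).trace = 1 := by
  simp

/-! ### Permutation matrices -/

/-- The operator that maps the basis state `y` to the basis state `f y`. -/
def permMat {N : ℕ} (f : Bits N → Bits N) : Op N := Matrix.of fun x y => if x = f y then 1 else 0

lemma permMat_id (N : ℕ) : permMat (id : Bits N → Bits N) = 1 := by
  ext x y
  simp [permMat, Matrix.one_apply]

lemma permMat_mul {N : ℕ} (f g : Bits N → Bits N) : permMat f * permMat g = permMat (f ∘ g) := by
  ext x y
  simp [permMat, Matrix.mul_apply]

lemma permMat_mul_self {N : ℕ} {f : Bits N → Bits N} (h : Function.Involutive f) :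
    permMat f * permMat f = 1 := by
  rw [permMat_mul, h.comp_self, permMat_id]

lemma conjTranspose_permMat {N : ℕ} {f : Bits N → Bits N} (h : Function.Involutive f) :
    (permMat f)ᴴ = permMat f := by
  ext x y
  simp only [permMat, Matrix.conjTranspose_apply, Matrix.of_apply]
  have : y = f x ↔ x = f y := ⟨fun e => by rw [e, h], fun e => by rw [e, h]⟩
  by_cases e : y = f x
  · rw [if_pos e, if_pos (this.1 e), star_one]
  · rw [if_neg e, if_neg (fun e' => e (this.2 e')), star_zero]

lemma permMat_mulVec {N : ℕ} {f : Bits N → Bits N} (h : Function.Involutive f) (ψ : Bits N → ℂ)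
    (x : Bits N) : (permMat f *ᵥ ψ) x = ψ (f x) := by
  have : ∀ y, (x = f y) = (y = f x) := fun y =>
    propext ⟨fun e => by rw [e, h], fun e => by rw [e, h]⟩
  simp [permMat, Matrix.mulVec, dotProduct, this]

lemma permMat_conj_apply {N : ℕ} {f : Bits N → Bits N} (h : Function.Involutive f) (ρ : Op N)
    (x y : Bits N) : (permMat f * ρ * (permMat f)ᴴ) x y = ρ (f x) (f y) := by
  have hx : ∀ x y, (x = f y) = (y = f x) := fun x y =>
    propext ⟨fun e => by rw [e, h], fun e => by rw [e, h]⟩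
  rw [conjTranspose_permMat h]
  simp only [permMat, Matrix.mul_apply, Matrix.of_apply, hx x]
  simp

lemma prob_permMat_conj {N : ℕ} {f : Bits N → Bits N} (hf : Function.Bijective f)
    (S : Bits N → Prop) (ρ : Op N) :
    prob S (permMat f * ρ * (permMat f)ᴴ) = prob (fun x => S (f x)) ρ := by
  classical
  have key : ∀ y, (permMat f * ρ * (permMat f)ᴴ) (f y) (f y) = ρ y y := fun y => by
    have : ∀ z, (f y = f z) = (z = y) := fun z =>
      propext ⟨fun e => (hf.1 e).symm, fun e => by rw [e]⟩
    simp only [permMat, Matrix.mul_apply, Matrix.of_apply, Matrix.conjTranspose_apply, this]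
    simp [apply_ite]
  rw [prob, prob, ← (Equiv.ofBijective f hf).sum_comp]
  refine Finset.sum_congr rfl fun y _ => ?_
  simp only [Equiv.ofBijective_apply, key]

/-! ### Placing an operator on selected qubits -/

/-- The splitting of a bit string into the bits at the positions `w` and the others. -/
def splitEquiv {N k : ℕ} {w : Fin k → Fin N} (hw : Function.Injective w) :
    Bits N ≃ Bits k × ({i : Fin N // ¬ i ∈ Set.range w} → Bool) :=
  (Equiv.piEquivPiSubtypeProd (fun i => i ∈ Set.range w) fun _ => Bool).trans
    (Equiv.prodCongr ((Equiv.ofInjective w hw).arrowCongr (Equiv.refl Bool)).symm (Equiv.refl _))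

lemma splitEquiv_fst {N k : ℕ} {w : Fin k → Fin N} (hw : Function.Injective w) (x : Bits N) :
    (splitEquiv hw x).1 = x ∘ w := by
  funext j
  simp [splitEquiv, Equiv.arrowCongr]

lemma splitEquiv_snd {N k : ℕ} {w : Fin k → Fin N} (hw : Function.Injective w) (x : Bits N)
    (i : {i : Fin N // ¬ i ∈ Set.range w}) : (splitEquiv hw x).2 i = x i := rfl

/-- The wires `w` are distinct qubits below `N`. -/
def Valid (N : ℕ) {k : ℕ} (w : Fin k → ℕ) : Prop := Function.Injective w ∧ ∀ j, w j < N

/-- The wires, as elements of `Fin N`. -/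
def Valid.fin {N k : ℕ} {w : Fin k → ℕ} (h : Valid N w) : Fin k → Fin N := fun j => ⟨w j, h.2 j⟩

lemma Valid.fin_injective {N k : ℕ} {w : Fin k → ℕ} (h : Valid N w) :
    Function.Injective h.fin := fun _ _ e => h.1 (congrArg Fin.val e)

lemma place_of_not_valid {N k : ℕ} {w : Fin k → ℕ} (h : ¬ Valid N w) (G : Op k) :
    place N w G = 1 := dif_neg h

/-- After the basis is split into the selected bits and the others, placing an operator is a
Kronecker product with the identity, from which products and adjoints follow. -/
lemma place_apply {N k : ℕ} {w : Fin k → ℕ} (h : Valid N w) (G : Op k) (x y : Bits N) :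
    place N w G x y =
      G (splitEquiv h.fin_injective x).1 (splitEquiv h.fin_injective y).1 *
        (1 : Matrix _ _ ℂ) (splitEquiv h.fin_injective x).2 (splitEquiv h.fin_injective y).2 := by
  have hh : Function.Injective w ∧ ∀ j, w j < N := h
  rw [place, dif_pos hh]
  simp only [Matrix.of_apply, splitEquiv_fst]
  have : (∀ i : Fin N, (∀ j, w j ≠ i) → x i = y i) ↔
      (splitEquiv h.fin_injective x).2 = (splitEquiv h.fin_injective y).2 := by
    constructor
    · intro H
      funext i
      rw [splitEquiv_snd, splitEquiv_snd]
      exact H i fun j e => i.2 ⟨j, Fin.ext e⟩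
    · intro H i hi
      refine congrFun H ⟨i, ?_⟩
      rintro ⟨j, rfl⟩
      exact hi j rfl
  rw [Matrix.one_apply]
  by_cases H : (splitEquiv h.fin_injective x).2 = (splitEquiv h.fin_injective y).2
  · rw [if_pos H, if_pos (this.2 H), mul_one]
    rfl
  · rw [if_neg H, if_neg fun H' => H (this.1 H'), mul_zero]

open scoped Kronecker in
lemma place_eq_kronecker {N k : ℕ} {w : Fin k → ℕ} (h : Valid N w) (G : Op k) :
    place N w G = (G ⊗ₖ (1 : Matrix _ _ ℂ)).submatrix (splitEquiv h.fin_injective)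
      (splitEquiv h.fin_injective) := by
  ext x y
  rw [place_apply h]
  rfl

lemma place_mul (N : ℕ) {k : ℕ} (w : Fin k → ℕ) (G G' : Op k) :
    place N w (G * G') = place N w G * place N w G' := by
  by_cases h : Valid N w
  · rw [place_eq_kronecker h, place_eq_kronecker h, place_eq_kronecker h,
      Matrix.submatrix_mul_equiv, ← Matrix.mul_kronecker_mul, one_mul]
  · simp [place_of_not_valid h]

lemma place_one (N : ℕ) {k : ℕ} (w : Fin k → ℕ) : place N w (1 : Op k) = 1 := by
  by_cases h : Valid N w
  · rw [place_eq_kronecker h, Matrix.one_kronecker_one, Matrix.submatrix_one_equiv]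
  · exact place_of_not_valid h _

lemma conjTranspose_place (N : ℕ) {k : ℕ} (w : Fin k → ℕ) (G : Op k) :
    (place N w G)ᴴ = place N w Gᴴ := by
  by_cases h : Valid N w
  · rw [place_eq_kronecker h, place_eq_kronecker h, Matrix.conjTranspose_submatrix,
      Matrix.conjTranspose_kronecker, Matrix.conjTranspose_one]
  · simp [place_of_not_valid h]

/-- The bound on the wires is essential: an instruction ignored on `N` qubits because a wire is
missing may take effect on `N + M` qubits. Repeated wires are harmless, since both sides are then
the identity. -/
lemma place_tensor_one {N M k : ℕ} {w : Fin k → ℕ} (h : ∀ j, w j < N) (G : Op k) :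
    place (N + M) w G = tensor (place N w G) 1 := by
  by_cases hw : Function.Injective w
  · have h1 : Function.Injective w ∧ ∀ j, w j < N := ⟨hw, h⟩
    have h2 : Function.Injective w ∧ ∀ j, w j < N + M :=
      ⟨hw, fun j => (h j).trans_le (Nat.le_add_right _ _)⟩
    refine op_ext_append fun u v u' v' => ?_
    rw [tensor_append, place, place, dif_pos h1, dif_pos h2, Matrix.one_apply]
    simp only [Matrix.of_apply]
    have e : ∀ (u : Bits N) (v : Bits M), (fun j => Fin.append u v ⟨w j, h2.2 j⟩) =
        fun j => u ⟨w j, h1.2 j⟩ := fun u v => by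
      funext j
      exact Fin.append_left u v ⟨w j, h1.2 j⟩
    rw [e, e]
    have key : (∀ i : Fin (N + M), (∀ j, w j ≠ i) → Fin.append u v i = Fin.append u' v' i) ↔
        (∀ i : Fin N, (∀ j, w j ≠ i) → u i = u' i) ∧ v = v' := by
      constructor
      · intro H
        refine ⟨fun i hi => ?_, funext fun i => ?_⟩
        · simpa using H (Fin.castAdd M i) hi
        · simpa using H (Fin.natAdd N i) fun j e => by
            have := h j
            simp at e
            omega
      · rintro ⟨H, rfl⟩ i
        refine Fin.addCases (fun i hi => ?_) (fun i _ => ?_) i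
        · simpa using H i hi
        · simp
    by_cases h3 : v = v' <;>
    by_cases h4 : ∀ i : Fin N, (∀ j, w j ≠ i) → u i = u' i
    · rw [if_pos (key.2 ⟨h4, h3⟩), if_pos h4, if_pos h3, mul_one]
    · rw [if_neg fun H => h4 (key.1 H).1, if_neg h4, zero_mul]
    · rw [if_neg fun H => h3 (key.1 H).2, if_neg h3, mul_zero]
    · rw [if_neg fun H => h3 (key.1 H).2, if_neg h3, mul_zero]
  · rw [place_of_not_valid fun H => hw H.1, place_of_not_valid fun H => hw H.1, tensor_one_one]


/-! ### Unitarity and inverses of circuits -/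

lemma sum_bits_one {α : Type*} [AddCommMonoid α] (f : Bits 1 → α) :
    ∑ x, f x = f (fun _ => true) + f (fun _ => false) := by
  rw [← (Equiv.funUnique (Fin 1) Bool).symm.sum_comp, Fintype.sum_bool]
  rfl

lemma op_one_ext {A B : Op 1} (h : ∀ a b, A (fun _ => a) (fun _ => b) = B (fun _ => a) (fun _ => b)) :
    A = B := by
  ext x y
  have e : ∀ x : Bits 1, x = fun _ => x 0 := fun x => by
    funext i
    rw [Subsingleton.elim i 0]
  rw [e x, e y]
  exact h _ _

lemma const_bool_eq_iff (a b : Bool) : ((fun _ => a : Bits 1) = fun _ => b) ↔ a = b :=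
  ⟨fun h => congrFun h 0, fun h => by rw [h]⟩

lemma inv_sqrt_two_mul_self :
    (1 / (Real.sqrt 2 : ℂ)) * (1 / (Real.sqrt 2 : ℂ)) = 1 / 2 := by
  rw [div_mul_div_comm, ← Complex.ofReal_mul, Real.mul_self_sqrt (by norm_num)]
  norm_num

lemma hGate_apply (a b : Bool) : hGate (fun _ => a) (fun _ => b) =
    if a = true ∧ b = true then -(1 / (Real.sqrt 2 : ℂ)) else 1 / (Real.sqrt 2 : ℂ) := rfl

lemma hGate_mul_self : hGate * hGate = 1 := by
  refine op_one_ext fun a b => ?_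
  rw [Matrix.mul_apply, sum_bits_one, Matrix.one_apply]
  simp only [hGate_apply, const_bool_eq_iff]
  cases a <;> cases b <;> simp only [inv_sqrt_two_mul_self, neg_mul, mul_neg, reduceCtorEq, and_self,
    and_true, and_false, if_true, if_false] <;> norm_num

lemma conjTranspose_hGate : hGateᴴ = hGate := by
  refine op_one_ext fun a b => ?_
  rw [Matrix.conjTranspose_apply, hGate_apply, hGate_apply]
  cases a <;> cases b <;> simp

lemma exp_pi_div_four_pow_four : Complex.exp (Complex.I * (Real.pi / 4)) ^ 4 = -1 := by
  rw [← Complex.exp_nat_mul, ← Complex.exp_pi_mul_I]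
  congr 1
  push_cast
  ring

/-- T⁴ = Z. This yields both T⁸ = 1, hence inverses inside the gate set, and the NOT gate as HZH. -/
lemma tGate_pow_four : tGate * tGate * tGate * tGate =
    Matrix.diagonal fun x => if x 0 = true then -1 else 1 := by
  simp only [tGate, Matrix.diagonal_mul_diagonal]
  congr 1
  funext x
  split_ifs
  · rw [← exp_pi_div_four_pow_four]
    ring
  · simp

lemma tGate_pow_eight : tGate ^ 8 = 1 := by
  have : tGate ^ 8 = (tGate * tGate * tGate * tGate) * (tGate * tGate * tGate * tGate) := by
    simp only [pow_succ, pow_zero, one_mul, mul_assoc]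
  rw [this, tGate_pow_four, Matrix.diagonal_mul_diagonal, ← Matrix.diagonal_one]
  congr 1
  funext x
  split_ifs <;> simp

lemma conjTranspose_tGate_mul_self : tGateᴴ * tGate = 1 := by
  rw [tGate, Matrix.diagonal_conjTranspose, Matrix.diagonal_mul_diagonal, ← Matrix.diagonal_one]
  congr 1
  funext x
  simp only [Pi.star_apply]
  split_ifs
  · rw [← starRingEnd_apply, ← Complex.exp_conj, ← Complex.exp_add]
    rw [map_mul, map_div₀, Complex.conj_I, Complex.conj_ofReal, Complex.conj_ofNat, neg_mul,
      neg_add_cancel, Complex.exp_zero]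
  · simp

/-- The action of CNOT on basis states. -/
def cnotFun (y : Bits 2) : Bits 2 := ![y 0, xor (y 0) (y 1)]

/-- The action of the Toffoli gate on basis states. -/
def toffoliFun (y : Bits 3) : Bits 3 := ![y 0, y 1, xor (y 0 && y 1) (y 2)]

lemma cnot_eq : cnot = permMat cnotFun := rfl

lemma toffoli_eq : toffoli = permMat toffoliFun := rfl

lemma cnotFun_involutive : Function.Involutive cnotFun := fun y => by
  funext i
  fin_cases i <;> simp [cnotFun]

lemma toffoliFun_involutive : Function.Involutive toffoliFun := fun y => by
  funext i
  fin_cases i <;> simp [toffoliFun]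

lemma gatesOp_append (N : ℕ) (l l' : List Gate) :
    gatesOp N (l ++ l') = gatesOp N l' * gatesOp N l := by
  induction l with
  | nil => simp [gatesOp]
  | cons g l ih => rw [List.cons_append, gatesOp, ih, gatesOp, Matrix.mul_assoc]

lemma conjTranspose_place_mul_self (N : ℕ) {k : ℕ} (w : Fin k → ℕ) {G : Op k} (h : Gᴴ * G = 1) :
    (place N w G)ᴴ * place N w G = 1 := by
  rw [conjTranspose_place, ← place_mul, h, place_one]

lemma Gate.conjTranspose_op_mul_self (N : ℕ) (g : Gate) : (g.op N)ᴴ * g.op N = 1 := by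
  cases g <;> refine conjTranspose_place_mul_self _ _ ?_
  · rw [conjTranspose_hGate, hGate_mul_self]
  · exact conjTranspose_tGate_mul_self
  · rw [cnot_eq, conjTranspose_permMat cnotFun_involutive, permMat_mul_self cnotFun_involutive]
  · rw [toffoli_eq, conjTranspose_permMat toffoliFun_involutive,
      permMat_mul_self toffoliFun_involutive]

lemma conjTranspose_gatesOp_mul_self (N : ℕ) (l : List Gate) :
    (gatesOp N l)ᴴ * gatesOp N l = 1 := by
  induction l with
  | nil => simp [gatesOp]
  | cons g l ih =>
    rw [gatesOp, Matrix.conjTranspose_mul, Matrix.mul_assoc, ← Matrix.mul_assoc _ _ (g.op N), ih,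
      Matrix.one_mul, g.conjTranspose_op_mul_self]

/-- Gates that undo a gate. -/
def Gate.inv : Gate → List Gate
  -- T has order 8; the other gates are involutions.
  | .t i => List.replicate 7 (.t i)
  | g => [g]

/-- Gates that undo a circuit. -/
def invGates : List Gate → List Gate
  | [] => []
  | g :: l => invGates l ++ g.inv

lemma gatesOp_inv_mul_op (N : ℕ) (g : Gate) : gatesOp N g.inv * g.op N = 1 := by
  cases g
  · simp only [Gate.inv, gatesOp, one_mul, Gate.op]
    rw [← place_mul, hGate_mul_self, place_one]
  · rename_i i
    simp only [Gate.inv, List.replicate, gatesOp, one_mul, Gate.op]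
    simp only [← place_mul]
    rw [← place_one N ![i], ← tGate_pow_eight]
    simp only [pow_succ, pow_zero, one_mul, mul_assoc]
  · simp only [Gate.inv, gatesOp, one_mul, Gate.op]
    rw [← place_mul, cnot_eq, permMat_mul_self cnotFun_involutive, place_one]
  · simp only [Gate.inv, gatesOp, one_mul, Gate.op]
    rw [← place_mul, toffoli_eq, permMat_mul_self toffoliFun_involutive, place_one]

lemma gatesOp_invGates_mul (N : ℕ) (l : List Gate) : gatesOp N (invGates l) * gatesOp N l = 1 := by
  induction l with
  | nil => simp [gatesOp, invGates]
  | cons g l ih =>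
    rw [invGates, gatesOp_append, gatesOp, Matrix.mul_assoc, ← Matrix.mul_assoc _ _ (g.op N), ih,
      Matrix.one_mul, gatesOp_inv_mul_op]

lemma gatesOp_invGates (N : ℕ) (l : List Gate) : gatesOp N (invGates l) = (gatesOp N l)ᴴ := by
  have h := mul_eq_one_comm.1 (conjTranspose_gatesOp_mul_self N l)
  rw [← Matrix.mul_one (gatesOp N (invGates l)), ← h, ← Matrix.mul_assoc, gatesOp_invGates_mul,
    Matrix.one_mul]

lemma length_invGates_le (l : List Gate) : (invGates l).length ≤ 7 * l.length := by
  induction l with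
  | nil => simp [invGates]
  | cons g l ih => cases g <;> simp [invGates, Gate.inv] <;> omega

/-- All the wires of the gate are smaller than `N`. -/
def Gate.Below (N : ℕ) : Gate → Prop
  | .h i => i < N
  | .t i => i < N
  | .cx i j => i < N ∧ j < N
  | .ccx i j k => i < N ∧ j < N ∧ k < N

lemma Gate.Below.mono {N N' : ℕ} (h : N ≤ N') {g : Gate} (hg : g.Below N) : g.Below N' := by
  cases g <;> simp only [Gate.Below] at * <;> omega

lemma below_invGates {N : ℕ} {l : List Gate} (h : ∀ g ∈ l, g.Below N) :
    ∀ g ∈ invGates l, g.Below N := by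
  induction l with
  | nil => simp [invGates]
  | cons g l ih =>
    intro g' hg'
    rw [invGates, List.mem_append] at hg'
    rcases hg' with hg' | hg'
    · exact ih (fun g hg => h g (List.mem_cons_of_mem _ hg)) _ hg'
    · have : g' = g := by
        cases g <;> simp [Gate.inv] at hg' <;> exact hg'
      exact this ▸ h g List.mem_cons_self

lemma Gate.op_add {N : ℕ} (M : ℕ) {g : Gate} (h : g.Below N) :
    g.op (N + M) = tensor (g.op N) 1 := by
  cases g <;> refine place_tensor_one (fun j => ?_) _ <;> simp only [Gate.Below] at h
  all_goals fin_cases j <;> simp <;> omega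

lemma gatesOp_add {N : ℕ} (M : ℕ) {l : List Gate} (h : ∀ g ∈ l, g.Below N) :
    gatesOp (N + M) l = tensor (gatesOp N l) 1 := by
  induction l with
  | nil => rw [gatesOp, gatesOp, tensor_one_one]
  | cons g l ih =>
    rw [gatesOp, gatesOp, ih fun g hg => h g (List.mem_cons_of_mem _ hg),
      g.op_add M (h g List.mem_cons_self), tensor_mul_tensor, one_mul]

lemma Gate.op_of_not_below {N : ℕ} {g : Gate} (h : ¬ g.Below N) : g.op N = 1 := by
  cases g <;> refine place_of_not_valid (fun H => h ?_) _ <;> simp only [Gate.Below]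
  · exact H.2 0
  · exact H.2 0
  · exact ⟨H.2 0, H.2 1⟩
  · exact ⟨H.2 0, H.2 1, H.2 2⟩

open Classical in
/-- The gates all of whose wires are smaller than `N`. -/
def filterBelow (N : ℕ) (l : List Gate) : List Gate := l.filter fun g => g.Below N

lemma below_filterBelow {N : ℕ} {l : List Gate} : ∀ g ∈ filterBelow N l, g.Below N := by
  intro g hg
  simpa using (List.mem_filter.1 hg).2

/-- Gates with a wire out of range do nothing on `N` qubits but could act once the list is embedded
in a larger circuit. Dropping them lets the test circuit contain the interpreter faithfully. -/
lemma gatesOp_filterBelow (N : ℕ) (l : List Gate) : gatesOp N (filterBelow N l) = gatesOp N l := by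
  induction l with
  | nil => rfl
  | cons g l ih =>
    by_cases h : g.Below N
    · rw [filterBelow, List.filter_cons_of_pos (by simpa using h), gatesOp, gatesOp, ← ih]
      rfl
    · rw [filterBelow, List.filter_cons_of_neg (by simpa using h), gatesOp, g.op_of_not_below h,
        Matrix.mul_one, ← ih]
      rfl

/-! ### Classical reversible circuits -/

/-- On basis states the circuit acts as the map `F` (written on sequences of bits). -/
structure Computes (N : ℕ) (l : List Gate) (F : (ℕ → Bool) → ℕ → Bool) : Prop where
  zeroFrom : ∀ σ, ZeroFrom N σ → ZeroFrom N (F σ)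
  gatesOp_eq : gatesOp N l = permMat fun y => cut N (F (ext y))

lemma Computes.nil (N : ℕ) : Computes N [] id := by
  refine ⟨fun σ h => h, ?_⟩
  rw [gatesOp, ← permMat_id]
  congr 1
  funext y i
  simp [cut]

/-- The field `zeroFrom` makes composition work: the intermediate sequence has no bit set from `N`
on, so cutting it to `N` bits and extending it again loses nothing. -/
lemma Computes.append {N : ℕ} {l l' : List Gate} {F F' : (ℕ → Bool) → ℕ → Bool}
    (h : Computes N l F) (h' : Computes N l' F') : Computes N (l ++ l') (F' ∘ F) := by
  refine ⟨fun σ hσ => h'.1 _ (h.1 _ hσ), ?_⟩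
  rw [gatesOp_append, h.2, h'.2, permMat_mul]
  congr 1
  funext y
  simp only [Function.comp]
  rw [ext_cut (h.1 _ (zeroFrom_ext y))]

lemma Computes.congr {N : ℕ} {l : List Gate} {F F' : (ℕ → Bool) → ℕ → Bool}
    (h : Computes N l F) (hF : ∀ σ w, F σ w = F' σ w) : Computes N l F' := by
  rwa [show F = F' from funext fun σ => funext fun w => hF σ w] at h

lemma place_permMat {N k : ℕ} {w : Fin k → ℕ} (h : Valid N w) {f : Bits k → Bits k}
    {g : Bits N → Bits N} (h1 : ∀ y j, g y (h.fin j) = f (y ∘ h.fin) j)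
    (h2 : ∀ y (i : Fin N), (∀ j, w j ≠ i) → g y i = y i) :
    place N w (permMat f) = permMat g := by
  ext x y
  have hh : Function.Injective w ∧ ∀ j, w j < N := h
  rw [place, dif_pos hh]
  simp only [Matrix.of_apply, permMat]
  have key : x = g y ↔ (∀ i : Fin N, (∀ j, w j ≠ i) → x i = y i) ∧
      (fun j => x ⟨w j, h.2 j⟩) = f (fun j => y ⟨w j, h.2 j⟩) := by
    constructor
    · rintro rfl
      exact ⟨fun i hi => h2 y i hi, funext fun j => h1 y j⟩
    · rintro ⟨H1, H2⟩
      funext i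
      by_cases hi : ∀ j, w j ≠ i
      · rw [H1 i hi, h2 y i hi]
      · push Not at hi
        obtain ⟨j, hj⟩ := hi
        have : i = h.fin j := Fin.ext hj.symm
        rw [this, h1]
        exact congrFun H2 j
  by_cases H1 : ∀ i : Fin N, (∀ j, w j ≠ i) → x i = y i
  · rw [if_pos H1]
    by_cases H2 : (fun j => x ⟨w j, h.2 j⟩) = f (fun j => y ⟨w j, h.2 j⟩)
    · rw [if_pos H2, if_pos (key.2 ⟨H1, H2⟩)]
    · rw [if_neg H2, if_neg fun H => H2 (key.1 H).2]
  · rw [if_neg H1, if_neg fun H => H1 (key.1 H).1]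

lemma zeroFrom_update {N j : ℕ} (hj : j < N) {σ : ℕ → Bool} (h : ZeroFrom N σ) (b : Bool) :
    ZeroFrom N (Function.update σ j b) := fun i hi => by
  rw [Function.update_of_ne (by omega), h i hi]

lemma Computes.cx {N i j : ℕ} (hi : i < N) (hj : j < N) (hij : i ≠ j) :
    Computes N [.cx i j] fun σ => Function.update σ j (xor (σ i) (σ j)) := by
  refine ⟨fun σ h => zeroFrom_update hj h _, ?_⟩
  rw [gatesOp, gatesOp, one_mul, Gate.op, cnot_eq]
  have hv : Valid N ![i, j] := by
    refine ⟨fun a b => ?_, fun a => ?_⟩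
    · fin_cases a <;> fin_cases b <;> simp [hij, hij.symm]
    · fin_cases a <;> simp [hi, hj]
  refine place_permMat hv (fun y a => ?_) fun y a ha => ?_
  · fin_cases a
    · simp [cut, cnotFun, Valid.fin, hij, ext_of_lt y hi]
    · simp [cut, cnotFun, Valid.fin, ext_of_lt y hi, ext_of_lt y hj]
  · have := ha 1
    simp only [Matrix.cons_val_one, Matrix.cons_val_fin_one] at this
    simp [cut, Function.update_of_ne this.symm]

lemma Computes.ccx {N i j k : ℕ} (hi : i < N) (hj : j < N) (hk : k < N) (hij : i ≠ j) (hik : i ≠ k)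
    (hjk : j ≠ k) :
    Computes N [.ccx i j k] fun σ => Function.update σ k (xor (σ i && σ j) (σ k)) := by
  refine ⟨fun σ h => zeroFrom_update hk h _, ?_⟩
  rw [gatesOp, gatesOp, one_mul, Gate.op, toffoli_eq]
  have hv : Valid N ![i, j, k] := by
    refine ⟨fun a b => ?_, fun a => ?_⟩
    · fin_cases a <;> fin_cases b <;> simp [hij, hij.symm, hik, hik.symm, hjk, hjk.symm]
    · fin_cases a <;> simp [hi, hj, hk]
  refine place_permMat hv (fun y a => ?_) fun y a ha => ?_
  · fin_cases a
    · simp [cut, toffoliFun, Valid.fin, hik, ext_of_lt y hi]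
    · simp [cut, toffoliFun, Valid.fin, hjk, ext_of_lt y hj]
    · simp [cut, toffoliFun, Valid.fin, ext_of_lt y hi, ext_of_lt y hj, ext_of_lt y hk]
  · have := ha 2
    simp only [Matrix.cons_val] at this
    simp [cut, Function.update_of_ne this.symm]

/-- The NOT gate, as a sequence of gates of the gate set. -/
def notGate (i : ℕ) : List Gate := [.h i, .t i, .t i, .t i, .t i, .h i]

/-- Instructions that are ignored. -/
def nops (n : ℕ) : List Gate := List.replicate n (.cx 0 0)

/-- A CNOT whose control is its target is not a valid instruction, so `place` ignores it. It still
counts as a gate and so serves as padding. -/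
lemma gatesOp_nops (N n : ℕ) : gatesOp N (nops n) = 1 := by
  induction n with
  | zero => rfl
  | succ n ih =>
    rw [nops, List.replicate_succ, gatesOp, ← nops, ih, one_mul]
    refine place_of_not_valid (fun H => ?_) _
    have := @H.1 0 1 rfl
    simp at this

lemma Computes.nops (N n : ℕ) : Computes N (nops n) id := by
  refine ⟨fun σ h => h, ?_⟩
  rw [gatesOp_nops, ← permMat_id]
  congr 1
  funext y i
  simp [cut]

/-- H T⁴ H = H Z H = X. -/
lemma hGate_mul_tGate_pow_mul_hGate :
    hGate * (tGate * (tGate * (tGate * (tGate * hGate)))) = permMat fun y _ => !(y 0) := by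
  have : hGate * (tGate * (tGate * (tGate * (tGate * hGate)))) =
      hGate * ((tGate * tGate * tGate * tGate) * hGate) := by simp only [mul_assoc]
  rw [this, tGate_pow_four]
  refine op_one_ext fun a b => ?_
  rw [Matrix.mul_apply, sum_bits_one]
  simp only [Matrix.diagonal_mul, hGate_apply, permMat, Matrix.of_apply, const_bool_eq_iff]
  cases a <;> cases b <;> simp only [inv_sqrt_two_mul_self, neg_mul, mul_neg, one_mul, reduceCtorEq,
    and_self, and_true, and_false, if_true, if_false, neg_neg, Bool.not_true, Bool.not_false] <;>
    norm_num

lemma Computes.notGate {N i : ℕ} (hi : i < N) :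
    Computes N (notGate i) fun σ => Function.update σ i (!(σ i)) := by
  refine ⟨fun σ h => zeroFrom_update hi h _, ?_⟩
  simp only [QObf.notGate, gatesOp, one_mul, Gate.op]
  simp only [← place_mul, mul_assoc]
  rw [hGate_mul_tGate_pow_mul_hGate]
  have hv : Valid N ![i] := ⟨fun a b _ => Subsingleton.elim a b, fun a => by simp [hi]⟩
  refine place_permMat hv (fun y a => ?_) fun y a ha => ?_
  · simp [cut, Valid.fin, ext_of_lt y hi]
  · have := ha 0
    simp only [Matrix.cons_val_fin_one] at this
    simp [cut, Function.update_of_ne this.symm]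


/-! ### Multiply controlled gates with borrowed qubits -/

/-- The conjunction of the bits `x, …, x + j`. -/
def conj (x : ℕ) (σ : ℕ → Bool) : ℕ → Bool
  | 0 => σ x
  | j + 1 => σ (x + (j + 1)) && conj x σ j

lemma conj_congr {x : ℕ} {σ τ : ℕ → Bool} {j : ℕ} (h : ∀ i ≤ j, σ (x + i) = τ (x + i)) :
    conj x σ j = conj x τ j := by
  induction j with
  | zero => exact h 0 le_rfl
  | succ j ih => rw [conj, conj, h (j + 1) le_rfl, ih fun i hi => h i (by omega)]

lemma conj_eq_true_iff {x : ℕ} {σ : ℕ → Bool} {j : ℕ} :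
    conj x σ j = true ↔ ∀ i ≤ j, σ (x + i) = true := by
  induction j with
  | zero => simp [conj]
  | succ j ih =>
    rw [conj, Bool.and_eq_true, ih]
    refine ⟨fun ⟨h1, h2⟩ i hi => ?_, fun h => ⟨h _ le_rfl, fun i hi => h i (by omega)⟩⟩
    rcases hi.lt_or_eq with hi | rfl
    · exact h2 i (by omega)
    · exact h1

/-- Adds to each bit `d + i` with `i ≤ j` the conjunction of the bits `x, …, x + i`. -/
def ladder (x d : ℕ) : ℕ → List Gate
  | 0 => [.cx x d]
  | j + 1 => [.ccx (x + (j + 1)) (d + j) (d + (j + 1))] ++ ladder x d j ++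
      [.ccx (x + (j + 1)) (d + j) (d + (j + 1))]

/-- The action of `ladder` on basis states. -/
def ladderFun (x d j : ℕ) (σ : ℕ → Bool) (w : ℕ) : Bool :=
  if d ≤ w ∧ w ≤ d + j then xor (conj x σ (w - d)) (σ w) else σ w

/-- The two outer Toffoli gates add x_{j+1} d_j and x_{j+1} (d_j + c_j) to the top bit, where c_j is
the conjunction that the inner ladder adds to d_j. The unknown d_j cancels and x_{j+1} c_j remains,
so the bits of the ladder need not start at zero. -/
lemma Computes.ladder {N x d j : ℕ} (hx : x + j < d) (hd : d + j < N) :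
    Computes N (ladder x d j) (ladderFun x d j) := by
  induction j with
  | zero =>
    refine (Computes.cx (by omega) (by omega) (by omega)).congr fun σ w => ?_
    rw [ladderFun]
    by_cases h : w = d
    · subst h
      simp [conj]
    · rw [if_neg (by omega), Function.update_of_ne h]
  | succ j ih =>
    have h1 := Computes.ccx (N := N) (i := x + (j + 1)) (j := d + j) (k := d + (j + 1))
      (by omega) (by omega) (by omega) (by omega) (by omega) (by omega)
    refine ((h1.append (ih (by omega) (by omega))).append h1).congr fun σ w => ?_
    simp only [Function.comp]
    set τ := Function.update σ (d + (j + 1)) (xor (σ (x + (j + 1)) && σ (d + j)) (σ (d + (j + 1))))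
      with hτ
    have hne : ∀ w, w ≠ d + (j + 1) → τ w = σ w := fun w hw => Function.update_of_ne hw _ _
    have hc : ∀ i ≤ j, conj x τ i = conj x σ i := fun i hi =>
      conj_congr fun l hl => hne _ (by omega)
    by_cases h : w = d + (j + 1)
    · subst h
      rw [Function.update_self, ladderFun, ladderFun, ladderFun, ladderFun, if_neg (by omega),
        if_pos (by omega), if_neg (by omega), if_pos (by omega), hne _ (by omega), hne _ (by omega),
        hτ, Function.update_self, ← hτ, show d + j - d = j by omega,
        show d + (j + 1) - d = j + 1 by omega, hc _ le_rfl, conj]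
      cases σ (x + (j + 1)) <;> cases σ (d + j) <;> cases σ (d + (j + 1)) <;> cases conj x σ j <;> rfl
    · rw [Function.update_of_ne h, ladderFun, ladderFun, hne _ h]
      by_cases h2 : d ≤ w ∧ w ≤ d + j
      · rw [if_pos h2, if_pos (by omega), hc _ (by omega)]
      · rw [if_neg h2, if_neg (by omega)]

/-- Flips the bit `d + j + 1` if all the bits `x, …, x + j + 1` are set; the bits `d, …, d + j` are
borrowed. -/
def multiControl (x d j : ℕ) : List Gate := ladder x d (j + 1) ++ ladder x d j

/-- The action of `multiControl` on basis states. -/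
def multiControlFun (x d j : ℕ) (σ : ℕ → Bool) : ℕ → Bool :=
  Function.update σ (d + (j + 1)) (xor (conj x σ (j + 1)) (σ (d + (j + 1))))

/-- The second ladder is one rung shorter: it undoes the additions to the borrowed bits and leaves
the one to the top bit. -/
lemma Computes.multiControl {N x d j : ℕ} (hx : x + (j + 1) < d) (hd : d + (j + 1) < N) :
    Computes N (multiControl x d j) (multiControlFun x d j) := by
  refine ((Computes.ladder hx hd).append
    (Computes.ladder (by omega) (by omega))).congr fun σ w => ?_
  simp only [Function.comp]
  have hc : ∀ i ≤ j, conj x (ladderFun x d (j + 1) σ) i = conj x σ i := fun i hi =>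
    conj_congr fun l hl => by rw [ladderFun, if_neg (by omega)]
  rw [multiControlFun]
  by_cases h : w = d + (j + 1)
  · subst h
    rw [Function.update_self, ladderFun, if_neg (by omega), ladderFun, if_pos (by omega)]
    congr 2
    omega
  · rw [Function.update_of_ne h, ladderFun]
    by_cases h2 : d ≤ w ∧ w ≤ d + j
    · rw [if_pos h2, hc _ (by omega), ladderFun, if_pos (by omega)]
      simp
    · rw [if_neg h2, ladderFun, if_neg (by omega)]

lemma length_ladder (x d j : ℕ) : (ladder x d j).length = 2 * j + 1 := by
  induction j with
  | zero => rfl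
  | succ j ih => simp [ladder, ih]; omega

lemma length_multiControl (x d j : ℕ) : (multiControl x d j).length = 4 * j + 4 := by
  simp [multiControl, length_ladder]; omega

lemma below_ladder {N x d j : ℕ} (hx : x + j < N) (hd : d + j < N) :
    ∀ g ∈ ladder x d j, g.Below N := by
  induction j with
  | zero => simp [ladder, Gate.Below]; omega
  | succ j ih =>
    intro g hg
    simp only [ladder, List.mem_append, List.mem_singleton] at hg
    rcases hg with (rfl | hg) | rfl
    · simp only [Gate.Below]; omega
    · exact ih (by omega) (by omega) g hg
    · simp only [Gate.Below]; omega

lemma below_multiControl {N x d j : ℕ} (hx : x + (j + 1) < N) (hd : d + (j + 1) < N) :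
    ∀ g ∈ multiControl x d j, g.Below N := by
  intro g hg
  rw [multiControl, List.mem_append] at hg
  exact hg.elim (below_ladder hx hd g) (below_ladder (by omega) (by omega) g)

/-! ### Layers of gates -/

/-- Flips the bits `x + i`, `i < m`, for which `a i` is set. -/
def flips (x : ℕ) (a : ℕ → Bool) : ℕ → List Gate
  | 0 => []
  | m + 1 => flips x a m ++ (if a m then notGate (x + m) else nops 6)

/-- The action of `flips` on basis states. -/
def flipsFun (x : ℕ) (a : ℕ → Bool) (m : ℕ) (σ : ℕ → Bool) (w : ℕ) : Bool :=
  if x ≤ w ∧ w < x + m then xor (a (w - x)) (σ w) else σ w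

lemma Computes.flips {N x : ℕ} (a : ℕ → Bool) {m : ℕ} (hx : x + m ≤ N) :
    Computes N (flips x a m) (flipsFun x a m) := by
  induction m with
  | zero =>
    refine (Computes.nil N).congr fun σ w => ?_
    rw [flipsFun, if_neg (by omega), id]
  | succ m ih =>
    have h1 := ih (by omega)
    rw [QObf.flips]
    by_cases h : a m = true
    · rw [if_pos h]
      refine (h1.append (Computes.notGate (by omega))).congr fun σ w => ?_
      simp only [Function.comp]
      by_cases hw : w = x + m
      · subst hw
        rw [Function.update_self, flipsFun, flipsFun, if_neg (by omega), if_pos (by omega),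
          show x + m - x = m by omega, h]
        simp
      · rw [Function.update_of_ne hw, flipsFun, flipsFun]
        by_cases h2 : x ≤ w ∧ w < x + m
        · rw [if_pos h2, if_pos (by omega)]
        · rw [if_neg h2, if_neg (by omega)]
    · rw [if_neg h]
      refine (h1.append (Computes.nops N 6)).congr fun σ w => ?_
      simp only [Function.comp, id]
      rw [flipsFun, flipsFun]
      by_cases hw : w = x + m
      · subst hw
        rw [if_neg (by omega), if_pos (by omega), show x + m - x = m by omega]
        simp [h]
      · by_cases h2 : x ≤ w ∧ w < x + m
        · rw [if_pos h2, if_pos (by omega)]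
        · rw [if_neg h2, if_neg (by omega)]

/-- Adds the bit `z` to the bits `y + i`, `i < m`, for which `b i` is set. -/
def fanout (z y : ℕ) (b : ℕ → Bool) : ℕ → List Gate
  | 0 => []
  | m + 1 => fanout z y b m ++ (if b m then [.cx z (y + m)] else nops 1)

/-- The action of `fanout` on basis states. -/
def fanoutFun (z y : ℕ) (b : ℕ → Bool) (m : ℕ) (σ : ℕ → Bool) (w : ℕ) : Bool :=
  if y ≤ w ∧ w < y + m then xor (b (w - y) && σ z) (σ w) else σ w

lemma Computes.fanout {N z y : ℕ} (b : ℕ → Bool) {m : ℕ} (hz : z < y) (hy : y + m ≤ N) :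
    Computes N (fanout z y b m) (fanoutFun z y b m) := by
  induction m with
  | zero =>
    refine (Computes.nil N).congr fun σ w => ?_
    rw [fanoutFun, if_neg (by omega), id]
  | succ m ih =>
    have h1 := ih (by omega)
    rw [QObf.fanout]
    by_cases h : b m = true
    · rw [if_pos h]
      refine (h1.append (Computes.cx (by omega) (by omega) (by omega))).congr fun σ w => ?_
      simp only [Function.comp]
      by_cases hw : w = y + m
      · subst hw
        rw [Function.update_self, fanoutFun, fanoutFun, fanoutFun, if_neg (by omega),
          if_neg (by omega), if_pos (by omega), show y + m - y = m by omega, h]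
        simp
      · rw [Function.update_of_ne hw, fanoutFun, fanoutFun]
        by_cases h2 : y ≤ w ∧ w < y + m
        · rw [if_pos h2, if_pos (by omega)]
        · rw [if_neg h2, if_neg (by omega)]
    · rw [if_neg h]
      refine (h1.append (Computes.nops N 1)).congr fun σ w => ?_
      simp only [Function.comp, id]
      rw [fanoutFun, fanoutFun]
      by_cases hw : w = y + m
      · subst hw
        rw [if_neg (by omega), if_pos (by omega), show y + m - y = m by omega]
        simp [h]
      · by_cases h2 : y ≤ w ∧ w < y + m
        · rw [if_pos h2, if_pos (by omega)]
        · rw [if_neg h2, if_neg (by omega)]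

/-- The padding makes the count independent of `a`. The simulator is told the number of gates, which
must not vary with the hidden strings. -/
lemma length_flips (x : ℕ) (a : ℕ → Bool) (m : ℕ) : (flips x a m).length = 6 * m := by
  induction m with
  | zero => rfl
  | succ m ih =>
    rw [flips, List.length_append, ih]
    split_ifs <;> simp [notGate, nops] <;> omega

lemma length_fanout (z y : ℕ) (b : ℕ → Bool) (m : ℕ) : (fanout z y b m).length = m := by
  induction m with
  | zero => rfl
  | succ m ih =>
    rw [fanout, List.length_append, ih]
    split_ifs <;> simp [nops]

lemma below_nops {N : ℕ} (hN : 0 < N) (n : ℕ) : ∀ g ∈ nops n, g.Below N := by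
  intro g hg
  rw [List.eq_of_mem_replicate hg]
  exact ⟨hN, hN⟩

lemma below_flips {N x : ℕ} (a : ℕ → Bool) {m : ℕ} (hx : x + m ≤ N) :
    ∀ g ∈ flips x a m, g.Below N := by
  induction m with
  | zero => simp [flips]
  | succ m ih =>
    intro g hg
    rw [flips, List.mem_append] at hg
    rcases hg with hg | hg
    · exact ih (by omega) g hg
    · split_ifs at hg
      · simp only [notGate, List.mem_cons, List.not_mem_nil, or_false] at hg
        rcases hg with rfl | rfl | rfl | rfl | rfl | rfl <;> simp only [Gate.Below] <;> omega
      · exact below_nops (by omega) _ g hg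

lemma below_fanout {N z y : ℕ} (b : ℕ → Bool) {m : ℕ} (hz : z < N) (hy : y + m ≤ N) :
    ∀ g ∈ fanout z y b m, g.Below N := by
  induction m with
  | zero => simp [fanout]
  | succ m ih =>
    intro g hg
    rw [fanout, List.mem_append] at hg
    rcases hg with hg | hg
    · exact ih (by omega) g hg
    · split_ifs at hg
      · simp only [List.mem_singleton] at hg
        subst hg
        simp only [Gate.Below]
        omega
      · exact below_nops (by omega) _ g hg

/-! ### Comparison with a fixed string -/

/-- The `m` bits from position `x` on are those of `a`. -/
def Matches (x : ℕ) (a : ℕ → Bool) (m : ℕ) (σ : ℕ → Bool) : Prop := ∀ i < m, σ (x + i) = a i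

lemma conj_flipsFun_not_iff {x : ℕ} {a : ℕ → Bool} {j : ℕ} {σ : ℕ → Bool} :
    conj x (flipsFun x (fun i => !(a i)) (j + 2) σ) (j + 1) = true ↔ Matches x a (j + 2) σ := by
  rw [conj_eq_true_iff, Matches]
  have : ∀ i, (i ≤ j + 1 → flipsFun x (fun i => !(a i)) (j + 2) σ (x + i) = true) ↔
      (i < j + 2 → σ (x + i) = a i) := fun i => by
    by_cases hi : i ≤ j + 1
    · rw [flipsFun, if_pos (by omega), show x + i - x = i by omega]
      simp only [hi, show i < j + 2 by omega, true_imp_iff]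
      cases a i <;> cases σ (x + i) <;> simp
    · simp [hi, show ¬ i < j + 2 by omega]
  exact forall_congr' this

/-- Flips the bit `d + j + 1` if the bits from position `x` on are those of `a`. -/
def matchFlip (x d : ℕ) (a : ℕ → Bool) (j : ℕ) : List Gate :=
  flips x (fun i => !(a i)) (j + 2) ++ multiControl x d j ++ flips x (fun i => !(a i)) (j + 2)

open Classical in
/-- The action of `matchFlip` on basis states. -/
def matchFlipFun (x d : ℕ) (a : ℕ → Bool) (j : ℕ) (σ : ℕ → Bool) : ℕ → Bool :=
  Function.update σ (d + (j + 1)) (xor (decide (Matches x a (j + 2) σ)) (σ (d + (j + 1))))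

lemma flipsFun_flipsFun (x : ℕ) (a : ℕ → Bool) (m : ℕ) (σ : ℕ → Bool) :
    flipsFun x a m (flipsFun x a m σ) = σ := by
  funext w
  by_cases h : x ≤ w ∧ w < x + m
  · rw [flipsFun, if_pos h, flipsFun, if_pos h]
    simp
  · rw [flipsFun, if_neg h, flipsFun, if_neg h]

lemma flipsFun_update {x m t : ℕ} (ht : x + m ≤ t) (a : ℕ → Bool) (σ : ℕ → Bool) (c : Bool) :
    flipsFun x a m (Function.update σ t c) = Function.update (flipsFun x a m σ) t c := by
  funext w
  by_cases h : x ≤ w ∧ w < x + m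
  · rw [flipsFun, if_pos h, Function.update_of_ne (by omega), Function.update_of_ne (by omega),
      flipsFun, if_pos h]
  · by_cases hw : w = t
    · subst hw
      rw [flipsFun, if_neg h, Function.update_self, Function.update_self]
    · rw [flipsFun, if_neg h, Function.update_of_ne hw, Function.update_of_ne hw,
        flipsFun, if_neg h]

/-- Flipping the bits on which `a` vanishes turns agreement with `a` into a conjunction. The target
lies outside the flipped range, so the second layer of flips commutes with the controlled flip and
cancels the first. -/
lemma Computes.matchFlip {N x d j : ℕ} (a : ℕ → Bool) (hx : x + (j + 1) < d)
    (hd : d + (j + 1) < N) : Computes N (matchFlip x d a j) (matchFlipFun x d a j) := by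
  classical
  have h1 := Computes.flips (N := N) (x := x) (fun i => !(a i)) (m := j + 2) (by omega)
  refine ((h1.append (Computes.multiControl hx hd)).append h1).congr fun σ w => ?_
  refine congrFun ?_ w
  simp only [Function.comp]
  rw [multiControlFun, flipsFun_update (by omega), flipsFun_flipsFun, matchFlipFun]
  congr 2
  · rw [Bool.eq_iff_iff, conj_flipsFun_not_iff, decide_eq_true_iff]
  · rw [flipsFun, if_neg (by omega)]

lemma length_matchFlip (x d : ℕ) (a : ℕ → Bool) (j : ℕ) :
    (matchFlip x d a j).length = 16 * j + 28 := by
  simp [matchFlip, length_flips, length_multiControl]; omega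

lemma below_matchFlip {N x d j : ℕ} (a : ℕ → Bool) (hx : x + (j + 1) < N)
    (hd : d + (j + 1) < N) : ∀ g ∈ matchFlip x d a j, g.Below N := by
  intro g hg
  simp only [matchFlip, List.mem_append] at hg
  rcases hg with (hg | hg) | hg
  · exact below_flips _ (by omega) g hg
  · exact below_multiControl hx hd g hg
  · exact below_flips _ (by omega) g hg

/-! ### The point function -/

/-- The gates of the circuit that adds the string `b` to the last of three registers of `j + 2`
qubits if the content of the first is `a`; the second register is borrowed. -/
def pointGates (j : ℕ) (a b : ℕ → Bool) : List Gate :=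
  fanout (2 * j + 3) (2 * j + 4) b (j + 2) ++ matchFlip 0 (j + 2) a j ++
    (fanout (2 * j + 3) (2 * j + 4) b (j + 2) ++ matchFlip 0 (j + 2) a j)

open Classical in
/-- The action of `pointGates` on basis states. -/
def pointFun (j : ℕ) (a b : ℕ → Bool) (σ : ℕ → Bool) (w : ℕ) : Bool :=
  if 2 * j + 4 ≤ w ∧ w < 2 * j + 4 + (j + 2) then
    xor (b (w - (2 * j + 4)) && decide (Matches 0 a (j + 2) σ)) (σ w) else σ w

lemma matches_congr {x m : ℕ} {a σ τ : ℕ → Bool} (h : ∀ i < m, σ (x + i) = τ (x + i)) :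
    Matches x a m σ ↔ Matches x a m τ := by
  unfold Matches
  refine forall_congr' fun i => forall_congr' fun hi => ?_
  rw [h i hi]

/-- Let z be the last bit of the second register and c the truth value of the match. The first
fanout adds b z, the comparison changes z to z + c, the second fanout adds b (z + c), and the last
comparison restores z. The net effect is b c, whatever z was. -/
lemma Computes.point (j : ℕ) (a b : ℕ → Bool) :
    Computes (3 * (j + 2)) (pointGates j a b) (pointFun j a b) := by
  classical
  have h1 := Computes.fanout (N := 3 * (j + 2)) (z := 2 * j + 3) (y := 2 * j + 4) b (m := j + 2)
    (by omega) (by omega)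
  have h2 := Computes.matchFlip (N := 3 * (j + 2)) (x := 0) (d := j + 2) (j := j) a
    (by omega) (by omega)
  have h3 := h1.append h2
  refine (h3.append h3).congr fun σ w => ?_
  simp only [Function.comp]
  set σ₁ := fanoutFun (2 * j + 3) (2 * j + 4) b (j + 2) σ with hσ₁
  set σ₂ := matchFlipFun 0 (j + 2) a j σ₁ with hσ₂
  set σ₃ := fanoutFun (2 * j + 3) (2 * j + 4) b (j + 2) σ₂ with hσ₃
  have e1 : ∀ w, ¬ (2 * j + 4 ≤ w ∧ w < 2 * j + 4 + (j + 2)) → σ₁ w = σ w := fun w hw => if_neg hw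
  have e3 : ∀ w, ¬ (2 * j + 4 ≤ w ∧ w < 2 * j + 4 + (j + 2)) → σ₃ w = σ₂ w := fun w hw => if_neg hw
  have e2 : ∀ w, w ≠ j + 2 + (j + 1) → σ₂ w = σ₁ w := fun w hw => Function.update_of_ne hw _ _
  have m1 : Matches 0 a (j + 2) σ₁ ↔ Matches 0 a (j + 2) σ :=
    matches_congr fun i hi => e1 _ (by omega)
  have m3 : Matches 0 a (j + 2) σ₃ ↔ Matches 0 a (j + 2) σ := by
    rw [← m1]
    exact matches_congr fun i hi => by rw [e3 _ (by omega), e2 _ (by omega)]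
  have e2' : σ₂ (2 * j + 3) = xor (decide (Matches 0 a (j + 2) σ)) (σ (2 * j + 3)) := by
    rw [hσ₂, matchFlipFun, show j + 2 + (j + 1) = 2 * j + 3 by omega, Function.update_self,
      e1 _ (by omega)]
    simp only [m1]
  rw [pointFun]
  by_cases hw : w = 2 * j + 3
  · subst hw
    rw [matchFlipFun, show j + 2 + (j + 1) = 2 * j + 3 by omega, Function.update_self,
      e3 _ (by omega), e2', if_neg (by omega)]
    simp only [m3]
    simp
  · rw [matchFlipFun, Function.update_of_ne (by omega)]
    by_cases hw2 : 2 * j + 4 ≤ w ∧ w < 2 * j + 4 + (j + 2)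
    · rw [if_pos hw2, hσ₃, fanoutFun, if_pos hw2, e2', e2 _ (by omega), hσ₁, fanoutFun, if_pos hw2]
      cases b (w - (2 * j + 4)) <;> cases decide (Matches 0 a (j + 2) σ) <;>
        cases σ (2 * j + 3) <;> cases σ w <;> rfl
    · rw [if_neg hw2, e3 _ hw2, e2 _ (by omega), e1 _ hw2]

lemma length_pointGates (j : ℕ) (a b : ℕ → Bool) : (pointGates j a b).length = 34 * j + 60 := by
  simp [pointGates, length_fanout, length_matchFlip]; omega

lemma below_pointGates (j : ℕ) (a b : ℕ → Bool) :
    ∀ g ∈ pointGates j a b, g.Below (3 * (j + 2)) := by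
  intro g hg
  have h1 := below_fanout (N := 3 * (j + 2)) (z := 2 * j + 3) (y := 2 * j + 4) b (m := j + 2)
    (by omega) (by omega)
  have h2 := below_matchFlip (N := 3 * (j + 2)) (x := 0) (d := j + 2) (j := j) a
    (by omega) (by omega)
  simp only [pointGates, List.mem_append] at hg
  rcases hg with (hg | hg) | (hg | hg)
  exacts [h1 g hg, h2 g hg, h1 g hg, h2 g hg]


/-! ### Operators close to the identity -/

/-- The square of the Euclidean norm. -/
def nsq {ι : Type*} [Fintype ι] (ψ : ι → ℂ) : ℝ := ∑ x, ‖ψ x‖ ^ 2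

lemma nsq_nonneg {ι : Type*} [Fintype ι] (ψ : ι → ℂ) : 0 ≤ nsq ψ :=
  Finset.sum_nonneg fun _ _ => sq_nonneg _

lemma nsq_neg {ι : Type*} [Fintype ι] (ψ : ι → ℂ) : nsq (-ψ) = nsq ψ := by simp [nsq]

lemma nsq_zero {ι : Type*} [Fintype ι] : nsq (0 : ι → ℂ) = 0 := by simp [nsq]

lemma ofReal_nsq {ι : Type*} [Fintype ι] (ψ : ι → ℂ) : (nsq ψ : ℂ) = star ψ ⬝ᵥ ψ := by
  rw [nsq, dotProduct]
  push_cast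
  exact Finset.sum_congr rfl fun x _ => (Complex.conj_mul' (ψ x)).symm

/-- The operator preserves the norm. -/
def IsIso {k : ℕ} (U : Op k) : Prop := ∀ ψ, nsq (U *ᵥ ψ) = nsq ψ

lemma isIso_of_conjTranspose_mul_self {k : ℕ} {U : Op k} (h : Uᴴ * U = 1) : IsIso U := fun ψ => by
  have : (nsq (U *ᵥ ψ) : ℂ) = nsq ψ := by
    rw [ofReal_nsq, ofReal_nsq, Matrix.star_mulVec, ← Matrix.dotProduct_mulVec,
      Matrix.mulVec_mulVec, h, Matrix.one_mulVec]
  exact_mod_cast this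

/-- On average over `s`, the operator `U s` moves no vector by much. -/
def Spread {ι : Type*} [Fintype ι] {k : ℕ} (U : ι → Op k) (c : ℝ) : Prop :=
  ∀ ψ, ∑ s, nsq (U s *ᵥ ψ - ψ) ≤ c * nsq ψ

lemma Spread.mono {ι : Type*} [Fintype ι] {k : ℕ} {U : ι → Op k} {c c' : ℝ} (h : Spread U c)
    (hc : c ≤ c') : Spread U c' := fun ψ =>
  (h ψ).trans (mul_le_mul_of_nonneg_right hc (nsq_nonneg ψ))

lemma Spread.one {ι : Type*} [Fintype ι] (k : ℕ) {c : ℝ} (hc : 0 ≤ c) :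
    Spread (fun _ : ι => (1 : Op k)) c := fun ψ => by
  simp only [Matrix.one_mulVec, sub_self, nsq_zero, Finset.sum_const_zero]
  exact mul_nonneg hc (nsq_nonneg ψ)

/-- Applying the isometry U shows that Uᴴ moves a vector exactly as far as U does. -/
lemma Spread.conjTranspose {ι : Type*} [Fintype ι] {k : ℕ} {U : ι → Op k} {c : ℝ}
    (h : Spread U c) (hU : ∀ s, (U s)ᴴ * U s = 1) : Spread (fun s => (U s)ᴴ) c := fun ψ => by
  refine le_trans (le_of_eq ?_) (h ψ)
  refine Finset.sum_congr rfl fun s _ => ?_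
  rw [← isIso_of_conjTranspose_mul_self (hU s) ((U s)ᴴ *ᵥ ψ - ψ), Matrix.mulVec_sub,
    Matrix.mulVec_mulVec, mul_eq_one_comm.1 (hU s), Matrix.one_mulVec, ← nsq_neg, neg_sub]

lemma nsq_eq_sum_slices {ι κ ρ : Type*} [Fintype ι] [Fintype κ] [Fintype ρ] (e : ι ≃ κ × ρ)
    (ψ : ι → ℂ) : nsq ψ = ∑ r, nsq fun u => ψ (e.symm (u, r)) := by
  rw [nsq, ← e.symm.sum_comp, Fintype.sum_prod_type_right]
  rfl

lemma place_mulVec_slice {N k : ℕ} {w : Fin k → ℕ} (h : Valid N w) (G : Op k) (ψ : Bits N → ℂ)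
    (r : _) :
    (fun u => (place N w G *ᵥ ψ) ((splitEquiv h.fin_injective).symm (u, r))) =
      G *ᵥ fun u => ψ ((splitEquiv h.fin_injective).symm (u, r)) := by
  funext u
  rw [Matrix.mulVec, dotProduct, Matrix.mulVec, dotProduct,
    ← (splitEquiv h.fin_injective).symm.sum_comp, Fintype.sum_prod_type]
  refine Finset.sum_congr rfl fun u' _ => ?_
  simp [place_apply h, Matrix.one_apply]

lemma IsIso.one (k : ℕ) : IsIso (1 : Op k) := fun ψ => by rw [Matrix.one_mulVec]

lemma IsIso.place {k : ℕ} {G : Op k} (hG : IsIso G) (N : ℕ) (w : Fin k → ℕ) :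
    IsIso (place N w G) := by
  by_cases h : Valid N w
  · intro ψ
    rw [nsq_eq_sum_slices (splitEquiv h.fin_injective),
      nsq_eq_sum_slices (splitEquiv h.fin_injective) ψ]
    refine Finset.sum_congr rfl fun r _ => ?_
    rw [place_mulVec_slice h, hG]
  · rw [place_of_not_valid h]
    exact IsIso.one N

/-- For each setting of the remaining qubits, the slice of the vector is acted on by `U s` alone,
and squared norms add over slices. The constant therefore does not depend on the number of ambient
qubits. -/
lemma Spread.place {ι : Type*} [Fintype ι] {k : ℕ} {U : ι → Op k} {c : ℝ} (hU : Spread U c)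
    (hc : 0 ≤ c) (N : ℕ) (w : Fin k → ℕ) : Spread (fun s => place N w (U s)) c := by
  by_cases h : Valid N w
  · intro ψ
    have : ∀ s, nsq (QObf.place N w (U s) *ᵥ ψ - ψ) =
        ∑ r, nsq (U s *ᵥ (fun u => ψ ((splitEquiv h.fin_injective).symm (u, r))) -
          fun u => ψ ((splitEquiv h.fin_injective).symm (u, r))) := fun s => by
      rw [nsq_eq_sum_slices (splitEquiv h.fin_injective)]
      refine Finset.sum_congr rfl fun r _ => ?_
      rw [← place_mulVec_slice h]
      rfl
    simp only [this]
    rw [Finset.sum_comm, nsq_eq_sum_slices (splitEquiv h.fin_injective) ψ, Finset.mul_sum]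
    exact Finset.sum_le_sum fun r _ => hU _
  · simp only [place_of_not_valid h]
    exact Spread.one N hc

lemma nsq_cons {k : ℕ} (ψ : Bits (k + 1) → ℂ) :
    nsq ψ = nsq (fun u : Bits k => ψ (Fin.cons true u)) +
      nsq (fun u : Bits k => ψ (Fin.cons false u)) := by
  rw [nsq, ← (Fin.consEquiv fun _ : Fin (k + 1) => Bool).sum_comp, Fintype.sum_prod_type,
    Fintype.sum_bool]
  rfl

lemma controlled_mulVec_cons {k : ℕ} (U : Op k) (ψ : Bits (k + 1) → ℂ) (b : Bool) :
    (fun u : Bits k => (controlled U *ᵥ ψ) (Fin.cons b u)) =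
      (if b = true then U else 1) *ᵥ fun u => ψ (Fin.cons b u) := by
  funext u
  rw [Matrix.mulVec, dotProduct, Matrix.mulVec, dotProduct,
    ← (Fin.consEquiv fun _ : Fin (k + 1) => Bool).sum_comp, Fintype.sum_prod_type,
    Fintype.sum_bool]
  cases b
  · simp [controlled, Fin.consEquiv]
    rfl
  · simp [controlled, Fin.consEquiv]

lemma IsIso.controlled {k : ℕ} {U : Op k} (hU : IsIso U) : IsIso (controlled U) := fun ψ => by
  rw [nsq_cons, nsq_cons ψ, controlled_mulVec_cons, controlled_mulVec_cons]
  simp [hU _]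

/-- Only the half of the vector with the control set is moved. -/
lemma Spread.controlled {ι : Type*} [Fintype ι] {k : ℕ} {U : ι → Op k} {c : ℝ} (hU : Spread U c)
    (hc : 0 ≤ c) : Spread (fun s => controlled (U s)) c := fun ψ => by
  have : ∀ s, nsq (QObf.controlled (U s) *ᵥ ψ - ψ) =
      nsq (U s *ᵥ (fun u => ψ (Fin.cons true u)) - fun u => ψ (Fin.cons true u)) := fun s => by
    have h1 := controlled_mulVec_cons (U s) ψ true
    have h2 := controlled_mulVec_cons (U s) ψ false
    rw [if_pos rfl] at h1
    rw [if_neg (by simp), Matrix.one_mulVec] at h2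
    rw [nsq_cons, ← h1]
    have h3 : nsq (fun u : Bits k => (QObf.controlled (U s) *ᵥ ψ - ψ) (Fin.cons false u)) = 0 := by
      have : (fun u : Bits k => (QObf.controlled (U s) *ᵥ ψ - ψ) (Fin.cons false u)) = 0 := by
        funext u
        rw [Pi.sub_apply, show (QObf.controlled (U s) *ᵥ ψ) (Fin.cons false u) =
          ψ (Fin.cons false u) from congrFun h2 u]
        simp
      rw [this, nsq_zero]
    rw [h3, add_zero]
    rfl
  simp only [this]
  refine (hU _).trans (mul_le_mul_of_nonneg_left ?_ hc)
  rw [nsq_cons ψ]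
  linarith [nsq_nonneg fun u : Bits k => ψ (Fin.cons false u)]

lemma controlled_one (k : ℕ) : controlled (1 : Op k) = 1 := by
  ext x y
  simp only [controlled, Matrix.of_apply, ite_self, Matrix.one_apply]
  have : x = y ↔ x 0 = y 0 ∧ Fin.tail x = Fin.tail y := by
    conv_lhs => rw [← Fin.cons_self_tail x, ← Fin.cons_self_tail y]
    exact Fin.cons_inj
  by_cases h : x = y
  · subst h; simp
  · rw [if_neg h]
    split_ifs with h1 h2
    · exact absurd (this.2 ⟨h1, h2⟩) h
    · rfl
    · rfl

/-! ### Queries to oracles close to the identity -/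

lemma IsIso.queryOp {k : ℕ} {U : Op k} (hU : Uᴴ * U = 1) (N : ℕ) (i c : Bool) (w : List ℕ) :
    IsIso (queryOp N U i c w) := by
  have hV : IsIso (if i = true then Uᴴ else U) := by
    split_ifs
    · refine isIso_of_conjTranspose_mul_self ?_
      rw [Matrix.conjTranspose_conjTranspose, mul_eq_one_comm.1 hU]
    · exact isIso_of_conjTranspose_mul_self hU
  rw [QObf.queryOp]
  split_ifs with h1 h2 h3 h2 h3
  · rw [if_pos h3] at hV; exact hV.controlled.place _ _
  · rw [if_neg h3] at hV; exact hV.controlled.place _ _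
  · exact IsIso.one N
  · rw [if_pos h3] at hV; exact hV.place _ _
  · rw [if_neg h3] at hV; exact hV.place _ _
  · exact IsIso.one N

lemma queryOp_one (N k : ℕ) (i c : Bool) (w : List ℕ) : queryOp N (1 : Op k) i c w = 1 := by
  rw [queryOp]
  simp [controlled_one, place_one]

lemma Spread.queryOp {ι : Type*} [Fintype ι] {k : ℕ} {U : ι → Op k} {r : ℝ} (hr : 0 ≤ r)
    (h : Spread U r) (hU : ∀ s, (U s)ᴴ * U s = 1) (N : ℕ) (i c : Bool) (w : List ℕ) :
    Spread (fun s => queryOp N (U s) i c w) r := by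
  have h' := h.conjTranspose hU
  unfold QObf.queryOp
  cases i <;> cases c <;> simp only [if_true, if_false, reduceCtorEq] <;> split_ifs
  · exact h.place hr _ _
  · exact Spread.one N hr
  · exact (h.controlled hr).place hr _ _
  · exact Spread.one N hr
  · exact h'.place hr _ _
  · exact Spread.one N hr
  · exact (h'.controlled hr).place hr _ _
  · exact Spread.one N hr

lemma isIso_ogateOp {k₁ k₂ : ℕ} {U₁ : Op k₁} {U₂ : Op k₂} (h₁ : U₁ᴴ * U₁ = 1) (h₂ : U₂ᴴ * U₂ = 1)
    (N : ℕ) (g : OGate) : IsIso (g.op N U₁ U₂) := by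
  cases g with
  | gate g => exact isIso_of_conjTranspose_mul_self (g.conjTranspose_op_mul_self N)
  | query s i c w =>
    rw [OGate.op]
    split_ifs
    · exact IsIso.queryOp h₂ _ _ _ _
    · exact IsIso.queryOp h₁ _ _ _ _

lemma isIso_ogatesOp {k₁ k₂ : ℕ} {U₁ : Op k₁} {U₂ : Op k₂} (h₁ : U₁ᴴ * U₁ = 1)
    (h₂ : U₂ᴴ * U₂ = 1) (N : ℕ) (l : List OGate) : IsIso (ogatesOp N U₁ U₂ l) := by
  induction l with
  | nil => exact IsIso.one N
  | cons g l ih =>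
    intro ψ
    rw [ogatesOp, ← Matrix.mulVec_mulVec, ih, isIso_ogateOp h₁ h₂]

lemma sum_nsq_ogateOp_sub_le {ι : Type*} [Fintype ι] {k₁ k₂ : ℕ} {U₁ : ι → Op k₁} {U₂ : ι → Op k₂}
    {r : ℝ} (hr : 0 ≤ r) (h₁ : Spread U₁ r) (h₂ : Spread U₂ r) (hU₁ : ∀ s, (U₁ s)ᴴ * U₁ s = 1)
    (hU₂ : ∀ s, (U₂ s)ᴴ * U₂ s = 1) (N : ℕ) (g : OGate) (ψ : Bits N → ℂ) :
    ∑ s, nsq (g.op N (U₁ s) (U₂ s) *ᵥ ψ - g.op N (1 : Op k₁) (1 : Op k₂) *ᵥ ψ) ≤ r * nsq ψ := by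
  cases g with
  | gate g =>
    simp only [OGate.op, sub_self, nsq_zero, Finset.sum_const_zero]
    exact mul_nonneg hr (nsq_nonneg ψ)
  | query s i c w =>
    cases s <;> simp only [OGate.op, reduceCtorEq, if_true, if_false, queryOp_one,
      Matrix.one_mulVec]
    · exact h₁.queryOp hr hU₁ N i c w ψ
    · exact h₂.queryOp hr hU₂ N i c w ψ

/-- This is ‖φ + ψ‖² ≤ (1 + t)‖φ‖² + (1 + 1/t)‖ψ‖², multiplied by t. With these weights, a bound t²
after t gates becomes exactly (t + 1)² after one more. -/
lemma mul_nsq_add_le {ι : Type*} [Fintype ι] (φ ψ : ι → ℂ) {t : ℝ} (ht : 0 ≤ t) :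
    t * nsq (φ + ψ) ≤ t * (t + 1) * nsq φ + (t + 1) * nsq ψ := by
  rw [nsq, nsq, nsq, Finset.mul_sum, Finset.mul_sum, Finset.mul_sum, ← Finset.sum_add_distrib]
  refine Finset.sum_le_sum fun x _ => ?_
  have h : ‖(φ + ψ) x‖ ≤ ‖φ x‖ + ‖ψ x‖ := norm_add_le _ _
  have h2 : ‖(φ + ψ) x‖ ^ 2 ≤ (‖φ x‖ + ‖ψ x‖) ^ 2 := pow_le_pow_left₀ (norm_nonneg _) h 2
  calc t * ‖(φ + ψ) x‖ ^ 2 ≤ t * (‖φ x‖ + ‖ψ x‖) ^ 2 := mul_le_mul_of_nonneg_left h2 ht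
    _ ≤ _ := by nlinarith [sq_nonneg (t * ‖φ x‖ - ‖ψ x‖)]

/-- Hybrid argument. The first gate is exchanged for its version with identity oracles; the
remaining gates preserve the norm of the error. The vector φ passed on to them comes from the
identity run, so it does not depend on the index, and the averaged bound applies again. -/
lemma sum_nsq_ogatesOp_sub_le {ι : Type*} [Fintype ι] {k₁ k₂ : ℕ} {U₁ : ι → Op k₁}
    {U₂ : ι → Op k₂} {r : ℝ} (hr : 0 ≤ r) (h₁ : Spread U₁ r) (h₂ : Spread U₂ r)
    (hU₁ : ∀ s, (U₁ s)ᴴ * U₁ s = 1) (hU₂ : ∀ s, (U₂ s)ᴴ * U₂ s = 1) (N : ℕ) (l : List OGate)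
    (ψ : Bits N → ℂ) :
    ∑ s, nsq (ogatesOp N (U₁ s) (U₂ s) l *ᵥ ψ - ogatesOp N (1 : Op k₁) (1 : Op k₂) l *ᵥ ψ) ≤
      (l.length : ℝ) ^ 2 * r * nsq ψ := by
  have e₁ : (1 : Op k₁)ᴴ * 1 = 1 := by simp
  have e₂ : (1 : Op k₂)ᴴ * 1 = 1 := by simp
  induction l generalizing ψ with
  | nil => simp [ogatesOp, nsq_zero]
  | cons g l ih =>
    set φ := g.op N (1 : Op k₁) (1 : Op k₂) *ᵥ ψ with hφ
    have hφψ : nsq φ = nsq ψ := isIso_ogateOp e₁ e₂ N g ψ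
    have key : ∀ s, ogatesOp N (U₁ s) (U₂ s) (g :: l) *ᵥ ψ -
        ogatesOp N (1 : Op k₁) (1 : Op k₂) (g :: l) *ᵥ ψ =
        ogatesOp N (U₁ s) (U₂ s) l *ᵥ (g.op N (U₁ s) (U₂ s) *ᵥ ψ - φ) +
          (ogatesOp N (U₁ s) (U₂ s) l *ᵥ φ - ogatesOp N (1 : Op k₁) (1 : Op k₂) l *ᵥ φ) := by
      intro s
      rw [ogatesOp, ogatesOp, ← Matrix.mulVec_mulVec, ← Matrix.mulVec_mulVec, ← hφ,
        Matrix.mulVec_sub]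
      abel
    have hg := sum_nsq_ogateOp_sub_le hr h₁ h₂ hU₁ hU₂ N g ψ
    have hl := ih φ
    rw [hφψ] at hl
    simp only [key]
    set A := fun s => ogatesOp N (U₁ s) (U₂ s) l *ᵥ (g.op N (U₁ s) (U₂ s) *ᵥ ψ - φ) with hA
    set B := fun s => ogatesOp N (U₁ s) (U₂ s) l *ᵥ φ -
      ogatesOp N (1 : Op k₁) (1 : Op k₂) l *ᵥ φ with hB
    have hAs : ∑ s, nsq (A s) ≤ r * nsq ψ := by
      refine le_trans (le_of_eq (Finset.sum_congr rfl fun s _ => ?_)) hg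
      exact isIso_ogatesOp (hU₁ s) (hU₂ s) N l _
    -- The weighted inequality has to be divided by the number of remaining gates. If there are
    -- none, the second error term vanishes.
    rcases Nat.eq_zero_or_pos l.length with h0 | hpos
    · have hBs : ∀ s, B s = 0 := fun s => by
        rw [List.length_eq_zero_iff] at h0
        subst h0
        simp [hB, ogatesOp]
      have : ∀ s, nsq (A s + B s) = nsq (A s) := fun s => by rw [hBs, add_zero]
      change ∑ s, nsq (A s + B s) ≤ _
      simp only [this, List.length_cons, h0]
      simpa using hAs
    · set t : ℝ := (l.length : ℝ) with ht
      have htpos : 0 < t := Nat.cast_pos.2 hpos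
      change ∑ s, nsq (A s + B s) ≤ _
      have h3 : t * ∑ s, nsq (A s + B s) ≤
          t * (t + 1) * ∑ s, nsq (A s) + (t + 1) * ∑ s, nsq (B s) := by
        rw [Finset.mul_sum, Finset.mul_sum, Finset.mul_sum, ← Finset.sum_add_distrib]
        exact Finset.sum_le_sum fun s _ => mul_nsq_add_le _ _ htpos.le
      have h4 : t * ∑ s, nsq (A s + B s) ≤ t * ((t + 1) ^ 2 * r * nsq ψ) := by
        refine h3.trans ?_
        have h5 := mul_le_mul_of_nonneg_left hAs (by positivity : 0 ≤ t * (t + 1))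
        have h6 := mul_le_mul_of_nonneg_left hl (by positivity : 0 ≤ t + 1)
        calc _ ≤ t * (t + 1) * (r * nsq ψ) + (t + 1) * (t ^ 2 * r * nsq ψ) := add_le_add h5 h6
          _ = _ := by ring
      have h7 := le_of_mul_le_mul_left h4 htpos
      simpa [ht] using h7

/-! ### Acceptance probabilities -/

open Classical in
lemma prOne_conj_zeroState {N : ℕ} (V : Op N) : prOne (V * zeroState N * Vᴴ) =
    ∑ x : Bits N, if ∃ h : 0 < N, x ⟨0, h⟩ = true then
      ‖(V *ᵥ Pi.single (fun _ => false) 1) x‖ ^ 2 else 0 := by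
  rw [prOne]
  refine Finset.sum_congr rfl fun x _ => ?_
  have : (V * zeroState N * Vᴴ) x x = ((‖(V *ᵥ Pi.single (fun _ => false) 1) x‖ ^ 2 : ℝ) : ℂ) := by
    rw [Matrix.mulVec_single_one, zeroState, Matrix.mul_apply,
      Finset.sum_eq_single (fun _ => false)]
    · push_cast
      rw [Matrix.mul_single_apply_same, mul_one, Matrix.conjTranspose_apply]
      exact Complex.mul_conj' _
    · intro y _ hy
      rw [Matrix.mul_single_apply_of_ne _ _ _ _ _ hy, zero_mul]
    · simp
  rw [this, Complex.ofReal_re]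

lemma nsq_single {N : ℕ} (α : Bits N) : nsq (Pi.single α (1 : ℂ)) = 1 := by
  rw [nsq, Finset.sum_eq_single α]
  · simp
  · intro y _ hy
    simp [Pi.single_eq_of_ne hy]
  · simp

lemma prOne_le_of_nsq_sub_le {N : ℕ} {V W : Op N} (hW : IsIso W)
    (h : nsq (V *ᵥ Pi.single (fun _ => false) 1 - W *ᵥ Pi.single (fun _ => false) 1) ≤ 1 / 1000) :
    prOne (V * zeroState N * Vᴴ) ≤ prOne (W * zeroState N * Wᴴ) + 1 / 8 := by
  classical
  set v := V *ᵥ Pi.single (fun _ => false) 1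
  set w := W *ᵥ Pi.single (fun _ => false) 1
  have hw : nsq w = 1 := (hW _).trans (nsq_single _)
  rw [prOne_conj_zeroState, prOne_conj_zeroState]
  -- This uses (p + q)² ≤ (1 + 1/10) p² + (1 + 10) q². Summed over all x, the excess is at most 1/10
  -- + 11/1000, which is below 1/8.
  have key : ∀ x, (if ∃ h : 0 < N, x ⟨0, h⟩ = true then ‖v x‖ ^ 2 else 0) ≤
      (if ∃ h : 0 < N, x ⟨0, h⟩ = true then ‖w x‖ ^ 2 else 0) + 1 / 10 * ‖w x‖ ^ 2 +
        11 * ‖(v - w) x‖ ^ 2 := fun x => by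
    have h1 : ‖v x‖ ≤ ‖w x‖ + ‖(v - w) x‖ := by
      have := norm_add_le (w x) ((v - w) x)
      rwa [Pi.sub_apply, add_sub_cancel] at this
    split_ifs
    · have h2 := pow_le_pow_left₀ (norm_nonneg _) h1 2
      nlinarith [sq_nonneg (‖w x‖ - 10 * ‖(v - w) x‖)]
    · positivity
  refine (Finset.sum_le_sum fun x _ => key x).trans ?_
  rw [Finset.sum_add_distrib, Finset.sum_add_distrib, ← Finset.mul_sum, ← Finset.mul_sum]
  rw [nsq] at hw h
  rw [hw]
  linarith

/-- Two families of oracles that are close to the identity on average are, for most of the indices,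
indistinguishable from it by an algorithm that makes few queries. -/
lemma OAlg.exists_prAccept_near {ι : Type*} [Fintype ι] [Nonempty ι] {k₁ k₂ : ℕ}
    {U₁ U₁' : ι → Op k₁} {U₂ : ι → Op k₂} {r : ℝ} (hr : 0 ≤ r) (h₁ : Spread U₁ r)
    (h₁' : Spread U₁' r) (h₂ : Spread U₂ r) (hU₁ : ∀ s, (U₁ s)ᴴ * U₁ s = 1)
    (hU₁' : ∀ s, (U₁' s)ᴴ * U₁' s = 1) (hU₂ : ∀ s, (U₂ s)ᴴ * U₂ s = 1) (S : OAlg)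
    (hS : 2000 * (S.gates.length : ℝ) ^ 2 * r ≤ Fintype.card ι) :
    ∃ s, S.prAccept (U₁ s) (U₂ s) ≤ S.prAccept (U₁' s) (U₂ s) + 1 / 4 := by
  set e₀ : Bits S.qubits → ℂ := Pi.single (fun _ => false) 1 with he₀
  set W := ogatesOp S.qubits (1 : Op k₁) (1 : Op k₂) S.gates with hW
  have e₁ : (1 : Op k₁)ᴴ * 1 = 1 := by simp
  have e₂ : (1 : Op k₂)ᴴ * 1 = 1 := by simp
  have hWi : IsIso W := isIso_ogatesOp e₁ e₂ _ _
  have H := sum_nsq_ogatesOp_sub_le hr h₁ h₂ hU₁ hU₂ S.qubits S.gates e₀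
  have H' := sum_nsq_ogatesOp_sub_le hr h₁' h₂ hU₁' hU₂ S.qubits S.gates e₀
  rw [he₀, nsq_single, mul_one, ← he₀] at H H'
  obtain ⟨s, -, hs⟩ : ∃ s ∈ (Finset.univ : Finset ι),
      nsq (ogatesOp S.qubits (U₁ s) (U₂ s) S.gates *ᵥ e₀ - W *ᵥ e₀) +
        nsq (ogatesOp S.qubits (U₁' s) (U₂ s) S.gates *ᵥ e₀ - W *ᵥ e₀) ≤ 1 / 1000 := by
    -- Both deviations have to be small at the same index, so their sum is averaged. The total is at
    -- most 2 L² r for L gates, which `hS` bounds by a thousandth of the number of indices.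
    refine Finset.exists_le_of_sum_le Finset.univ_nonempty ?_
    rw [Finset.sum_add_distrib, Finset.sum_const, Finset.card_univ, nsmul_eq_mul]
    linarith
  refine ⟨s, ?_⟩
  have n1 := nsq_nonneg (ogatesOp S.qubits (U₁ s) (U₂ s) S.gates *ᵥ e₀ - W *ᵥ e₀)
  have n2 := nsq_nonneg (ogatesOp S.qubits (U₁' s) (U₂ s) S.gates *ᵥ e₀ - W *ᵥ e₀)
  have p1 := prOne_le_of_nsq_sub_le (V := ogatesOp S.qubits (U₁ s) (U₂ s) S.gates) hWi
    (by linarith)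
  have p2 := prOne_le_of_nsq_sub_le (V := W) (isIso_ogatesOp (hU₁' s) (hU₂ s) S.qubits S.gates)
    (by
      change nsq (W *ᵥ e₀ - ogatesOp S.qubits (U₁' s) (U₂ s) S.gates *ᵥ e₀) ≤ _
      rw [← nsq_neg, neg_sub]
      linarith)
  rw [OAlg.prAccept, OAlg.prAccept]
  linarith

/-! ### Families of operators that move few basis states -/

/-- Only amplitudes in `S s` change, and `F s` permutes this set, so ‖Uψ - ψ‖² is at most four times
the weight of ψ on it. Summed over s, each basis state is counted at most `c` times. -/
lemma Spread.permMat {ι : Type*} [Fintype ι] {N : ℕ} {F : ι → Bits N → Bits N}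
    (hF : ∀ s, Function.Involutive (F s)) (S : ι → Bits N → Prop)
    (hS : ∀ s y, ¬ S s y → F s y = y) (hS' : ∀ s y, S s y → S s (F s y)) {c : ℕ}
    (hc : ∀ y, {s | S s y}.ncard ≤ c) : Spread (fun s => permMat (F s)) (4 * c) := by
  classical
  intro ψ
  have h1 : ∀ s, nsq (QObf.permMat (F s) *ᵥ ψ - ψ) ≤ 4 * ∑ y, if S s y then ‖ψ y‖ ^ 2 else 0 := by
    intro s
    have e : ∑ y, (if S s y then ‖ψ (F s y)‖ ^ 2 else 0) = ∑ y, if S s y then ‖ψ y‖ ^ 2 else 0 := by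
      rw [← Equiv.sum_comp (hF s).toPerm]
      refine Finset.sum_congr rfl fun y _ => ?_
      have : S s (F s y) ↔ S s y :=
        ⟨fun h => by have := hS' s _ h; rwa [hF s] at this, fun h => hS' s _ h⟩
      simp only [Function.Involutive.coe_toPerm, this, hF s y]
    have h2 : nsq (QObf.permMat (F s) *ᵥ ψ - ψ) ≤
        ∑ y, (2 * (if S s y then ‖ψ (F s y)‖ ^ 2 else 0) +
          2 * (if S s y then ‖ψ y‖ ^ 2 else 0)) := by
      rw [nsq]
      refine Finset.sum_le_sum fun y _ => ?_
      rw [Pi.sub_apply, permMat_mulVec (hF s)]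
      split_ifs with h
      · have := pow_le_pow_left₀ (norm_nonneg _) (norm_sub_le (ψ (F s y)) (ψ y)) 2
        nlinarith [sq_nonneg (‖ψ (F s y)‖ - ‖ψ y‖)]
      · simp [hS s y h]
    rw [Finset.sum_add_distrib, ← Finset.mul_sum, ← Finset.mul_sum, e] at h2
    linarith
  refine (Finset.sum_le_sum fun s _ => h1 s).trans ?_
  rw [← Finset.mul_sum, Finset.sum_comm, mul_assoc]
  refine mul_le_mul_of_nonneg_left ?_ (by norm_num)
  rw [nsq, Finset.mul_sum]
  refine Finset.sum_le_sum fun y _ => ?_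
  rw [← Finset.sum_filter, Finset.sum_const, nsmul_eq_mul]
  refine mul_le_mul_of_nonneg_right ?_ (sq_nonneg _)
  have := hc y
  rw [Set.ncard_eq_toFinset_card'] at this
  simp only [Set.toFinset_ofPred] at this
  exact_mod_cast this


/-! ### Rules for measurement probabilities -/

lemma prOne_eq_prob {N : ℕ} (ρ : Op N) : prOne ρ = prob (fun x => ext x 0 = true) ρ := by
  classical
  rw [prOne, prob]
  refine Finset.sum_congr rfl fun x _ => ?_
  have : (∃ h : 0 < N, x ⟨0, h⟩ = true) ↔ ext x 0 = true := by
    by_cases h : 0 < N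
    · simp [h, ext_of_lt x h]
    · simp [h, ext_of_le x (by omega : N ≤ 0)]
  by_cases h : ext x 0 = true
  · rw [if_pos h, if_pos (this.2 h)]
  · rw [if_neg h, if_neg fun h' => h (this.1 h')]

lemma prob_congr {N : ℕ} {S T : Bits N → Prop} (h : ∀ x, S x ↔ T x) (ρ : Op N) :
    prob S ρ = prob T ρ := by
  rw [show S = T from funext fun x => propext (h x)]

/-- Discarding qubits does not change the statistics of the others, so events about the output can
be evaluated on the joint final state. -/
lemma prob_interpret (J : QAlg) {m n : ℕ} (ρ : Op (m + n)) (S : Bits n → Prop)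
    (T : Bits (m + n + J.ancillas) → Prop)
    (h : ∀ u x z, T (Fin.append (Fin.append u x) z) ↔ S x) :
    prob S (J.interpret ρ) = prob T (J.run ρ) := by
  classical
  rw [prob, prob, sum_bits_append, sum_bits_append, Finset.sum_comm]
  refine Finset.sum_congr rfl fun x _ => ?_
  simp only [h, QAlg.interpret, Matrix.of_apply]
  split_ifs
  · simp
  · simp

open Classical in
lemma prob_eq_re_trace {N : ℕ} (S : Bits N → Prop) (ρ : Op N) :
    prob S ρ = ((Matrix.diagonal (fun x => if S x then (1 : ℂ) else 0) * ρ).trace).re := by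
  rw [prob, Matrix.trace, Complex.re_sum]
  refine Finset.sum_congr rfl fun x _ => ?_
  rw [Matrix.diag_apply, Matrix.diagonal_mul]
  split_ifs <;> simp

/-- No signalling: a unitary on the first qubits commutes with a projection that only concerns the
last ones. -/
lemma prob_tensor_one_conj {m n : ℕ} {w : Op m} (hw : wᴴ * w = 1) (S : Bits (m + n) → Prop)
    (T : Bits n → Prop) (h : ∀ u v, S (Fin.append u v) ↔ T v) (ρ : Op (m + n)) :
    prob S (tensor w 1 * ρ * (tensor w 1)ᴴ) = prob S ρ := by
  classical
  rw [prob_eq_re_trace, prob_eq_re_trace]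
  have hd : Matrix.diagonal (fun x => if S x then (1 : ℂ) else 0) =
      tensor (1 : Op m) (Matrix.diagonal fun v => if T v then (1 : ℂ) else 0) := by
    refine op_ext_append fun u v u' v' => ?_
    rw [tensor_append, Matrix.diagonal_apply, Matrix.diagonal_apply, Matrix.one_apply]
    simp only [append_inj_iff, h]
    split_ifs <;> simp_all
  rw [hd]
  congr 1
  rw [← Matrix.mul_assoc, ← Matrix.mul_assoc, tensor_mul_tensor, Matrix.trace_mul_comm,
    ← Matrix.mul_assoc, conjTranspose_tensor, tensor_mul_tensor]
  simp [hw]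

lemma zeroState_apply {n : ℕ} (x y : Bits n) :
    zeroState n x y = if x = (fun _ => false) ∧ y = (fun _ => false) then 1 else 0 := by
  rw [zeroState, Matrix.single_apply]
  simp only [eq_comm]

lemma prob_tensor_zeroState {m n : ℕ} (S : Bits (m + n) → Prop) (ρ : Op m) :
    prob S (tensor ρ (zeroState n)) = prob (fun u => S (Fin.append u fun _ => false)) ρ := by
  classical
  rw [prob, prob, sum_bits_append]
  refine Finset.sum_congr rfl fun u _ => ?_
  rw [Finset.sum_eq_single fun _ => false]
  · rw [tensor_append, zeroState_apply]
    simp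
  · intro v _ hv
    rw [tensor_append, zeroState_apply]
    simp [hv]
  · simp

lemma prob_single {N : ℕ} (S : Bits N → Prop) (α : Bits N) [Decidable (S α)] :
    prob S (Matrix.single α α 1) = if S α then 1 else 0 := by
  classical
  rw [prob, Finset.sum_eq_single α]
  · simp
  · intro y _ hy
    simp [Ne.symm hy]
  · simp

lemma injective_of_conjTranspose_permMat_mul_self {N : ℕ} {f : Bits N → Bits N}
    (h : (permMat f)ᴴ * permMat f = 1) : Function.Injective f := by
  intro y y' hy
  by_contra hne
  have := congrFun (congrFun h y) y'
  rw [Matrix.one_apply_ne hne, Matrix.mul_apply, Finset.sum_eq_single (f y)] at this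
  · simp [permMat, hy] at this
  · intro z _ hz
    simp [permMat, hz]
  · simp

lemma Computes.prob_conj {N : ℕ} {l : List Gate} {F : (ℕ → Bool) → ℕ → Bool} (h : Computes N l F)
    (S : Bits N → Prop) (ρ : Op N) :
    prob S (gatesOp N l * ρ * (gatesOp N l)ᴴ) = prob (fun y => S (cut N (F (ext y)))) ρ := by
  have hu := conjTranspose_gatesOp_mul_self N l
  rw [h.2] at hu ⊢
  have hi := injective_of_conjTranspose_permMat_mul_self hu
  exact prob_permMat_conj (Finite.injective_iff_bijective.1 hi) S ρ

/-! ### States continued by zeros -/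

open Classical in
/-- The state `σ` on the first `q` of `N` qubits, with the others in state `0`. -/
def padded (N : ℕ) {q : ℕ} (σ : Op q) : Op N :=
  Matrix.of fun x y => if ZeroFrom q (ext x) ∧ ZeroFrom q (ext y) then
    σ (cut q (ext x)) (cut q (ext y)) else 0

lemma zeroFrom_ext_append {m n : ℕ} (u : Bits m) (v : Bits n) :
    ZeroFrom m (ext (Fin.append u v)) ↔ v = fun _ => false := by
  constructor
  · intro h
    funext i
    have := h (m + i) (by omega)
    rwa [ext_append_right, ext_val] at this
  · rintro rfl i hi
    obtain ⟨i, rfl⟩ := Nat.exists_eq_add_of_le hi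
    rw [ext_append_right, ext]
    split_ifs <;> rfl

lemma cut_ext_append {m n : ℕ} (u : Bits m) (v : Bits n) : cut m (ext (Fin.append u v)) = u := by
  funext i
  rw [cut, ext_append_left _ _ i.2, ext_val]

/-- In `padded` the total number of qubits is a free argument. Different groupings of zero qubits
can thus be compared without transport between types. -/
lemma tensor_zeroState {q : ℕ} (σ : Op q) (n : ℕ) :
    tensor σ (zeroState n) = padded (q + n) σ := by
  refine op_ext_append fun u v u' v' => ?_
  rw [tensor_append, zeroState_apply, padded, Matrix.of_apply]
  simp only [zeroFrom_ext_append, cut_ext_append]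
  split_ifs <;> simp

lemma ZeroFrom.mono {q K : ℕ} (hq : q ≤ K) {σ : ℕ → Bool} (h : ZeroFrom q σ) : ZeroFrom K σ :=
  fun i hi => h i (hq.trans hi)

lemma padded_padded {q K : ℕ} (hq : q ≤ K) (N : ℕ) (σ : Op q) :
    padded N (padded K σ) = padded N σ := by
  ext x y
  simp only [padded, Matrix.of_apply]
  by_cases h : ZeroFrom K (ext x) ∧ ZeroFrom K (ext y)
  · rw [if_pos h, ext_cut h.1, ext_cut h.2]
  · rw [if_neg h, if_neg fun h' => h ⟨h'.1.mono hq, h'.2.mono hq⟩]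

lemma cut_ext_append_add {p K q : ℕ} (u : Bits p) (v : Bits K) :
    cut (p + q) (ext (Fin.append u v)) = Fin.append u (cut q (ext v)) := by
  refine ext_injective (funext fun i => ?_)
  rcases lt_or_ge i p with h | h
  · rw [ext_append_left _ _ h, ext_of_lt _ (by omega), cut, ext_append_left _ _ h]
  · obtain ⟨i, rfl⟩ := Nat.exists_eq_add_of_le h
    rw [ext_append_right]
    by_cases hi : i < q
    · rw [ext_of_lt _ (by omega), ext_of_lt _ hi, cut, cut, ext_append_right]
    · rw [ext_of_le _ (by omega), ext_of_le _ (by omega)]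

lemma zeroFrom_ext_append_add {p K q : ℕ} (u : Bits p) (v : Bits K) :
    ZeroFrom (p + q) (ext (Fin.append u v)) ↔ ZeroFrom q (ext v) := by
  constructor
  · intro h i hi
    have := h (p + i) (by omega)
    rwa [ext_append_right] at this
  · intro h i hi
    obtain ⟨i, rfl⟩ := Nat.exists_eq_add_of_le (by omega : p ≤ i)
    rw [ext_append_right]
    exact h i (by omega)

lemma tensor_padded {p K q : ℕ} (ρ : Op p) (σ : Op q) :
    tensor ρ (padded K σ) = padded (p + K) (tensor ρ σ) := by
  refine op_ext_append fun u v u' v' => ?_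
  rw [tensor_append, padded, padded, Matrix.of_apply, Matrix.of_apply]
  rw [cut_ext_append_add, cut_ext_append_add, tensor_append]
  by_cases h : ZeroFrom q (ext v) ∧ ZeroFrom q (ext v')
  · rw [if_pos h, if_pos (by simpa only [zeroFrom_ext_append_add] using h)]
  · rw [if_neg h, if_neg (by simpa only [zeroFrom_ext_append_add] using h), mul_zero]

/-! ### The attack -/

/-- Runs the interpreter on the first state, with the second state (continued by zeros) as input,
and outputs the last qubit of the result. -/
def attack (J : QAlg) (n q₁ q₂ : ℕ) : QAlg where
  ancillas := (n + 1 - q₂) + J.ancillas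
  gates := J.gates ++ [.cx 0 (q₁ + n), .cx (q₁ + n) 0]

lemma prOne_attack (J : QAlg) {n q₁ q₂ : ℕ} (hn : 0 < n) (hq : q₂ ≤ n + 1) (σ₁ : Op q₁)
    (σ₂ : Op q₂) : prOne ((attack J n q₁ q₂).run (tensor σ₁ σ₂)) =
      prob (fun x => ext x n = true) (J.interpret (tensor σ₁ (padded (n + 1) σ₂))) := by
  set l : List Gate := [.cx 0 (q₁ + n), .cx (q₁ + n) 0] with hl
  -- As a function of the number of qubits, the probability can be rewritten along `h2`, which
  -- regroups the extra ancillas of the attack with the second state into an input register of n + 1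
  -- qubits.
  set f : ℕ → ℝ := fun N => prOne (gatesOp N (J.gates ++ l) * padded N (tensor σ₁ σ₂) *
    (gatesOp N (J.gates ++ l))ᴴ) with hf
  have h1 : prOne ((attack J n q₁ q₂).run (tensor σ₁ σ₂)) =
      f (q₁ + q₂ + (n + 1 - q₂ + J.ancillas)) := by
    rw [QAlg.run, tensor_zeroState]
    rfl
  have h2 : q₁ + q₂ + (n + 1 - q₂ + J.ancillas) = q₁ + (n + 1) + J.ancillas := by omega
  rw [h1, h2, hf]
  dsimp only
  -- If qubit 0 holds u and qubit q₁ + n holds v, the first CNOT leaves u + v in the latter and the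
  -- second leaves u + (u + v) = v in qubit 0, where the outcome is measured.
  have hc : Computes (q₁ + (n + 1) + J.ancillas) l _ :=
    (Computes.cx (i := 0) (j := q₁ + n) (by omega) (by omega) (by omega)).append
      (Computes.cx (i := q₁ + n) (j := 0) (by omega) (by omega) (by omega))
  rw [prOne_eq_prob, gatesOp_append, Matrix.conjTranspose_mul, ← Matrix.mul_assoc,
    Matrix.mul_assoc (gatesOp _ l), Matrix.mul_assoc (gatesOp _ l), hc.prob_conj]
  rw [prob_interpret J _ _ fun x => ext x (q₁ + n) = true]
  · rw [QAlg.run, tensor_zeroState, tensor_padded, padded_padded (by omega)]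
    refine prob_congr (fun y => ?_) _
    rw [ext_cut (hc.1 _ (zeroFrom_ext y))]
    simp [Function.update_of_ne (by omega : 0 ≠ q₁ + n)]
    cases ext y 0 <;> simp
  · intro u x z
    rw [ext_append_left _ _ (by omega), ext_append_right]

/-! ### The circuits of the pair -/

/-- The circuit that adds `b` to its last register if the content of the first is `a`. -/
def pointCircuit (j : ℕ) (a b : Bits (j + 2)) : Circuit where
  qubits := 3 * (j + 2)
  gates := pointGates j (ext a) (ext b)

/-- The basis state with `a` in the first register. -/
def pointInput (j : ℕ) (a : Bits (j + 2)) : Bits (3 * (j + 2)) := cut _ (ext a)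

/-- The content of the last register is `b`. -/
def OutputIs (j : ℕ) (b : Bits (j + 2)) (x : Bits (3 * (j + 2))) : Prop :=
  Matches (2 * j + 4) (ext b) (j + 2) (ext x)

lemma prob_pointCircuit (j : ℕ) (a b b' : Bits (j + 2)) :
    prob (OutputIs j b') (gatesOp (3 * (j + 2)) (pointCircuit j a b).gates *
      (Matrix.single (pointInput j a) (pointInput j a) 1 : Op (3 * (j + 2))) *
        (gatesOp (3 * (j + 2)) (pointCircuit j a b).gates)ᴴ) =
    if b = b' then 1 else 0 := by
  classical
  have h := Computes.point j (ext a) (ext b)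
  have e : ext (pointInput j a) = ext a := ext_cut ((zeroFrom_ext a).mono (by omega))
  refine (h.prob_conj _ _).trans ?_
  rw [prob_single]
  have : OutputIs j b' (cut (3 * (j + 2)) (pointFun j (ext a) (ext b) (ext (pointInput j a)))) ↔
      b = b' := by
    rw [OutputIs, ext_cut (h.1 _ (zeroFrom_ext _)), e]
    have hm : Matches 0 (ext a) (j + 2) (ext a) := fun i _ => by rw [zero_add]
    have key : ∀ i < j + 2, pointFun j (ext a) (ext b) (ext a) (2 * j + 4 + i) = ext b i := by
      intro i hi
      rw [pointFun, if_pos (by omega), ext_of_le a (by omega),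
        show 2 * j + 4 + i - (2 * j + 4) = i by omega]
      simp [hm]
    constructor
    · intro H
      refine ext_injective (funext fun i => ?_)
      by_cases hi : i < j + 2
      · rw [← key i hi, H i hi]
      · rw [ext_of_le _ (by omega), ext_of_le _ (by omega)]
    · rintro rfl i hi
      exact key i hi
  split_ifs with h1 h2 h2
  · rfl
  · exact absurd (this.1 h1) h2
  · exact absurd (this.2 h2) h1
  · rfl

/-- Writes `a` to the first register of the input of the interpreter `J`, which has `q` qubits of
advice, and runs `J`. -/
def loadGates (J : QAlg) (j q : ℕ) (a : Bits (j + 2)) : List Gate :=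
  flips q (ext a) (j + 2) ++ filterBelow (q + 3 * (j + 2) + J.ancillas) J.gates

/-- The gates of the circuit that tests whether its first `q` qubits are advice with which the
interpreter `J` maps `a` to `b`; the result is added to the last qubit, number `n`. -/
def testGates (J : QAlg) (j q n : ℕ) (a b : Bits (j + 2)) : List Gate :=
  loadGates J j q a ++ matchFlip (q + (2 * j + 4)) (n - (j + 1)) (ext b) j ++
    invGates (loadGates J j q a)

/-- The test, with ignored instructions up to a total of `n`. -/
def testCircuit (J : QAlg) (j q n : ℕ) (a b : Bits (j + 2)) : Circuit where
  qubits := n + 1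
  gates := testGates J j q n a b ++ nops (n - (testGates J j q n a b).length)

lemma below_loadGates (J : QAlg) (j q : ℕ) (a : Bits (j + 2)) :
    ∀ g ∈ loadGates J j q a, g.Below (q + 3 * (j + 2) + J.ancillas) := by
  intro g hg
  rw [loadGates, List.mem_append] at hg
  exact hg.elim (below_flips _ (by omega) g) (below_filterBelow g)

lemma length_loadGates_le (J : QAlg) (j q : ℕ) (a : Bits (j + 2)) :
    (loadGates J j q a).length ≤ 6 * (j + 2) + J.gates.length := by
  rw [loadGates, List.length_append, length_flips]
  exact Nat.add_le_add_left (List.length_filter_le _ _) _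

/-- The factor 8 counts the loading part once forwards and, since a T gate is undone by seven, at
most seven times backwards. -/
lemma length_testGates_le (J : QAlg) (j q n : ℕ) (a b : Bits (j + 2)) :
    (testGates J j q n a b).length ≤ 8 * (6 * (j + 2) + J.gates.length) + 16 * j + 28 := by
  rw [testGates, List.length_append, List.length_append, length_matchFlip]
  have h1 := length_loadGates_le J j q a
  have h2 := length_invGates_le (loadGates J j q a)
  omega

lemma below_testCircuit (J : QAlg) {j q n : ℕ} (a b : Bits (j + 2))
    (hn : q + 3 * (j + 2) + J.ancillas + (j + 1) ≤ n) :
    ∀ g ∈ (testCircuit J j q n a b).gates, g.Below (n + 1) := by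
  have hl : ∀ g ∈ loadGates J j q a, g.Below (n + 1) := fun g hg =>
    (below_loadGates J j q a g hg).mono (by omega)
  intro g hg
  simp only [testCircuit, testGates, List.mem_append] at hg
  rcases hg with ((hg | hg) | hg) | hg
  · exact hl g hg
  · exact below_matchFlip _ (by omega) (by omega) g hg
  · exact below_invGates hl g hg
  · exact below_nops (by omega) _ g hg

lemma gatesOp_testCircuit (J : QAlg) (j q n : ℕ) (a b : Bits (j + 2)) :
    gatesOp (n + 1) (testCircuit J j q n a b).gates = (gatesOp (n + 1) (loadGates J j q a))ᴴ *
      (gatesOp (n + 1) (matchFlip (q + (2 * j + 4)) (n - (j + 1)) (ext b) j) *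
        gatesOp (n + 1) (loadGates J j q a)) := by
  change gatesOp (n + 1) (testGates J j q n a b ++ _) = _
  rw [gatesOp_append, gatesOp_nops, one_mul, testGates, gatesOp_append, gatesOp_append,
    gatesOp_invGates]

lemma flipsFun_append {q m r s : ℕ} (hm : m ≤ r) (a : Bits m) (u : Bits q) (x : Bits r)
    (z : Bits s) :
    cut (q + r + s) (flipsFun q (ext a) m (ext (Fin.append (Fin.append u x) z))) =
      Fin.append (Fin.append u fun i => xor (ext a i) (x i)) z := by
  refine ext_injective (funext fun i => ?_)
  have hz : ZeroFrom (q + r + s) (flipsFun q (ext a) m (ext (Fin.append (Fin.append u x) z))) :=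
    fun i hi => by rw [flipsFun, if_neg (by omega), ext_of_le _ hi]
  rw [ext_cut hz]
  rcases lt_or_ge i (q + r) with h | h
  · rw [ext_append_left _ _ h]
    rcases lt_or_ge i q with h' | h'
    · rw [flipsFun, if_neg (by omega), ext_append_left _ _ h, ext_append_left _ _ h',
        ext_append_left _ _ h']
    · obtain ⟨i, rfl⟩ := Nat.exists_eq_add_of_le h'
      rw [ext_append_right, flipsFun, ext_append_left _ _ h, ext_append_right,
        ext_of_lt _ (by omega : i < r), ext_of_lt _ (by omega : i < r),
        show q + i - q = i by omega]
      by_cases hi : i < m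
      · rw [if_pos (by omega)]
      · rw [if_neg (by omega), ext_of_le a (not_lt.1 hi)]
        simp
  · obtain ⟨i, rfl⟩ := Nat.exists_eq_add_of_le h
    rw [flipsFun, if_neg (by omega), ext_append_right, ext_append_right]

lemma flipsFun_involutive {N q m : ℕ} (hN : q + m ≤ N) (a : ℕ → Bool) :
    Function.Involutive fun y : Bits N => cut N (flipsFun q a m (ext y)) := fun y => by
  dsimp only
  rw [ext_cut ((Computes.flips a hN).1 _ (zeroFrom_ext y)), flipsFun_flipsFun]
  funext i
  simp [cut]

/-- The layer of NOT gates turns the zero state of the input register into the basis state for `a`;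
what follows is an ordinary run of `J`. -/
lemma loadGates_conj (J : QAlg) (j q : ℕ) (a : Bits (j + 2)) (σ : Op q) :
    gatesOp (q + 3 * (j + 2) + J.ancillas) (loadGates J j q a) *
      tensor (tensor σ (zeroState (3 * (j + 2)))) (zeroState J.ancillas) *
      (gatesOp (q + 3 * (j + 2) + J.ancillas) (loadGates J j q a))ᴴ =
    J.run (tensor σ (Matrix.single (pointInput j a) (pointInput j a) 1)) := by
  rw [loadGates, gatesOp_append, gatesOp_filterBelow, Matrix.conjTranspose_mul, ← Matrix.mul_assoc,
    Matrix.mul_assoc (gatesOp _ J.gates), Matrix.mul_assoc (gatesOp _ J.gates), QAlg.run]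
  congr 2
  have hN : q + (j + 2) ≤ q + 3 * (j + 2) + J.ancillas := by omega
  rw [(Computes.flips (ext a) hN).2]
  refine op_ext_append fun u z u' z' => ?_
  obtain ⟨u, x, rfl⟩ := exists_append u
  obtain ⟨u', x', rfl⟩ := exists_append u'
  rw [permMat_conj_apply (flipsFun_involutive hN (ext a)), flipsFun_append (by omega),
    flipsFun_append (by omega)]
  simp only [tensor_append]
  congr 2
  rw [zeroState_apply, Matrix.single_apply]
  have key : ∀ x : Bits (3 * (j + 2)), (fun i : Fin (3 * (j + 2)) => xor (ext a i) (x i)) =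
      (fun _ => false) ↔ pointInput j a = x := fun x => by
    rw [funext_iff, funext_iff]
    refine forall_congr' fun i => ?_
    rw [pointInput, cut]
    cases ext a i <;> cases x i <;> simp
  simp only [key]

/-- The test gives the probability that the interpreter, with the given advice, maps `a` to `b`. -/
lemma prob_testCircuit (J : QAlg) {j q n M : ℕ}
    (hn : n = q + 3 * (j + 2) + J.ancillas + M) (hM : j + 1 ≤ M) (a b : Bits (j + 2)) (σ : Op q) :
    prob (fun x => ext x n = true) (gatesOp (n + 1) (testCircuit J j q n a b).gates * padded (n + 1) σ *
      (gatesOp (n + 1) (testCircuit J j q n a b).gates)ᴴ) =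
    prob (OutputIs j b)
      (J.interpret (tensor σ (Matrix.single (pointInput j a) (pointInput j a) 1))) := by
  classical
  subst hn
  set N := q + 3 * (j + 2) + J.ancillas with hN
  set w := gatesOp N (loadGates J j q a) with hw
  have hww : wᴴ * w = 1 := conjTranspose_gatesOp_mul_self _ _
  have hload : gatesOp (N + M + 1) (loadGates J j q a) = tensor w (1 : Op (M + 1)) :=
    gatesOp_add (M + 1) (below_loadGates J j q a)
  have hρ : padded (N + M + 1) σ =
      tensor (tensor (tensor σ (zeroState (3 * (j + 2)))) (zeroState J.ancillas))
        (zeroState (M + 1)) := by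
    rw [tensor_zeroState, tensor_zeroState, tensor_zeroState, padded_padded (by omega),
      padded_padded (by omega)]
    rfl
  -- By `hM`, both the borrowed qubits and the target of the comparison lie beyond the `N` qubits
  -- used by the interpreter.
  have hc : Computes (N + M + 1) (matchFlip (q + (2 * j + 4)) (N + M - (j + 1)) (ext b) j) _ :=
    Computes.matchFlip (ext b) (by omega) (by omega)
  set P := gatesOp (N + M + 1) (matchFlip (q + (2 * j + 4)) (N + M - (j + 1)) (ext b) j) with hP
  rw [gatesOp_testCircuit, hload, hρ]
  have e : (tensor w (1 : Op (M + 1)))ᴴ * (P * tensor w (1 : Op (M + 1))) *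
      tensor (tensor (tensor σ (zeroState (3 * (j + 2)))) (zeroState J.ancillas))
        (zeroState (M + 1)) * ((tensor w (1 : Op (M + 1)))ᴴ * (P * tensor w (1 : Op (M + 1))))ᴴ =
      tensor wᴴ (1 : Op (M + 1)) * (P *
        tensor (J.run (tensor σ (Matrix.single (pointInput j a) (pointInput j a) 1)))
          (zeroState (M + 1)) * Pᴴ) * (tensor wᴴ (1 : Op (M + 1)))ᴴ := by
    have hr : J.run (tensor σ (Matrix.single (pointInput j a) (pointInput j a) 1)) =
        w * tensor (tensor σ (zeroState (3 * (j + 2)))) (zeroState J.ancillas) * wᴴ :=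
      (loadGates_conj J j q a σ).symm
    have : tensor (J.run (tensor σ (Matrix.single (pointInput j a) (pointInput j a) 1)))
        (zeroState (M + 1)) = tensor w (1 : Op (M + 1)) *
        tensor (tensor (tensor σ (zeroState (3 * (j + 2)))) (zeroState J.ancillas))
          (zeroState (M + 1)) * tensor wᴴ 1 := by
      rw [tensor_mul_tensor, tensor_mul_tensor, one_mul, mul_one, hr]
    rw [this]
    simp only [Matrix.conjTranspose_mul, conjTranspose_tensor, Matrix.conjTranspose_one,
      Matrix.conjTranspose_conjTranspose, Matrix.mul_assoc]
  refine (congrArg _ e).trans ?_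
  -- The backward run acts on the first `N` qubits and the measured one is number N + M, so it can
  -- be dropped.
  rw [prob_tensor_one_conj (T := fun v : Bits (M + 1) => ext v M = true)]
  · refine (hc.prob_conj _ _).trans ((prob_tensor_zeroState (m := N) (n := M + 1) _ _).trans ?_)
    refine (prob_interpret J _ _ _ ?_).symm
    intro u x z
    have hz : ext (Fin.append (Fin.append (Fin.append u x) z) fun _ : Fin (M + 1) => false)
        (N + M) = false := by
      rw [ext_append_right, ext_of_lt _ (Nat.lt_succ_self M)]
    rw [ext_cut (hc.1 _ (zeroFrom_ext _)), matchFlipFun,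
      show N + M - (j + 1) + (j + 1) = N + M by omega, Function.update_self, hz, Bool.xor_false,
      decide_eq_true_iff, OutputIs, Matches, Matches]
    refine forall_congr' fun i => forall_congr' fun hi => ?_
    rw [ext_append_left _ _ (by omega), ext_append_left _ _ (by omega), add_assoc, ext_append_right]
  · rw [Matrix.conjTranspose_conjTranspose]
    exact mul_eq_one_comm.1 hww
  · intro u v
    rw [ext_append_right]


/-! ### The circuits of the pair are close to the identity -/

lemma cut_ext {N : ℕ} (x : Bits N) : cut N (ext x) = x := funext fun i => ext_val x i

lemma eq_of_matches {x m : ℕ} {a : Bits m} {σ : ℕ → Bool} (h : Matches x (ext a) m σ) :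
    a = fun i : Fin m => σ (x + i) := funext fun i => by
  rw [h i i.2, ext_val]

lemma Computes.spread {ι : Type*} [Fintype ι] {N : ℕ} {l : ι → List Gate}
    {F : ι → (ℕ → Bool) → ℕ → Bool} (h : ∀ s, Computes N (l s) (F s))
    (hF : ∀ s σ, F s (F s σ) = σ) (S : ι → (ℕ → Bool) → Prop) (hS : ∀ s σ, ¬ S s σ → F s σ = σ)
    (hS' : ∀ s σ, S s σ → S s (F s σ)) {c : ℕ} (hc : ∀ σ, {s | S s σ}.ncard ≤ c) :
    Spread (fun s => gatesOp N (l s)) (4 * c) := by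
  simp only [(h _).2]
  refine Spread.permMat (fun s y => ?_) (fun s y => S s (ext y)) (fun s y hy => ?_)
    (fun s y hy => ?_) fun y => hc (ext y)
  · rw [ext_cut ((h s).1 _ (zeroFrom_ext y)), hF, cut_ext]
  · rw [hS s _ hy, cut_ext]
  · rw [ext_cut ((h s).1 _ (zeroFrom_ext y))]
    exact hS' s _ hy

/-- A basis state can be moved only if `a` is the content of its first register; `b` remains free,
which leaves 2^(j+2) pairs. -/
lemma spread_pointCircuit (j : ℕ) : Spread (fun s : Bits (j + 2) × Bits (j + 2) =>
    gatesOp (3 * (j + 2)) (pointCircuit j s.1 s.2).gates) (4 * (2 ^ (j + 2) : ℕ)) := by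
  classical
  have hm : ∀ (s : Bits (j + 2) × Bits (j + 2)) σ,
      Matches 0 (ext s.1) (j + 2) (pointFun j (ext s.1) (ext s.2) σ) ↔
        Matches 0 (ext s.1) (j + 2) σ := fun s σ =>
    matches_congr fun i hi => by rw [pointFun, if_neg (by omega)]
  refine Computes.spread (c := 2 ^ (j + 2)) (l := fun s => (pointCircuit j s.1 s.2).gates)
    (F := fun s => pointFun j (ext s.1) (ext s.2))
    (fun s => Computes.point j (ext s.1) (ext s.2)) (fun s σ => ?_)
    (fun s σ => Matches 0 (ext s.1) (j + 2) σ) (fun s σ hσ => ?_) (fun s σ hσ => (hm s σ).2 hσ)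
    fun σ => ?_
  · funext w
    by_cases hw : 2 * j + 4 ≤ w ∧ w < 2 * j + 4 + (j + 2)
    · rw [pointFun, if_pos hw, pointFun, if_pos hw]
      simp only [hm]
      rw [← Bool.xor_assoc, Bool.xor_self, Bool.false_xor]
    · rw [pointFun, if_neg hw, pointFun, if_neg hw]
  · funext w
    rw [pointFun]
    simp [hσ]
  · have hsub : {s : Bits (j + 2) × Bits (j + 2) | Matches 0 (ext s.1) (j + 2) σ} ⊆
        Set.range fun b : Bits (j + 2) => ((fun i : Fin (j + 2) => σ (0 + i) : Bits (j + 2)), b) := by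
      rintro ⟨a, b⟩ hs
      exact ⟨b, Prod.ext (eq_of_matches hs).symm rfl⟩
    refine (Set.ncard_le_ncard hsub (Set.toFinite _)).trans ?_
    rw [← Set.image_univ]
    refine (Set.ncard_image_le (Set.toFinite _)).trans ?_
    simp [Set.ncard_univ]

lemma spread_matchFlip {N x d j : ℕ} (hx : x + (j + 1) < d) (hd : d + (j + 1) < N) :
    Spread (fun b : Bits (j + 2) => gatesOp N (matchFlip x d (ext b) j)) 4 := by
  classical
  have hm : ∀ (b : Bits (j + 2)) σ,
      Matches x (ext b) (j + 2) (matchFlipFun x d (ext b) j σ) ↔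
        Matches x (ext b) (j + 2) σ := fun b σ =>
    matches_congr fun i hi => by rw [matchFlipFun, Function.update_of_ne (by omega)]
  have := Computes.spread (fun b : Bits (j + 2) => Computes.matchFlip (ext b) hx hd) (fun b σ => ?_)
    (fun b σ => Matches x (ext b) (j + 2) σ) (fun b σ hσ => ?_) (fun b σ hσ => (hm b σ).2 hσ)
    (c := 1) fun σ => ?_
  · simpa using this
  · rw [matchFlipFun]
    simp only [hm]
    rw [matchFlipFun, Function.update_self, Function.update_idem, ← Bool.xor_assoc, Bool.xor_self,
      Bool.false_xor, Function.update_eq_self]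
  · rw [matchFlipFun]
    simp [hσ]
  · refine (Set.ncard_le_one_iff (Set.toFinite _)).2 fun {a b} ha hb => ?_
    rw [eq_of_matches ha, eq_of_matches hb]

/-- The test is the conjugate of a comparison by the loading unitary, which depends on a and q but
not on b. For fixed a and q, the sum over b is therefore that of `spread_matchFlip` at a rotated
vector. The advice length q may itself depend on b, so the sum is first enlarged to all q ≤ Q, at
the price of a factor Q + 1. The permutation `β` covers both the right and the wrong expected
answer. -/
lemma spread_testCircuit {j n Q : ℕ} (J : ℕ → QAlg)
    (hn : ∀ q ≤ Q, q + 3 * (j + 2) + (J q).ancillas + (j + 1) ≤ n)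
    (β : Equiv.Perm (Bits (j + 2))) (q : Bits (j + 2) × Bits (j + 2) → ℕ) (hq : ∀ s, q s ≤ Q) :
    Spread (fun s => gatesOp (n + 1) (testCircuit (J (q s)) j (q s) n s.1 (β s.2)).gates)
      (4 * (2 ^ (j + 2) : ℕ) * (Q + 1)) := by
  intro ψ
  set φ : Bits (j + 2) → ℕ → Bits (n + 1) → ℂ := fun a q =>
    gatesOp (n + 1) (loadGates (J q) j q a) *ᵥ ψ with hφ
  set f : Bits (j + 2) → Bits (j + 2) → ℕ → ℝ := fun a b q =>
    nsq (gatesOp (n + 1) (matchFlip (q + (2 * j + 4)) (n - (j + 1)) (ext b) j) *ᵥ φ a q - φ a q)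
    with hf
  have h1 : ∀ a b q, nsq (gatesOp (n + 1) (testCircuit (J q) j q n a b).gates *ᵥ ψ - ψ) =
      f a b q := by
    intro a b q
    have hu := conjTranspose_gatesOp_mul_self (n + 1) (loadGates (J q) j q a)
    rw [← isIso_of_conjTranspose_mul_self hu, gatesOp_testCircuit, Matrix.mulVec_sub,
      Matrix.mulVec_mulVec, ← Matrix.mul_assoc, mul_eq_one_comm.1 hu, one_mul,
      ← Matrix.mulVec_mulVec]
  have h2 : ∀ a, ∀ q ≤ Q, ∑ b, f a b q ≤ 4 * nsq ψ := by
    intro a q hq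
    have hb := hn q hq
    refine (spread_matchFlip (by omega) (by omega) (φ a q)).trans ?_
    rw [isIso_of_conjTranspose_mul_self (conjTranspose_gatesOp_mul_self _ _)]
  calc ∑ s, nsq (gatesOp (n + 1) (testCircuit (J (q s)) j (q s) n s.1 (β s.2)).gates *ᵥ ψ - ψ)
      ≤ ∑ s : Bits (j + 2) × Bits (j + 2), ∑ q ∈ Finset.range (Q + 1), f s.1 (β s.2) q := by
        refine Finset.sum_le_sum fun s _ => ?_
        rw [h1]
        exact Finset.single_le_sum (f := fun q => f s.1 (β s.2) q) (fun q _ => nsq_nonneg _)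
          (Finset.mem_range.2 (Nat.lt_succ_of_le (hq s)))
    _ = ∑ a : Bits (j + 2), ∑ q ∈ Finset.range (Q + 1), ∑ b, f a b q := by
        rw [Fintype.sum_prod_type]
        refine Finset.sum_congr rfl fun a _ => ?_
        rw [Finset.sum_comm]
        refine Finset.sum_congr rfl fun q _ => ?_
        exact Equiv.sum_comp β fun b => f a b q
    _ ≤ ∑ _a : Bits (j + 2), ∑ _q ∈ Finset.range (Q + 1), 4 * nsq ψ :=
        Finset.sum_le_sum fun a _ => Finset.sum_le_sum fun q hq =>
          h2 a q (Nat.lt_succ_iff.1 (Finset.mem_range.1 hq))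
    _ = _ := by
        simp only [Finset.sum_const, Finset.card_univ, Finset.card_range, nsmul_eq_mul]
        simp
        ring


/-! ### Running programs -/

/-- The program `c`, started on `s`, halts in `s'` after at most `T` steps. -/
def Runs (c : Prog) (s : Store) (T : ℕ) (s' : Store) : Prop := ∃ t ≤ T, Exec c s t s'

lemma Exec.runs {c : Prog} {s s' : Store} {t : ℕ} (h : Exec c s t s') : Runs c s t s' :=
  ⟨t, le_rfl, h⟩

lemma Runs.mono {c : Prog} {s s' : Store} {T T' : ℕ} (h : Runs c s T s') (hT : T ≤ T') :
    Runs c s T' s' := by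
  obtain ⟨t, ht, h⟩ := h
  exact ⟨t, ht.trans hT, h⟩

lemma Runs.congr {c : Prog} {s s' s'' : Store} {T T' : ℕ} (h : Runs c s T s') (hT : T ≤ T')
    (hs : s' = s'') : Runs c s T' s'' := hs ▸ h.mono hT

lemma Runs.seq {c d : Prog} {s s' s'' : Store} {T T' : ℕ} (h : Runs c s T s')
    (h' : Runs d s' T' s'') : Runs (c.seq d) s (T + T') s'' := by
  obtain ⟨t, ht, h⟩ := h
  obtain ⟨t', ht', h'⟩ := h'
  exact ⟨t + t', add_le_add ht ht', h.seq h'⟩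

lemma Runs.loop {r : ℕ} {c : Prog} {T : ℕ} (σ : ℕ → Store) (m : ℕ) (hm : σ m r = [])
    (h : ∀ i < m, σ i r ≠ [] ∧ Runs c (σ i) T (σ (i + 1))) :
    Runs (c.loop r) (σ 0) (m * (T + 1) + 1) (σ m) := by
  induction m generalizing σ with
  | zero => exact ⟨1, by omega, Exec.loopDone hm⟩
  | succ m ih =>
    obtain ⟨h0, t, ht, hc⟩ := h 0 (by omega)
    obtain ⟨t', ht', hl⟩ := ih (fun i => σ (i + 1)) hm fun i hi => h (i + 1) (by omega)
    refine ⟨_, ?_, Exec.loopStep h0 hc hl⟩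
    have : (m + 1) * (T + 1) = m * (T + 1) + (T + 1) := by ring
    omega

/-- A step pushes at most one bit, so outputs of polynomial-time programs have polynomial length.
This bounds the gate counts of interpreter and simulator. -/
lemma Exec.length_le {c : Prog} {s s' : Store} {t : ℕ} (h : Exec c s t s') (r : ℕ) :
    (s' r).length ≤ (s r).length + t := by
  induction h with
  | nop s => omega
  | push s r' b =>
    by_cases hr : r = r'
    · subst hr
      simp
    · rw [Function.update_of_ne hr]
      omega
  | pop s r' =>
    by_cases hr : r = r'
    · subst hr
      simp only [Function.update_self, List.length_tail]
      omega
    · rw [Function.update_of_ne hr]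
      omega
  | seq _ _ ih ih' => omega
  | ifTrue _ _ ih => omega
  | ifFalse _ _ ih => omega
  | loopDone _ => omega
  | loopStep _ _ _ ih ih' => omega

/-- All the stacks of the program have numbers smaller than `R`. -/
def Prog.Below (R : ℕ) : Prog → Prop
  | .nop => True
  | .push r _ => r < R
  | .pop r => r < R
  | .seq c d => c.Below R ∧ d.Below R
  | .ifTop r c d => r < R ∧ c.Below R ∧ d.Below R
  | .loop r c => r < R ∧ c.Below R

lemma Prog.Below.mono {R R' : ℕ} (h : R ≤ R') {c : Prog} (hc : c.Below R) : c.Below R' := by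
  induction c with
  | nop => trivial
  | push r b => exact Nat.lt_of_lt_of_le hc h
  | pop r => exact Nat.lt_of_lt_of_le hc h
  | seq c d ih ih' => exact ⟨ih hc.1, ih' hc.2⟩
  | ifTop r c d ih ih' => exact ⟨Nat.lt_of_lt_of_le hc.1 h, ih hc.2.1, ih' hc.2.2⟩
  | loop r c ih => exact ⟨Nat.lt_of_lt_of_le hc.1 h, ih hc.2⟩

lemma Prog.exists_below (c : Prog) : ∃ R, c.Below R := by
  induction c with
  | nop => exact ⟨0, trivial⟩
  | push r b => exact ⟨r + 1, Nat.lt_succ_self r⟩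
  | pop r => exact ⟨r + 1, Nat.lt_succ_self r⟩
  | seq c d ih ih' =>
    obtain ⟨R, h⟩ := ih
    obtain ⟨R', h'⟩ := ih'
    exact ⟨max R R', h.mono (le_max_left _ _), h'.mono (le_max_right _ _)⟩
  | ifTop r c d ih ih' =>
    obtain ⟨R, h⟩ := ih
    obtain ⟨R', h'⟩ := ih'
    exact ⟨max (r + 1) (max R R'), le_max_left (r + 1) _,
      h.mono ((le_max_left R R').trans (le_max_right _ _)),
      h'.mono ((le_max_right R R').trans (le_max_right _ _))⟩
  | loop r c ih =>
    obtain ⟨R, h⟩ := ih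
    exact ⟨max (r + 1) R, le_max_left (r + 1) _, h.mono (le_max_right _ _)⟩

/-- The first `R` stacks of `s` and the other stacks of `u`. -/
def merge (R : ℕ) (s u : Store) : Store := fun r => if r < R then s r else u r

lemma merge_of_lt {R r : ℕ} (h : r < R) (s u : Store) : merge R s u r = s r := if_pos h

lemma merge_of_le {R r : ℕ} (h : R ≤ r) (s u : Store) : merge R s u r = u r := if_neg (by omega)

lemma merge_update {R r : ℕ} (h : r < R) (s u : Store) (l : List Bool) :
    merge R (Function.update s r l) u = Function.update (merge R s u) r l := by
  funext x
  by_cases hx : x = r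
  · subst hx
    rw [merge_of_lt h, Function.update_self, Function.update_self]
  · rw [Function.update_of_ne hx, merge, merge, Function.update_of_ne hx]

/-- A program leaves alone the stacks that it does not mention. -/
lemma Exec.merge {R : ℕ} {c : Prog} {s s' : Store} {t : ℕ} (h : Exec c s t s') (hc : c.Below R)
    (u : Store) : Exec c (merge R s u) t (merge R s' u) := by
  induction h with
  | nop s => exact Exec.nop _
  | push s r b =>
    rw [merge_update hc, ← merge_of_lt hc s u]
    exact Exec.push _ r b
  | pop s r =>
    rw [merge_update hc, ← merge_of_lt hc s u]
    exact Exec.pop _ r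
  | seq _ _ ih ih' => exact Exec.seq (ih hc.1) (ih' hc.2)
  | ifTrue h _ ih => exact Exec.ifTrue (by rwa [merge_of_lt hc.1]) (ih hc.2.1)
  | ifFalse h _ ih => exact Exec.ifFalse (by rwa [merge_of_lt hc.1]) (ih hc.2.2)
  | loopDone h => exact Exec.loopDone (by rwa [merge_of_lt hc.1])
  | loopStep h _ _ ih ih' => exact Exec.loopStep (by rwa [merge_of_lt hc.1]) (ih hc.2) (ih' hc)

/-! ### Elementary programs -/

/-- Pushes `true` on each of the listed stacks. -/
def pushEach : List ℕ → Prog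
  | [] => .nop
  | r :: l => .seq (.push r true) (pushEach l)

/-- Empties stack `r` and pushes as many `true` on each of the listed stacks. -/
def drain (r : ℕ) (l : List ℕ) : Prog := .loop r (.seq (.pop r) (pushEach l))

/-- The effect of `drain` after `i` rounds. -/
def drainStore (r : ℕ) (l : List ℕ) (s : Store) (i : ℕ) : Store := fun x =>
  if x = r then (s r).drop i else if x ∈ l then List.replicate i true ++ s x else s x

lemma runs_pushEach {l : List ℕ} (hl : l.Nodup) (s : Store) :
    Runs (pushEach l) s (l.length + 1) fun x => if x ∈ l then true :: s x else s x := by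
  induction l generalizing s with
  | nil => simpa [pushEach] using (Exec.nop s).runs
  | cons r l ih =>
    have h := (Exec.push s r true).runs.seq (ih hl.of_cons (Function.update s r (true :: s r)))
    have hr : r ∉ l := (List.nodup_cons.1 hl).1
    refine h.congr (by simp; omega) ?_
    funext x
    by_cases hx : x = r
    · subst hx
      simp [hr]
    · simp [hx]

lemma runs_drain {r : ℕ} {l : List ℕ} (hl : l.Nodup) (hr : r ∉ l) (s : Store) :
    Runs (drain r l) s ((s r).length * (l.length + 3) + 1) (drainStore r l s (s r).length) := by
  have h := Runs.loop (r := r) (c := .seq (.pop r) (pushEach l)) (T := l.length + 2)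
    (drainStore r l s) (s r).length (by simp [drainStore]) fun i hi => ?_
  · have h0 : drainStore r l s 0 = s := by
      funext x
      by_cases hx : x = r
      · simp [drainStore, hx]
      · simp [drainStore, hx]
    rwa [h0] at h
  · refine ⟨by simp [drainStore]; omega, ?_⟩
    have h := (Exec.pop (drainStore r l s i) r).runs.seq (runs_pushEach hl _)
    refine h.congr (by omega) ?_
    funext x
    by_cases hx : x = r
    · subst hx
      simp [drainStore, hr]
    · by_cases hx' : x ∈ l
      · simp [drainStore, hx, hx', List.replicate_succ]
      · simp [drainStore, hx', hx]

/-- Empties stack `r` and pops as many elements from stack `r'`. -/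
def cancel (r r' : ℕ) : Prog := .loop r (.seq (.pop r) (.pop r'))

lemma runs_cancel {r r' : ℕ} (hr : r ≠ r') (s : Store) :
    Runs (cancel r r') s ((s r).length * 3 + 1)
      (Function.update (Function.update s r []) r' ((s r').drop (s r).length)) := by
  have h := Runs.loop (r := r) (c := .seq (.pop r) (.pop r')) (T := 2)
    (fun i => Function.update (Function.update s r ((s r).drop i)) r' ((s r').drop i))
    (s r).length (by simp [hr]) fun i hi => ?_
  · simpa [cancel] using h
  · refine ⟨by simp [hr]; omega, ?_⟩
    have h := (Exec.pop (Function.update (Function.update s r ((s r).drop i)) r'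
      ((s r').drop i)) r).runs.seq (Exec.pop _ r').runs
    refine h.congr le_rfl ?_
    funext x
    by_cases hx : x = r'
    · subst hx
      simp [hr.symm]
    · by_cases hx' : x = r
      · subst hx'
        simp [hr]
      · simp [hx', hx]

/-- Moves the content of stack `r` to stack `r'`, in reverse order. -/
def reverseTo (r r' : ℕ) : Prog :=
  .loop r (.ifTop r (.seq (.pop r) (.push r' true)) (.seq (.pop r) (.push r' false)))

lemma runs_pop_push (s : Store) {r r' : ℕ} (hr : r ≠ r') (b : Bool) :
    Exec (.seq (.pop r) (.push r' b)) s 2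
      (Function.update (Function.update s r (s r).tail) r' (b :: s r')) := by
  have h := (Exec.pop s r).seq (Exec.push (Function.update s r (s r).tail) r' b)
  rwa [Function.update_of_ne hr.symm] at h

lemma runs_reverseTo {r r' : ℕ} (hr : r ≠ r') (s : Store) :
    Runs (reverseTo r r') s ((s r).length * 4 + 1)
      (Function.update (Function.update s r []) r' ((s r).reverse ++ s r')) := by
  generalize hl : s r = l
  induction l generalizing s with
  | nil =>
    refine ⟨1, by simp, ?_⟩
    have : Function.update (Function.update s r []) r' ([].reverse ++ s r') = s := by
      rw [List.reverse_nil, List.nil_append, ← hl]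
      simp
    rw [this]
    exact Exec.loopDone hl
  | cons b l ih =>
    set s' := Function.update (Function.update s r (s r).tail) r' (b :: s r') with hs'
    have hb : Exec (.ifTop r (.seq (.pop r) (.push r' true)) (.seq (.pop r) (.push r' false)))
        s 3 s' := by
      cases b
      · exact Exec.ifFalse (by simp [hl]) (runs_pop_push s hr false)
      · exact Exec.ifTrue (by simp [hl]) (runs_pop_push s hr true)
    obtain ⟨t, ht, h⟩ := ih s' (by simp [hs', hr, hl])
    refine Runs.congr ⟨_, ?_, Exec.loopStep (by simp [hl]) hb h⟩ le_rfl ?_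
    · simp only [List.length_cons]; omega
    · funext x
      by_cases hx : x = r'
      · subst hx
        simp [hs']
      · by_cases hx' : x = r
        · subst hx'
          simp [hs', hr]
        · simp [hs', hx', hx]

/-- Pushes the listed bits on stack `r`. -/
def emit (r : ℕ) : List Bool → Prog
  | [] => .nop
  | b :: l => .seq (.push r b) (emit r l)

lemma runs_emit (r : ℕ) (l : List Bool) (s : Store) :
    Runs (emit r l) s (l.length + 1) (Function.update s r (l.reverse ++ s r)) := by
  induction l generalizing s with
  | nil => simpa [emit] using (Exec.nop s).runs
  | cons b l ih =>
    have h := (Exec.push s r b).runs.seq (ih (Function.update s r (b :: s r)))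
    refine h.congr (by simp; omega) ?_
    simp


/-! ### Decoding random bits

Every sequence of bits, continued by zeros, begins with the description of a pair of circuits. -/

/-- Decodes a number; the second component is the rest of the input. -/
def decNat : List Bool → ℕ × List Bool
  | true :: l => ((decNat l).1 + 1, (decNat l).2)
  | false :: l => (0, l)
  | [] => (0, [])

/-- Decodes a gate. -/
def decGate : List Bool → Gate × List Bool
  | true :: true :: l => (.ccx (decNat l).1 (decNat (decNat l).2).1
      (decNat (decNat (decNat l).2).2).1, (decNat (decNat (decNat l).2).2).2)
  | true :: false :: l => (.cx (decNat l).1 (decNat (decNat l).2).1, (decNat (decNat l).2).2)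
  | [true] => (.cx 0 0, [])
  | false :: true :: l => (.t (decNat l).1, (decNat l).2)
  | false :: false :: l => (.h (decNat l).1, (decNat l).2)
  | [false] => (.h 0, [])
  | [] => (.h 0, [])

lemma length_decNat_le (l : List Bool) :
    (decNat l).1 + (decNat l).2.length ≤ l.length := by
  induction l with
  | nil => simp [decNat]
  | cons b l ih => cases b <;> simp [decNat]; omega

lemma length_decGate_le (l : List Bool) : (decGate l).2.length ≤ l.length := by
  match l with
  | true :: true :: l =>
    have h1 := length_decNat_le l
    have h2 := length_decNat_le (decNat l).2
    have h3 := length_decNat_le (decNat (decNat l).2).2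
    simp only [decGate, List.length_cons]
    omega
  | true :: false :: l =>
    have h1 := length_decNat_le l
    have h2 := length_decNat_le (decNat l).2
    simp only [decGate, List.length_cons]
    omega
  | [true] => simp [decGate]
  | false :: true :: l =>
    have h1 := length_decNat_le l
    simp only [decGate, List.length_cons]
    omega
  | false :: false :: l =>
    have h1 := length_decNat_le l
    simp only [decGate, List.length_cons]
    omega
  | [false] => simp [decGate]
  | [] => simp [decGate]

/-- Decodes a list of gates. -/
def decGates : List Bool → List Gate × List Bool
  | true :: l => ((decGate l).1 :: (decGates (decGate l).2).1, (decGates (decGate l).2).2)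
  | false :: l => ([], l)
  | [] => ([], [])
termination_by l => l.length
decreasing_by all_goals exact Nat.lt_succ_of_le (length_decGate_le l)

lemma length_decGates_le (l : List Bool) :
    (decGates l).1.length + (decGates l).2.length ≤ l.length := by
  induction h : l.length using Nat.strong_induction_on generalizing l with
  | _ m ih =>
    subst h
    match l with
    | true :: l =>
      have h1 := length_decGate_le l
      have h2 := ih _ (Nat.lt_succ_of_le h1) _ rfl
      simp only [decGates, List.length_cons]
      omega
    | false :: l => simp [decGates]
    | [] => simp [decGates]

/-- Decodes a circuit. -/
def decCircuit (l : List Bool) : Circuit × List Bool :=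
  (⟨(decNat l).1, (decGates (decNat l).2).1⟩, (decGates (decNat l).2).2)

lemma length_decCircuit_le (l : List Bool) :
    (decCircuit l).1.qubits + (decCircuit l).1.size + (decCircuit l).2.length ≤ l.length := by
  have h1 := length_decNat_le l
  have h2 := length_decGates_le (decNat l).2
  simp only [decCircuit, Circuit.size]
  omega

/-- Decodes a pair of circuits. -/
def decPair (l : List Bool) : Circuit × Circuit :=
  ((decCircuit l).1, (decCircuit (decCircuit l).2).1)

lemma decNat_encNat (n : ℕ) (l : List Bool) : decNat (encNat n ++ l) = (n, l) := by
  induction n with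
  | zero => rfl
  | succ n ih =>
    rw [encNat, List.replicate_succ, List.cons_append, List.cons_append, decNat]
    rw [encNat] at ih
    rw [ih]

lemma decGate_encGate (g : Gate) (l : List Bool) : decGate (encGate g ++ l) = (g, l) := by
  cases g <;> simp only [encGate, List.cons_append, List.append_assoc, decGate, decNat_encNat]

lemma decGates_encList (gs : List Gate) (l : List Bool) :
    decGates (encList encGate gs ++ l) = (gs, l) := by
  induction gs with
  | nil => simp [encList, decGates]
  | cons g gs ih =>
    simp only [encList, List.cons_append, List.append_assoc, decGates, decGate_encGate, ih]

lemma decCircuit_encCircuit (C : Circuit) (l : List Bool) :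
    decCircuit (encCircuit C ++ l) = (C, l) := by
  simp only [encCircuit, List.append_assoc, decCircuit, decNat_encNat, decGates_encList]

/-- Coins after the end of the code are irrelevant, so every pair with a short code is hit by some
coin sequence of the prescribed length. -/
lemma decPair_encCircuitPair (P : Circuit × Circuit) (l : List Bool) :
    decPair (encCircuitPair P ++ l) = P := by
  simp only [encCircuitPair, List.append_assoc, decPair, decCircuit_encCircuit]

/-! ### The decoder as a program

The input is on stack `1`, the output (reversed) on stack `2`. -/

lemma Exec.congr {c : Prog} {s s' s'' : Store} {t : ℕ} (h : Exec c s t s') (hs : s' = s'') :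
    Exec c s t s'' := hs ▸ h

/-- Started with `l` on stack `1`, the program reads a part of it, leaves `rest`, and writes `out`. -/
def Reads (c : Prog) (l out rest : List Bool) (K : ℕ) : Prop :=
  ∀ s : Store, s 1 = l → s 3 = [] → ∃ t, t + 100 * rest.length ≤ 100 * l.length + K ∧
    Exec c s t (Function.update (Function.update s 1 rest) 2 (out.reverse ++ s 2))

/-- The running time in `Reads` is amortised: each consumed bit pays for 100 steps, and `K` is an
allowance for overhead and for reading past the end. The bounds of consecutive programs simply add.
-/
lemma Reads.seq {c d : Prog} {l o m o' r : List Bool} {K K' : ℕ} (h : Reads c l o m K)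
    (h' : Reads d m o' r K') : Reads (c.seq d) l (o ++ o') r (K + K') := by
  intro s h1 h3
  obtain ⟨t, ht, hc⟩ := h s h1 h3
  obtain ⟨t', ht', hd⟩ := h' (Function.update (Function.update s 1 m) 2 (o.reverse ++ s 2))
    (by simp) (by simp [h3])
  refine ⟨t + t', by omega, (hc.seq hd).congr ?_⟩
  funext x
  by_cases hx : x = 2
  · subst hx; simp
  · by_cases hx' : x = 1
    · subst hx'; simp
    · simp [hx', hx]

lemma Reads.mono {c : Prog} {l o r : List Bool} {K K' : ℕ} (h : Reads c l o r K) (hK : K ≤ K') :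
    Reads c l o r K' := by
  intro s h1 h3
  obtain ⟨t, ht, hc⟩ := h s h1 h3
  exact ⟨t, by omega, hc⟩

/-- Reads a bit and continues according to its value. -/
def branch (c d : Prog) : Prog :=
  .ifTop 1 (.seq (.seq (.pop 1) (.push 2 true)) c) (.seq (.seq (.pop 1) (.push 2 false)) d)

lemma reads_pop_push (l : List Bool) (b : Bool) :
    Reads (.seq (.pop 1) (.push 2 b)) l [b] l.tail 2 := by
  intro s h1 _
  subst h1
  exact ⟨2, by simp; omega, runs_pop_push s (by decide) b⟩

lemma exec_branch_true {c : Prog} {l o r : List Bool} {K : ℕ} (d : Prog) (h : Reads c l o r K)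
    {s : Store} (h1 : s 1 = true :: l) (h3 : s 3 = []) :
    ∃ t, t + 100 * r.length ≤ 100 * l.length + (K + 3) ∧ Exec (branch c d) s t
      (Function.update (Function.update s 1 r) 2 ((true :: o).reverse ++ s 2)) := by
  obtain ⟨t, ht, hc⟩ := h (Function.update (Function.update s 1 (s 1).tail) 2 (true :: s 2))
    (by simp [h1]) (by simp [h3])
  refine ⟨2 + t + 1, by omega, (Exec.ifTrue (by simp [h1])
    ((runs_pop_push s (by decide : (1 : ℕ) ≠ 2) true).seq hc)).congr ?_⟩
  funext x
  by_cases hx : x = 2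
  · subst hx; simp
  · by_cases hx' : x = 1
    · subst hx'; simp
    · simp [hx', hx]

lemma reads_branch_true {c d : Prog} {l o r : List Bool} {K : ℕ} (h : Reads c l o r K) :
    Reads (branch c d) (true :: l) (true :: o) r (K + 3) := by
  intro s h1 h3
  obtain ⟨t, ht, hc⟩ := exec_branch_true d h h1 h3
  exact ⟨t, by simp only [List.length_cons]; omega, hc⟩

lemma reads_branch_false {c d : Prog} {l o r : List Bool} {K : ℕ} (hl : l.head? ≠ some true)
    (h : Reads d l.tail o r K) : Reads (branch c d) l (false :: o) r (K + 3) := by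
  intro s h1 h3
  obtain ⟨t, ht, hc⟩ := (reads_pop_push l false).seq h s h1 h3
  exact ⟨t + 1, by omega, Exec.ifFalse (by simpa [h1] using hl) hc⟩

/-- Reads a number. -/
def readNat : Prog := .seq (.push 3 true) (.loop 3 (branch .nop (.pop 3)))

lemma reads_readNat (l : List Bool) :
    Reads readNat l (encNat (decNat l).1) (decNat l).2 10 := by
  suffices H : ∀ s : Store, s 1 = l → s 3 = [true] →
      ∃ t, t + 100 * (decNat l).2.length ≤ 100 * l.length + 9 ∧
        Exec (.loop 3 (branch .nop (.pop 3))) s t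
          (Function.update (Function.update (Function.update s 3 []) 1 (decNat l).2) 2
            ((encNat (decNat l).1).reverse ++ s 2)) by
    intro s h1 h3
    obtain ⟨t, ht, hc⟩ := H (Function.update s 3 (true :: s 3)) (by simpa using h1) (by simp [h3])
    refine ⟨1 + t, by omega, ((Exec.push s 3 true).seq hc).congr ?_⟩
    have e : Function.update (Function.update s 3 (true :: s 3)) 3 [] = s := by
      rw [Function.update_idem, ← h3, Function.update_eq_self]
    rw [e]
    simp
  -- The flag on stack 3 keeps the loop running. A `false` and an exhausted input both remove it,
  -- since `ifTop` treats them alike.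
  have halt : ∀ (l : List Bool), l.head? ≠ some true → decNat l = (0, l.tail) →
      ∀ s : Store, s 1 = l → s 3 = [true] →
      ∃ t, t + 100 * (decNat l).2.length ≤ 100 * l.length + 9 ∧
        Exec (.loop 3 (branch .nop (.pop 3))) s t
          (Function.update (Function.update (Function.update s 3 []) 1 (decNat l).2) 2
            ((encNat (decNat l).1).reverse ++ s 2)) := by
    intro l hl hd s h1 h3
    have hb : Exec (branch .nop (.pop 3)) s (2 + 1 + 1) _ := Exec.ifFalse (by simpa [h1] using hl)
      ((runs_pop_push s (by decide : (1 : ℕ) ≠ 2) false).seq (Exec.pop _ 3))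
    refine ⟨_, ?_, (Exec.loopStep (by simp [h3]) hb (Exec.loopDone (by simp [h3]))).congr ?_⟩
    rotate_left
    · rw [hd]
      funext x
      by_cases hx : x = 2
      · subst hx; simp [encNat]
      · by_cases hx' : x = 1
        · subst hx'; simp [h1]
        · by_cases hx'' : x = 3
          · subst hx''; simp [h3]
          · simp [hx', hx'', hx]
    · rw [hd]
      simp
      omega
  induction l with
  | nil => exact halt [] (by simp) rfl
  | cons b l ih =>
    cases b
    · exact halt _ (by simp) rfl
    · intro s h1 h3
      have hb := Exec.ifTrue (r := 1) (d := .seq (.seq (.pop 1) (.push 2 false)) (.pop 3))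
        (by simp [h1]) ((runs_pop_push s (by decide : (1 : ℕ) ≠ 2) true).seq (Exec.nop _))
      obtain ⟨t, ht, hc⟩ := ih (Function.update (Function.update s 1 (s 1).tail) 2 (true :: s 2))
        (by simp [h1]) (by simp [h3])
      refine ⟨_, ?_, (Exec.loopStep (by simp [h3]) hb hc).congr ?_⟩
      rotate_left
      · funext x
        by_cases hx : x = 2
        · subst hx
          simp only [decNat, encNat, List.replicate_succ, Function.update_self, List.reverse_append,
            List.reverse_replicate, List.reverse_cons, List.append_assoc,
            List.nil_append, List.cons_append]
        · by_cases hx' : x = 1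
          · subst hx'; simp [decNat]
          · by_cases hx'' : x = 3
            · subst hx''; simp
            · simp [hx', hx'', hx]
      · simp only [decNat, List.length_cons] at ht ⊢
        omega

/-- Reads a gate. -/
def readGate : Prog :=
  branch (branch (.seq (.seq readNat readNat) readNat) (.seq readNat readNat))
    (branch readNat readNat)

lemma reads_readGate (l : List Bool) :
    Reads readGate l (encGate (decGate l).1) (decGate l).2 50 := by
  match l with
  | true :: true :: l =>
    refine (reads_branch_true (reads_branch_true
      (((reads_readNat _).seq (reads_readNat _)).seq (reads_readNat _)))).mono (by norm_num)
  | true :: false :: l =>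
    refine (reads_branch_true (reads_branch_false (by simp)
      ((reads_readNat _).seq (reads_readNat _)))).mono (by norm_num)
  | [true] =>
    refine (reads_branch_true (reads_branch_false (by simp)
      ((reads_readNat _).seq (reads_readNat _)))).mono (by norm_num)
  | false :: true :: l =>
    refine (reads_branch_false (by simp) (reads_branch_true (reads_readNat _))).mono (by norm_num)
  | false :: false :: l =>
    refine (reads_branch_false (by simp) (reads_branch_false (by simp)
      (reads_readNat _))).mono (by norm_num)
  | [false] =>
    refine (reads_branch_false (by simp) (reads_branch_false (by simp)
      (reads_readNat _))).mono (by norm_num)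
  | [] =>
    refine (reads_branch_false (by simp) (reads_branch_false (by simp)
      (reads_readNat _))).mono (by norm_num)

/-- Reads a circuit. -/
def readCircuit : Prog :=
  .seq readNat (.seq (.push 4 true) (.loop 4 (branch readGate (.pop 4))))

lemma exec_readGates (l : List Bool) (s : Store) (h1 : s 1 = l) (h3 : s 3 = []) (h4 : s 4 = [true]) :
    ∃ t, t + 100 * (decGates l).2.length ≤ 100 * l.length + 9 ∧
      Exec (.loop 4 (branch readGate (.pop 4))) s t
        (Function.update (Function.update (Function.update s 4 []) 1 (decGates l).2) 2
          ((encList encGate (decGates l).1).reverse ++ s 2)) := by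
  have halt : ∀ (l : List Bool), l.head? ≠ some true → decGates l = ([], l.tail) →
      ∀ s : Store, s 1 = l → s 4 = [true] →
      ∃ t, t + 100 * (decGates l).2.length ≤ 100 * l.length + 9 ∧
      Exec (.loop 4 (branch readGate (.pop 4))) s t
        (Function.update (Function.update (Function.update s 4 []) 1 (decGates l).2) 2
          ((encList encGate (decGates l).1).reverse ++ s 2)) := by
    intro l hl hd s h1 h4
    have hb : Exec (branch readGate (.pop 4)) s (2 + 1 + 1) _ :=
      Exec.ifFalse (by simpa [h1] using hl)
        ((runs_pop_push s (by decide : (1 : ℕ) ≠ 2) false).seq (Exec.pop _ 4))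
    refine ⟨_, ?_, (Exec.loopStep (by simp [h4]) hb (Exec.loopDone (by simp [h4]))).congr ?_⟩
    rotate_left
    · rw [hd]
      funext x
      by_cases hx : x = 2
      · subst hx; simp [encList]
      · by_cases hx' : x = 1
        · subst hx'; simp [h1]
        · by_cases hx'' : x = 4
          · subst hx''; simp [h4]
          · simp [hx', hx'', hx]
    · rw [hd]
      simp
      omega
  induction h : l.length using Nat.strong_induction_on generalizing l s with
  | _ m ih =>
    subst h
    match l with
    | [] => exact halt [] (by simp) (by simp [decGates]) s h1 h4
    | false :: l => exact halt _ (by simp) (by simp [decGates]) s h1 h4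
    | true :: l =>
      obtain ⟨t, ht, hg⟩ := exec_branch_true (.pop 4) (reads_readGate l) h1 h3
      obtain ⟨t', ht', hl⟩ := ih _ (Nat.lt_succ_of_le (length_decGate_le l)) (decGate l).2
        (Function.update (Function.update s 1 (decGate l).2) 2
          ((true :: encGate (decGate l).1).reverse ++ s 2)) (by simp) (by simp [h3]) (by simp [h4])
        rfl
      refine ⟨_, ?_, (Exec.loopStep (by simp [h4]) hg hl).congr ?_⟩
      rotate_left
      · funext x
        by_cases hx : x = 2
        · subst hx
          simp [decGates, encList]
        · by_cases hx' : x = 1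
          · subst hx'; simp [decGates]
          · by_cases hx'' : x = 4
            · subst hx''; simp
            · simp [hx', hx'', hx]
      · have := length_decGate_le l
        simp only [decGates, List.length_cons] at ht ht' ⊢
        omega

lemma reads_readCircuit (l : List Bool) (s : Store) (h1 : s 1 = l) (h3 : s 3 = [])
    (h4 : s 4 = []) :
    ∃ t, t + 100 * (decCircuit l).2.length ≤ 100 * l.length + 20 ∧
      Exec readCircuit s t (Function.update (Function.update s 1 (decCircuit l).2) 2
        ((encCircuit (decCircuit l).1).reverse ++ s 2)) := by
  obtain ⟨t, ht, hc⟩ := reads_readNat l s h1 h3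
  set s₁ := Function.update (Function.update s 1 (decNat l).2) 2
    ((encNat (decNat l).1).reverse ++ s 2) with hs₁
  obtain ⟨t', ht', hc'⟩ := exec_readGates (decNat l).2 (Function.update s₁ 4 (true :: s₁ 4))
    (by simp [hs₁]) (by simp [hs₁, h3]) (by simp [hs₁, h4])
  refine ⟨_, ?_, (hc.seq ((Exec.push s₁ 4 true).seq hc')).congr ?_⟩
  · simp only [decCircuit]
    omega
  · funext x
    by_cases hx : x = 2
    · subst hx
      simp [hs₁, decCircuit, encCircuit]
    · by_cases hx' : x = 1
      · subst hx'; simp [decCircuit]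
      · by_cases hx'' : x = 4
        · subst hx''; simp [h4]
        · simp [hx', hx'', hx, hs₁]

/-- Decodes the bits on stack `1`. -/
def sampler : Prog :=
  .seq (.seq (.seq (drain 0 []) readCircuit) readCircuit) (reverseTo 2 0)

lemma runs_sampler (n : ℕ) (l : List Bool) : ∃ s, s 0 = encCircuitPair (decPair l) ∧
    Runs sampler
      (fun i => if i = 0 then List.replicate n true else if i = 1 then l else [])
      (5 * (3 * n + 1 + 100 * l.length + 40) + 1) s := by
  set s₀ : Store := fun i => if i = 0 then List.replicate n true else if i = 1 then l else []
  obtain ⟨t₁, ht₁, h₁⟩ := runs_drain (r := 0) (l := []) List.nodup_nil (by simp) s₀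
  set s₁ := drainStore 0 [] s₀ (s₀ 0).length with hs₁
  have e0 : s₁ 0 = [] := by simp [hs₁, drainStore]
  have e1 : s₁ 1 = l := by simp [hs₁, drainStore, s₀]
  have e : ∀ i, 1 < i → s₁ i = [] := fun i hi => by
    simp [hs₁, drainStore, s₀, show i ≠ 0 by omega, show i ≠ 1 by omega]
  obtain ⟨t₂, ht₂, h₂⟩ := reads_readCircuit l s₁ e1 (e 3 (by omega)) (e 4 (by omega))
  set s₂ := Function.update (Function.update s₁ 1 (decCircuit l).2) 2
    ((encCircuit (decCircuit l).1).reverse ++ s₁ 2) with hs₂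
  obtain ⟨t₃, ht₃, h₃⟩ := reads_readCircuit (decCircuit l).2 s₂ (by simp [hs₂])
    (by simp [hs₂, e 3]) (by simp [hs₂, e 4])
  set s₃ := Function.update (Function.update s₂ 1 (decCircuit (decCircuit l).2).2) 2
    ((encCircuit (decCircuit (decCircuit l).2).1).reverse ++ s₂ 2) with hs₃
  have h := (h₁.seq h₂).seq h₃
  -- The output is no longer than the time spent so far, so reversing it costs at most four times as
  -- much: hence the factor 5.
  have hl := h.length_le 2
  rw [show s₀ 2 = [] from rfl, List.length_nil, zero_add] at hl
  have e3 : s₃ 2 = (encCircuitPair (decPair l)).reverse := by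
    simp [hs₃, hs₂, e 2, encCircuitPair, decPair]
  have ht : t₁ + t₂ + t₃ ≤ 3 * n + 1 + 100 * l.length + 40 := by
    have : (s₀ 0).length = n := by simp [s₀]
    rw [this] at ht₁
    simp only [List.length_nil] at ht₁
    omega
  refine ⟨_, ?_, (h.runs.seq (runs_reverseTo (r := 2) (r' := 0) (by decide) s₃)).mono ?_⟩
  · rw [Function.update_self, e3, List.reverse_reverse]
    simp [hs₃, hs₂, e0]
  · omega

/-! ### The family of all pairs of circuits -/

/-- The number of random bits. -/
def coins : Polynomial ℕ := 20 * (Polynomial.X + 2) ^ 2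

lemma eval_coins (n : ℕ) : coins.eval n = 20 * (n + 2) ^ 2 := by simp [coins]

/-- The pairs of circuits described by random bits. -/
def randomPairs : CircuitPairFamily where
  dist n := (PMF.uniformOfFintype (Bits (coins.eval n))).map fun r => decPair (List.ofFn r)
  poly_size := by
    refine ⟨coins, fun n P hP => ?_⟩
    rw [PMF.mem_support_map_iff] at hP
    obtain ⟨r, -, rfl⟩ := hP
    have h1 := length_decCircuit_le (List.ofFn r)
    have h2 := length_decCircuit_le (decCircuit (List.ofFn r)).2
    rw [List.length_ofFn] at h1
    constructor <;> simp only [decPair] <;> omega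

lemma randomPairs_isPolyTime : randomPairs.IsPolyTime := by
  refine ⟨sampler, 5 * (3 * Polynomial.X + 1 + 100 * coins + 40) + 1, coins,
    fun n r => decPair (List.ofFn r), fun n r => ?_, fun n => rfl⟩
  obtain ⟨s, hs, t, ht, h⟩ := runs_sampler n (List.ofFn r)
  refine ⟨t, s, h, ht.trans (le_of_eq ?_), hs⟩
  rw [List.length_ofFn]
  simp

lemma mem_support_randomPairs {n : ℕ} {P : Circuit × Circuit}
    (h : (encCircuitPair P).length ≤ coins.eval n) : P ∈ (randomPairs.dist n).support := by
  rw [randomPairs, PMF.mem_support_map_iff]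
  set l := encCircuitPair P ++ List.replicate (coins.eval n - (encCircuitPair P).length) false
    with hl
  have hlen : l.length = coins.eval n := by
    rw [hl, List.length_append, List.length_replicate]
    omega
  refine ⟨fun i => l.get (i.cast hlen.symm), by simp, ?_⟩
  have : List.ofFn (fun i : Fin (coins.eval n) => l.get (i.cast hlen.symm)) = l := by
    refine List.ext_get (by simp [hlen]) fun i h1 h2 => by simp
  rw [this, hl, decPair_encCircuitPair]

lemma length_encNat (n : ℕ) : (encNat n).length = n + 1 := by simp [encNat]

lemma length_encGate_le {N : ℕ} {g : Gate} (h : g.Below N) : (encGate g).length ≤ 3 * N + 2 := by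
  cases g <;> simp only [Gate.Below] at h <;>
    simp only [encGate, List.length_cons, List.length_append, length_encNat] <;> omega

lemma length_encList_le {α : Type} {enc : α → List Bool} {K : ℕ} {l : List α}
    (h : ∀ a ∈ l, (enc a).length ≤ K) : (encList enc l).length ≤ l.length * (K + 1) + 1 := by
  induction l with
  | nil => simp [encList]
  | cons a l ih =>
    have h1 := h a List.mem_cons_self
    have h2 := ih fun a ha => h a (List.mem_cons_of_mem _ ha)
    simp only [encList, List.length_cons, List.length_append]
    have : (l.length + 1) * (K + 1) = l.length * (K + 1) + (K + 1) := by ring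
    omega

/-- With unary wire numbers, each of at most n gates costs O(n) bits. The number of coins is twice
this bound, enough for a pair. -/
lemma length_encCircuit_le {n : ℕ} {C : Circuit} (h1 : C.qubits ≤ n + 1) (h2 : C.size ≤ n)
    (h3 : ∀ g ∈ C.gates, g.Below (n + 1)) : (encCircuit C).length ≤ 10 * (n + 2) ^ 2 := by
  have h := length_encList_le fun g hg => length_encGate_le (h3 g hg)
  rw [encCircuit, List.length_append, length_encNat]
  have h4 : C.gates.length * (3 * (n + 1) + 2 + 1) ≤ n * (3 * (n + 1) + 2 + 1) :=
    Nat.mul_le_mul_right _ h2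
  nlinarith

/-- The family contains every pair of circuits that are not too large. -/
lemma mem_support_randomPairs_of_le {n : ℕ} {P : Circuit × Circuit} (h1 : P.1.qubits ≤ n + 1)
    (h2 : P.1.size ≤ n) (h3 : ∀ g ∈ P.1.gates, g.Below (n + 1)) (h1' : P.2.qubits ≤ n + 1)
    (h2' : P.2.size ≤ n) (h3' : ∀ g ∈ P.2.gates, g.Below (n + 1)) :
    P ∈ (randomPairs.dist n).support := by
  refine mem_support_randomPairs ?_
  have a := length_encCircuit_le h1 h2 h3
  have b := length_encCircuit_le h1' h2' h3'
  rw [eval_coins, encCircuitPair, List.length_append]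
  omega


/-! ### The attack is efficient -/

lemma encList_append {α : Type} (enc : α → List Bool) (l : List α) :
    ∃ e, encList enc l = e ++ [false] ∧ ∀ l', encList enc (l ++ l') = e ++ encList enc l' := by
  induction l with
  | nil => exact ⟨[], rfl, fun _ => rfl⟩
  | cons a l ih =>
    obtain ⟨e, he, h⟩ := ih
    exact ⟨true :: (enc a ++ e), by simp [encList, he], fun l' => by simp [encList, h]⟩

/-- The additional ancillas are a unary prefix, and the two additional gates replace the final end
marker. The description of the interpreter can thus be edited at its ends without being parsed. -/
lemma encQAlg_attack (J : QAlg) (n q₁ q₂ : ℕ) : ∃ e, encQAlg J = e ++ [false] ∧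
    encQAlg (attack J n q₁ q₂) = List.replicate (n + 1 - q₂) true ++ (e ++
      ([true, true, false, false] ++ (List.replicate (q₁ + n) true ++ ([false, true, true, false] ++
        (List.replicate (q₁ + n) true ++ [false, false, false]))))) := by
  obtain ⟨e, he, h⟩ := encList_append encGate J.gates
  refine ⟨encNat J.ancillas ++ e, by simp [encQAlg, he], ?_⟩
  rw [encQAlg, attack, h, encNat]
  simp only [encList, encGate, encNat, List.replicate_zero, List.nil_append, List.append_assoc,
    List.cons_append]
  rw [List.replicate_add (n + 1 - q₂), List.append_assoc]

/-- Computes the parameters of the interpreter, whose program uses stacks smaller than `R`, and saves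
on stacks from `R` on what is needed later. -/
def attackPrepare (R : ℕ) : Prog :=
  .seq (.seq (.seq (.seq (.seq (drain 0 [R, R + 1, R + 2]) (drain 1 [0, R + 1]))
    (drain (R + 2) [1])) (.push 1 true)) (.push R true)) (cancel 2 R)

/-- Turns the description of the interpreter into that of the attack. -/
def attackFinish (R : ℕ) : Prog :=
  .seq (.seq (.seq (.seq (.seq (.seq (.seq (.seq (reverseTo 0 (R + 2)) (.pop (R + 2)))
    (emit (R + 2) [true, true, false, false])) (drain (R + 1) [R + 2, R + 3]))
    (emit (R + 2) [false, true, true, false])) (drain (R + 3) [R + 2]))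
    (emit (R + 2) [false, false, false])) (reverseTo (R + 2) 0)) (drain R [0])

lemma runs_attackPrepare {R : ℕ} (hR : 3 ≤ R) (n q₁ q₂ : ℕ) : ∃ s,
    Runs (attackPrepare R) (unaryStore ![n, q₁, q₂]) (20 * (n + q₁ + q₂) + 20) s ∧
    (∀ r < R, s r = unaryStore ![q₁, n + 1] r) ∧ s R = List.replicate (n + 1 - q₂) true ∧
    s (R + 1) = List.replicate (q₁ + n) true ∧ s (R + 2) = [] ∧ s (R + 3) = [] := by
  have n0 : R ≠ 0 := by omega
  have n1 : R ≠ 1 := by omega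
  have n2 : R ≠ 2 := by omega
  set s₀ : Store := unaryStore ![n, q₁, q₂] with hs₀
  have e00 : s₀ 0 = List.replicate n true := rfl
  have e01 : s₀ 1 = List.replicate q₁ true := rfl
  have e02 : s₀ 2 = List.replicate q₂ true := rfl
  have e03 : ∀ r, 3 ≤ r → s₀ r = [] := fun r hr => dif_neg (by omega)
  have h₁ := runs_drain (r := 0) (l := [R, R + 1, R + 2]) (by simp) (by simp [n0.symm]) s₀
  have h₂ := runs_drain (r := 1) (l := [0, R + 1]) (by simp) (by simp [n0])
    (drainStore 0 [R, R + 1, R + 2] s₀ (s₀ 0).length)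
  have len0 : (s₀ 0).length = n := by simp [e00]
  rw [len0] at h₁ h₂
  set s₁ := drainStore 0 [R, R + 1, R + 2] s₀ n with hs₁
  have e10 : s₁ 0 = [] := by simp [hs₁, drainStore, e00]
  have e11 : s₁ 1 = List.replicate q₁ true := by simp [hs₁, drainStore, n1.symm, n0, e01]
  have e12 : s₁ 2 = List.replicate q₂ true := by
    simp [hs₁, drainStore, n2.symm, n1, n0, e02]
  have e1R : s₁ R = List.replicate n true := by simp [hs₁, drainStore, n0, e03 R hR]
  have e1R1 : s₁ (R + 1) = List.replicate n true := by simp [hs₁, drainStore, e03 (R + 1) (by omega)]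
  have e1R2 : s₁ (R + 2) = List.replicate n true := by simp [hs₁, drainStore, e03 (R + 2) (by omega)]
  have e1 : ∀ r, 3 ≤ r → r < R ∨ R + 3 ≤ r → s₁ r = [] := fun r hr hr' => by
    simp [hs₁, drainStore, show r ≠ 0 by omega, show r ≠ R by omega, show r ≠ R + 1 by omega,
      show r ≠ R + 2 by omega, e03 r hr]
  have len1 : (s₁ 1).length = q₁ := by simp [e11]
  rw [len1] at h₂
  set s₂ := drainStore 1 [0, R + 1] s₁ q₁ with hs₂
  have e20 : s₂ 0 = List.replicate q₁ true := by simp [hs₂, drainStore, e10]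
  have e21 : s₂ 1 = [] := by simp [hs₂, drainStore, e11]
  have e2R1 : s₂ (R + 1) = List.replicate (q₁ + n) true := by
    simp [hs₂, drainStore, e1R1, n0]
  have e2 : ∀ r, r ≠ 0 → r ≠ 1 → r ≠ R + 1 → s₂ r = s₁ r := fun r a b c => by
    simp [hs₂, drainStore, a, b, c]
  have h₃ := runs_drain (r := R + 2) (l := [1]) (by simp) (by simp) s₂
  have len2 : (s₂ (R + 2)).length = n := by
    rw [e2 _ (by omega) (by omega) (by omega), e1R2, List.length_replicate]
  rw [len2] at h₃
  set s₃ := drainStore (R + 2) [1] s₂ n with hs₃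
  have e31 : s₃ 1 = List.replicate n true := by simp [hs₃, drainStore, e21]
  have e3R2 : s₃ (R + 2) = [] := by simp [hs₃, drainStore, len2]
  have e3 : ∀ r, r ≠ 1 → r ≠ R + 2 → s₃ r = s₂ r := fun r a b => by
    simp [hs₃, drainStore, a, b]
  have h₄ := (Exec.push s₃ 1 true).runs
  set s₄ := Function.update s₃ 1 (true :: s₃ 1) with hs₄
  have h₅ := (Exec.push s₄ R true).runs
  set s₅ := Function.update s₄ R (true :: s₄ R) with hs₅
  have e5R : s₅ R = List.replicate (n + 1) true := by
    rw [hs₅, Function.update_self, hs₄, Function.update_of_ne n1, e3 _ n1 (by omega),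
      e2 _ n0 n1 (by omega), e1R, List.replicate_succ]
  have e51 : s₅ 1 = List.replicate (n + 1) true := by
    rw [hs₅, Function.update_of_ne n1.symm, hs₄, Function.update_self, e31, List.replicate_succ]
  have e5 : ∀ r, r ≠ 1 → r ≠ R → s₅ r = s₃ r := fun r a b => by
    rw [hs₅, Function.update_of_ne b, hs₄, Function.update_of_ne a]
  have e52 : s₅ 2 = List.replicate q₂ true := by
    rw [e5 _ (by omega) n2.symm, e3 _ (by omega) (by omega), e2 _ (by omega) (by omega) (by omega),
      e12]
  -- Popping an empty stack has no effect, so this computes the truncated difference n + 1 - q₂.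
  have h₆ := runs_cancel n2.symm s₅
  set s₆ := Function.update (Function.update s₅ 2 []) R ((s₅ R).drop (s₅ 2).length) with hs₆
  have e6 : ∀ r, r ≠ 2 → r ≠ R → s₆ r = s₅ r := fun r a b => by
    rw [hs₆, Function.update_of_ne b, Function.update_of_ne a]
  refine ⟨s₆, ((((((h₁.seq h₂).seq h₃).seq h₄).seq h₅).seq h₆).mono ?_), ?_, ?_, ?_, ?_, ?_⟩
  · rw [e52]
    simp
    omega
  · intro r hr
    by_cases hr0 : r = 0
    · subst hr0
      rw [e6 _ (by omega) (by omega), e5 _ (by omega) (by omega), e3 _ (by omega) (by omega), e20]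
      rfl
    · by_cases hr1 : r = 1
      · subst hr1
        rw [e6 _ (by omega) (by omega), e51]
        rfl
      · rw [show unaryStore ![q₁, n + 1] r = [] from dif_neg (by omega)]
        by_cases hr2 : r = 2
        · subst hr2
          rw [hs₆, Function.update_of_ne (by omega), Function.update_self]
        · rw [e6 _ hr2 (by omega), e5 _ hr1 (by omega), e3 _ hr1 (by omega),
            e2 _ hr0 hr1 (by omega), e1 _ (by omega) (Or.inl hr)]
  · rw [hs₆, Function.update_self, e5R, e52]
    simp
  · rw [e6 _ (by omega) (by omega), e5 _ (by omega) (by omega), e3 _ (by omega) (by omega), e2R1]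
  · rw [e6 _ (by omega) (by omega), e5 _ (by omega) (by omega), e3R2]
  · rw [e6 _ (by omega) (by omega), e5 _ (by omega) (by omega), e3 _ (by omega) (by omega),
      e2 _ (by omega) (by omega) (by omega), e1 _ (by omega) (Or.inr le_rfl)]

lemma runs_attackFinish {R : ℕ} (hR : 3 ≤ R) (s : Store) (e : List Bool) (k f : ℕ)
    (h0 : s 0 = e ++ [false]) (hk : s R = List.replicate k true)
    (hf : s (R + 1) = List.replicate f true) (h2 : s (R + 2) = []) (h3 : s (R + 3) = []) :
    ∃ s', Runs (attackFinish R) s (10 * (e.length + k + f) + 10 * f + 200) s' ∧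
      s' 0 = List.replicate k true ++ (e ++ ([true, true, false, false] ++ (List.replicate f true ++
        ([false, true, true, false] ++ (List.replicate f true ++ [false, false, false]))))) := by
  have n0 : R ≠ 0 := by omega
  have h₁ := runs_reverseTo (r := 0) (r' := R + 2) (by omega) s
  set s₁ := Function.update (Function.update s 0 []) (R + 2) ((s 0).reverse ++ s (R + 2)) with hs₁
  have h₂ := (Exec.pop s₁ (R + 2)).runs
  set s₂ := Function.update s₁ (R + 2) (s₁ (R + 2)).tail with hs₂
  have h₃ := runs_emit (R + 2) [true, true, false, false] s₂
  set s₃ := Function.update s₂ (R + 2) ([true, true, false, false].reverse ++ s₂ (R + 2)) with hs₃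
  have a3 : s₃ (R + 2) = [true, true, false, false].reverse ++ e.reverse := by
    simp [hs₃, hs₂, hs₁, h0, h2]
  have b3 : ∀ r, r ≠ 0 → r ≠ R + 2 → s₃ r = s r := fun r a b => by
    simp [hs₃, hs₂, hs₁, a, b]
  have c3 : s₃ 0 = [] := by simp [hs₃, hs₂, hs₁]
  have h₄ := runs_drain (r := R + 1) (l := [R + 2, R + 3]) (by simp) (by simp) s₃
  have len3 : (s₃ (R + 1)).length = f := by
    rw [b3 _ (by omega) (by omega), hf, List.length_replicate]
  rw [len3] at h₄
  set s₄ := drainStore (R + 1) [R + 2, R + 3] s₃ f with hs₄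
  have a4 : s₄ (R + 2) = List.replicate f true ++ s₃ (R + 2) := by simp [hs₄, drainStore]
  have a4' : s₄ (R + 3) = List.replicate f true := by
    simp [hs₄, drainStore, b3 (R + 3) (by omega) (by omega), h3]
  have b4 : ∀ r, r ≤ R → s₄ r = s₃ r := fun r hr => by
    simp [hs₄, drainStore, show r ≠ R + 1 by omega, show r ≠ R + 2 by omega,
      show r ≠ R + 3 by omega]
  have h₅ := runs_emit (R + 2) [false, true, true, false] s₄
  set s₅ := Function.update s₄ (R + 2) ([false, true, true, false].reverse ++ s₄ (R + 2)) with hs₅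
  have h₆ := runs_drain (r := R + 3) (l := [R + 2]) (by simp) (by simp) s₅
  have len5 : (s₅ (R + 3)).length = f := by
    rw [hs₅, Function.update_of_ne (by omega), a4', List.length_replicate]
  rw [len5] at h₆
  set s₆ := drainStore (R + 3) [R + 2] s₅ f with hs₆
  have a6 : s₆ (R + 2) = List.replicate f true ++ s₅ (R + 2) := by simp [hs₆, drainStore]
  have b6 : ∀ r, r ≤ R → s₆ r = s₄ r := fun r hr => by
    simp [hs₆, hs₅, drainStore, show r ≠ R + 2 by omega, show r ≠ R + 3 by omega]
  have h₇ := runs_emit (R + 2) [false, false, false] s₆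
  set s₇ := Function.update s₆ (R + 2) ([false, false, false].reverse ++ s₆ (R + 2)) with hs₇
  have a7 : s₇ (R + 2) = (e ++ ([true, true, false, false] ++ (List.replicate f true ++
        ([false, true, true, false] ++ (List.replicate f true ++ [false, false, false]))))).reverse := by
    rw [hs₇, Function.update_self, a6, hs₅, Function.update_self, a4, a3]
    simp only [List.reverse_append, List.reverse_replicate, List.append_assoc]
  have h₈ := runs_reverseTo (r := R + 2) (r' := 0) (by omega) s₇
  set s₈ := Function.update (Function.update s₇ (R + 2) []) 0 ((s₇ (R + 2)).reverse ++ s₇ 0) with hs₈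
  have b7 : ∀ r, r ≤ R → s₇ r = s₃ r := fun r hr => by
    rw [hs₇, Function.update_of_ne (by omega), b6 r hr, b4 r hr]
  have a8 : s₈ R = List.replicate k true := by
    rw [hs₈, Function.update_of_ne n0, Function.update_of_ne (by omega), b7 R le_rfl,
      b3 _ n0 (by omega), hk]
  have h₉ := runs_drain (r := R) (l := [0]) (by simp) (by simp [n0]) s₈
  refine ⟨_, ((((((((h₁.seq h₂).seq h₃).seq h₄).seq h₅).seq h₆).seq h₇).seq h₈).seq h₉).mono ?_, ?_⟩
  · rw [h0, a8, a7]
    simp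
    omega
  · rw [a8]
    simp only [drainStore, n0.symm, if_false, List.mem_singleton, if_true, List.length_replicate]
    rw [hs₈, Function.update_self, a7, List.reverse_reverse, b7 0 (by omega), c3, List.append_nil]

lemma eval_le_eval (p : Polynomial ℕ) {a b : ℕ} (h : a ≤ b) : p.eval a ≤ p.eval b := by
  rw [Polynomial.eval_eq_sum, Polynomial.eval_eq_sum]
  exact Finset.sum_le_sum fun i _ => Nat.mul_le_mul_left _ (Nat.pow_le_pow_left h i)

lemma isQPT_attack {J : (Fin 2 → ℕ) → QAlg} (hJ : IsQPT J) :
    IsQPT fun v : Fin 3 → ℕ => attack (J ![v 1, v 0 + 1]) (v 0) (v 1) (v 2) := by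
  obtain ⟨c, p, hc⟩ := hJ
  obtain ⟨R₀, hR₀⟩ := c.exists_below
  set R := max R₀ 3 with hRdef
  have hcR : c.Below R := hR₀.mono (le_max_left _ _)
  have hR : 3 ≤ R := le_max_right _ _
  refine ⟨.seq (.seq (attackPrepare R) c) (attackFinish R),
    50 * (Polynomial.X + 10) + 20 * p.comp (Polynomial.X + 1), fun v => ?_⟩
  have hv : v = ![v 0, v 1, v 2] := by
    funext i
    fin_cases i <;> rfl
  generalize v 0 = n at hv
  generalize v 1 = q₁ at hv
  generalize v 2 = q₂ at hv
  subst hv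
  simp only [Matrix.cons_val_zero, Matrix.cons_val_one, Matrix.cons_val]
  obtain ⟨s₁, ⟨t₁, ht₁, h₁⟩, hlow, hRk, hR1, hR2, hR3⟩ := runs_attackPrepare hR n q₁ q₂
  obtain ⟨t₂, s₂, h₂, ht₂, hs₂⟩ := hc ![q₁, n + 1]
  have h₂' := h₂.merge hcR s₁
  -- The interpreter's program is known to work only on its own initial store. The stacks below `R`
  -- agree with that store, and those from `R` on survive the run.
  have hm : merge R (unaryStore ![q₁, n + 1]) s₁ = s₁ := by
    funext r
    by_cases hr : r < R
    · rw [merge_of_lt hr, hlow r hr]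
    · rw [merge_of_le (by omega)]
  rw [hm] at h₂'
  obtain ⟨e, he, hatt⟩ := encQAlg_attack (J ![q₁, n + 1]) n q₁ q₂
  obtain ⟨s₃, ⟨t₃, ht₃, h₃⟩, hs₃⟩ := runs_attackFinish hR (merge R s₂ s₁) e (n + 1 - q₂) (q₁ + n)
    (by rw [merge_of_lt (by omega), hs₂, he]) (by rw [merge_of_le le_rfl, hRk])
    (by rw [merge_of_le (by omega), hR1]) (by rw [merge_of_le (by omega), hR2])
    (by rw [merge_of_le (by omega), hR3])
  refine ⟨_, s₃, (h₁.seq h₂').seq h₃, ?_, by rw [hs₃, hatt]⟩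
  -- Stack 0 initially holds q₁ bits and grows by at most one per step.
  have hel : e.length + 1 ≤ q₁ + t₂ := by
    have := h₂.length_le 0
    rw [hs₂, he] at this
    simpa [unaryStore] using this
  have hsum : ∑ i, ![n, q₁, q₂] i = n + q₁ + q₂ := by simp [Fin.sum_univ_three]
  have hsum2 : ∑ i, ![q₁, n + 1] i = q₁ + (n + 1) := by simp [Fin.sum_univ_two]
  rw [hsum2] at ht₂
  have hp : p.eval (q₁ + (n + 1)) ≤ p.eval (n + q₁ + q₂ + 1) := eval_le_eval p (by omega)
  rw [hsum]
  simp only [Polynomial.eval_add, Polynomial.eval_mul, Polynomial.eval_X, Polynomial.eval_comp,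
    Polynomial.eval_ofNat, Polynomial.eval_one]
  omega


/-! ### Asymptotics -/

lemma eventually_mul_eval_le_two_pow (P : Polynomial ℕ) (c : ℕ) :
    ∀ᶠ k : ℕ in Filter.atTop, c * P.eval k ≤ 2 ^ k := by
  induction P using Polynomial.induction_on' generalizing c with
  | add P Q hP hQ =>
    filter_upwards [hP (2 * c), hQ (2 * c)] with k h1 h2
    rw [Polynomial.eval_add]
    nlinarith
  | monomial d a =>
    have h := tendsto_pow_const_div_const_pow_of_one_lt d (by norm_num : (1 : ℝ) < 2)
    have hpos : (0 : ℝ) < 1 / (c * a + 1) := by positivity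
    filter_upwards [h.eventually_le_const hpos] with k hk
    rw [Polynomial.eval_monomial]
    have h2 : (0 : ℝ) < 2 ^ k := by positivity
    have h3 : (0 : ℝ) < c * a + 1 := by positivity
    rw [div_le_div_iff₀ h2 h3, one_mul] at hk
    have h4 : (c : ℝ) * (a * k ^ d) ≤ 2 ^ k := by
      have : (0 : ℝ) ≤ (k : ℝ) ^ d := by positivity
      nlinarith
    exact_mod_cast h4

lemma Negligible.exists_forall_le {ε : ℕ → ℝ} (h : Negligible ε) {δ : ℝ} (hδ : 0 < δ) :
    ∃ M, ∀ m, M ≤ m → ε m ≤ δ := by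
  have h0 := h 0
  simp only [pow_zero, one_mul] at h0
  exact Filter.eventually_atTop.1 (h0.eventually_le_const hδ)

/-! ### Sizes of uniform families -/

lemma IsUniform.exists_length_le {α : Type} {d : ℕ} {enc : α → List Bool} {F : (Fin d → ℕ) → α}
    (h : IsUniform enc F) : ∃ P : Polynomial ℕ, ∀ v, (enc (F v)).length ≤ P.eval (∑ i, v i) := by
  obtain ⟨c, p, hc⟩ := h
  refine ⟨Polynomial.X + p, fun v => ?_⟩
  obtain ⟨t, s, h, ht, hs⟩ := hc v
  have h1 := h.length_le 0
  rw [hs] at h1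
  have h2 : (unaryStore v 0).length ≤ ∑ i, v i := by
    unfold unaryStore
    split_ifs with hd
    · rw [List.length_replicate]
      exact Finset.single_le_sum (f := v) (fun _ _ => Nat.zero_le _) (Finset.mem_univ _)
    · simp
  simp only [Polynomial.eval_add, Polynomial.eval_X]
  omega

lemma length_le_length_encList {α : Type} (enc : α → List Bool) (l : List α) :
    l.length ≤ (encList enc l).length := by
  induction l with
  | nil => simp
  | cons a l ih =>
    simp only [encList, List.length_cons, List.length_append]
    omega

lemma QAlg.ancillas_le (A : QAlg) : A.ancillas ≤ (encQAlg A).length := by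
  rw [encQAlg, List.length_append, length_encNat]
  omega

lemma QAlg.length_gates_le (A : QAlg) : A.gates.length ≤ (encQAlg A).length := by
  have := length_le_length_encList encGate A.gates
  rw [encQAlg, List.length_append]
  omega

lemma OAlg.length_gates_le (S : OAlg) : S.gates.length ≤ (encOAlg S).length := by
  have := length_le_length_encList encOGate S.gates
  rw [encOAlg, List.length_append]
  omega

/-! ### The success of the attack -/

lemma posSemidef_padded {q N : ℕ} (h : q ≤ N) {σ : Op q} (hσ : σ.PosSemidef) :
    (padded N σ).PosSemidef := by
  obtain ⟨r, rfl⟩ := Nat.exists_eq_add_of_le h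
  rw [← tensor_zeroState]
  exact posSemidef_tensor hσ (posSemidef_single _)

lemma trace_padded {q N : ℕ} (h : q ≤ N) {σ : Op q} (hσ : σ.trace = 1) :
    (padded N σ).trace = 1 := by
  obtain ⟨r, rfl⟩ := Nat.exists_eq_add_of_le h
  rw [← tensor_zeroState, trace_tensor, hσ, zeroState, trace_single, one_mul]

lemma size_pointCircuit (j : ℕ) (a b : Bits (j + 2)) : (pointCircuit j a b).size = 34 * j + 60 :=
  length_pointGates j _ _

lemma size_testCircuit (J : QAlg) {j q n : ℕ} (a b : Bits (j + 2))
    (h : 8 * (6 * (j + 2) + J.gates.length) + 16 * j + 28 ≤ n) :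
    (testCircuit J j q n a b).size = n := by
  have := length_testGates_le J j q n a b
  simp only [Circuit.size, testCircuit, List.length_append, nops, List.length_replicate]
  omega

/-- With correct obfuscations of a point function and of a test for it, the attack finds out the
result of the test. -/
lemma abs_prOne_attack_sub_le {J : (Fin 2 → ℕ) → QAlg} {j n : ℕ} (a b b' : Bits (j + 2))
    (σ τ : QState) (hn : σ.qubits + 3 * (j + 2) + (J ![σ.qubits, 3 * (j + 2)]).ancillas + (j + 1) ≤ n)
    {δ₁ δ₂ : ℝ} (D : Circuit)
    (hD : D = testCircuit (J ![σ.qubits, 3 * (j + 2)]) j σ.qubits n a b')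
    (hσ : ∀ ρ : Op (pointCircuit j a b).qubits, ρ.PosSemidef → ρ.trace = 1 →
      traceNorm ((J ![σ.qubits, (pointCircuit j a b).qubits]).interpret (tensor σ.op ρ) -
        (pointCircuit j a b).unitary * ρ * (pointCircuit j a b).unitaryᴴ) ≤ δ₁)
    (hτ : ∀ ρ : Op D.qubits, ρ.PosSemidef → ρ.trace = 1 →
      traceNorm ((J ![τ.qubits, D.qubits]).interpret (tensor τ.op ρ) -
        D.unitary * ρ * D.unitaryᴴ) ≤ δ₂) :
    |prOne ((attack (J ![τ.qubits, n + 1]) n τ.qubits σ.qubits).run (tensor τ.op σ.op)) -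
      (if b = b' then 1 else 0)| ≤ δ₁ + δ₂ := by
  subst hD
  have hq : σ.qubits ≤ n + 1 := by omega
  rw [prOne_attack _ (by omega) hq]
  have h2 := (abs_prob_sub_le_traceNorm (fun x => ext x n = true) _ _).trans
    (hτ (padded (n + 1) σ.op) (posSemidef_padded hq σ.posSemidef) (trace_padded hq σ.trace_eq_one))
  have h1 := (abs_prob_sub_le_traceNorm (OutputIs j b') _ _).trans
    (hσ (Matrix.single (pointInput j a) (pointInput j a) 1) (posSemidef_single _) (trace_single _))
  have e1 := prob_pointCircuit j a b b'
  have e2 := prob_testCircuit (J ![σ.qubits, 3 * (j + 2)]) (j := j) (q := σ.qubits) (n := n)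
    (M := n - (σ.qubits + 3 * (j + 2) + (J ![σ.qubits, 3 * (j + 2)]).ancillas)) (by omega)
    (by omega) a b' σ.op
  change |prob (OutputIs j b') ((J ![σ.qubits, 3 * (j + 2)]).interpret (tensor σ.op
    (Matrix.single (pointInput j a) (pointInput j a) 1))) - prob (OutputIs j b')
      (gatesOp (3 * (j + 2)) (pointCircuit j a b).gates *
        (Matrix.single (pointInput j a) (pointInput j a) 1 : Op (3 * (j + 2))) *
        (gatesOp (3 * (j + 2)) (pointCircuit j a b).gates)ᴴ)| ≤ δ₁ at h1
  change |prob (fun x => ext x n = true) ((J ![τ.qubits, n + 1]).interpret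
    (tensor τ.op (padded (n + 1) σ.op))) - prob (fun x => ext x n = true)
      (gatesOp (n + 1) (testCircuit (J ![σ.qubits, 3 * (j + 2)]) j σ.qubits n a b').gates *
        padded (n + 1) σ.op *
        (gatesOp (n + 1) (testCircuit (J ![σ.qubits, 3 * (j + 2)]) j σ.qubits n a b').gates)ᴴ)| ≤
      δ₂ at h2
  rw [e2] at h2
  rw [e1] at h1
  -- The intermediate quantity is the probability that the interpreter, given the obfuscated point
  -- function, maps a to b'. The ideal test, applied to that state, accepts with exactly this
  -- probability.
  have := abs_sub_le
    (prob (fun x => ext x n = true) ((J ![τ.qubits, n + 1]).interpret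
      (tensor τ.op (padded (n + 1) σ.op))))
    (prob (OutputIs j b') ((J ![σ.qubits, 3 * (j + 2)]).interpret (tensor σ.op
      (Matrix.single (pointInput j a) (pointInput j a) 1))))
    (if b = b' then 1 else 0)
  linarith

/-- The bitwise complement. -/
def complement (m : ℕ) : Equiv.Perm (Bits m) := Equiv.arrowCongr (Equiv.refl _) Equiv.boolNot

lemma ne_complement {m : ℕ} (b : Bits (m + 1)) : b ≠ complement (m + 1) b := fun h => by
  have := congrFun h 0
  simp [complement, Equiv.arrowCongr] at this

/-! ### The impossibility of obfuscation -/

lemma not_exists_obfuscator {O : Circuit → QState} {J : (Fin 2 → ℕ) → QAlg} (hJ : IsQPT J)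
    (hE : PolyExpansion randomPairs O) (hF : FunctionalEquivalence randomPairs O J)
    (hV : TwoCircuitVBB randomPairs O) : False := by
  obtain ⟨S, hS, ε, hε, hVBB⟩ := hV _ (isQPT_attack hJ)
  obtain ⟨p, hp⟩ := hE
  obtain ⟨η, hη, hFE⟩ := hF
  obtain ⟨PJ, hPJ⟩ := hJ.exists_length_le
  obtain ⟨PS, hPS⟩ := hS.exists_length_le
  obtain ⟨M₁, hM₁⟩ := hε.exists_forall_le (by norm_num : (0 : ℝ) < 1 / 20)
  obtain ⟨M₂, hM₂⟩ := hη.exists_forall_le (by norm_num : (0 : ℝ) < 1 / 20)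
  -- Polynomials in j: `rQ` bounds the obfuscation of a point circuit, which has 3j + 6 qubits and
  -- 34j + 60 gates; `rB` bounds the description of the interpreter for it; `rn` leaves room for the
  -- test, with eight copies of the loading part; `rT` bounds the simulator, whose parameters sum to
  -- 3n + 37j + 67.
  set rQ : Polynomial ℕ := p.comp (37 * Polynomial.X + 66) with hrQ
  set rB : Polynomial ℕ := PJ.comp (rQ + (3 * Polynomial.X + 6)) with hrB
  set rn : Polynomial ℕ := rQ + 9 * rB + 200 * (Polynomial.X + 1) with hrn
  set rT : Polynomial ℕ := PS.comp (3 * rn + 37 * Polynomial.X + 67) with hrT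
  obtain ⟨j, ⟨hj, hjM₁⟩, hjM₂⟩ :=
    (((eventually_mul_eval_le_two_pow (rT ^ 2 * (rQ + 1)) 8000).and
      (Filter.eventually_ge_atTop M₁)).and (Filter.eventually_ge_atTop M₂)).exists
  set Q := rQ.eval j with hQ
  set B := rB.eval j with hB
  set n := rn.eval j with hn
  set T := rT.eval j with hT
  have eQ : Q = p.eval (37 * j + 66) := by simp [hQ, hrQ]
  have eB : B = PJ.eval (Q + (3 * j + 6)) := by simp [hB, hrB, hQ]
  have en : n = Q + 9 * B + 200 * (j + 1) := by simp [hn, hrn, hQ, hB]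
  have eT : T = PS.eval (3 * n + 37 * j + 67) := by simp [hT, hrT, hn]
  -- The advice length must be bounded before the test circuits can be sized, so membership in the
  -- family is first shown with the point circuit as its own partner.
  have hpt : ∀ a b : Bits (j + 2), (pointCircuit j a b, pointCircuit j a b) ∈
      (randomPairs.dist n).support := fun a b => by
    have h1 : (pointCircuit j a b).qubits ≤ n + 1 := by simp only [pointCircuit]; omega
    have h2 : (pointCircuit j a b).size ≤ n := by rw [size_pointCircuit]; omega
    have h3 : ∀ g ∈ (pointCircuit j a b).gates, g.Below (n + 1) := fun g hg =>
      (below_pointGates j _ _ g hg).mono h1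
    exact mem_support_randomPairs_of_le h1 h2 h3 h1 h2 h3
  set q : Bits (j + 2) × Bits (j + 2) → ℕ := fun s => (O (pointCircuit j s.1 s.2)).qubits with hq
  have hqQ : ∀ s, q s ≤ Q := fun s => by
    have := hp _ ⟨n, _, hpt s.1 s.2, Or.inl rfl⟩
    rw [size_pointCircuit] at this
    refine this.trans (le_of_eq ?_)
    rw [eQ]
    congr 1
    simp only [pointCircuit]
    omega
  set Jq : ℕ → QAlg := fun q => J ![q, 3 * (j + 2)] with hJq
  have hJB : ∀ q ≤ Q, (encQAlg (Jq q)).length ≤ B := fun q hq => by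
    refine (hPJ _).trans ?_
    rw [eB]
    refine eval_le_eval _ ?_
    simp only [Fin.sum_univ_two, Matrix.cons_val_zero, Matrix.cons_val_one]
    omega
  have hanc : ∀ q ≤ Q, q + 3 * (j + 2) + (Jq q).ancillas + (j + 1) ≤ n := fun q hq => by
    have := (Jq q).ancillas_le.trans (hJB q hq)
    omega
  have hsize : ∀ q ≤ Q, ∀ a b, (testCircuit (Jq q) j q n a b).size = n := fun q hq a b => by
    have := (Jq q).length_gates_le.trans (hJB q hq)
    exact size_testCircuit _ _ _ (by omega)
  have hmem : ∀ (s : Bits (j + 2) × Bits (j + 2)) b,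
      (testCircuit (Jq (q s)) j (q s) n s.1 b, pointCircuit j s.1 s.2) ∈
        (randomPairs.dist n).support := fun s b => by
    refine mem_support_randomPairs_of_le le_rfl (hsize _ (hqQ s) _ _).le
      (below_testCircuit _ _ _ (hanc _ (hqQ s))) ?_ ?_ fun g hg =>
      (below_pointGates j _ _ g hg).mono ?_
    · simp only [pointCircuit]; omega
    · rw [size_pointCircuit]; omega
    · omega
  -- None of the parameters involves a, b, b' or the advice length: a single oracle circuit serves
  -- for all of them.
  set S₀ := S ![n, n + 1, 3 * (j + 2), n, 34 * j + 60] with hS₀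
  set acc : Bits (j + 2) × Bits (j + 2) → Bits (j + 2) → ℝ := fun s b =>
    prOne ((attack (J ![(O (testCircuit (Jq (q s)) j (q s) n s.1 b)).qubits, n + 1]) n
      (O (testCircuit (Jq (q s)) j (q s) n s.1 b)).qubits (q s)).run
      (tensor (O (testCircuit (Jq (q s)) j (q s) n s.1 b)).op (O (pointCircuit j s.1 s.2)).op))
    with hacc
  have hacc1 : ∀ s b, |acc s b - (if s.2 = b then 1 else 0)| ≤ 1 / 20 + 1 / 20 := fun s b => by
    refine abs_prOne_attack_sub_le s.1 s.2 b (O (pointCircuit j s.1 s.2))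
      (O (testCircuit (Jq (q s)) j (q s) n s.1 b)) (hanc _ (hqQ s)) _ rfl (fun ρ h1 h2 => ?_)
      fun ρ h1 h2 => ?_
    · refine (hFE _ ⟨n, _, hmem s b, Or.inr rfl⟩ ρ h1 h2).trans (hM₂ _ ?_)
      simp only [pointCircuit]
      omega
    · refine (hFE _ ⟨n, _, hmem s b, Or.inl rfl⟩ ρ h1 h2).trans (hM₂ _ ?_)
      simp only [testCircuit]
      omega
  have hacc2 : ∀ s b, |acc s b - S₀.prAccept
      (gatesOp (n + 1) (testCircuit (Jq (q s)) j (q s) n s.1 b).gates)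
      (gatesOp (3 * (j + 2)) (pointCircuit j s.1 s.2).gates)| ≤ 1 / 20 := fun s b => by
    have h := hVBB n _ (hmem s b)
    simp only [hsize _ (hqQ s), size_pointCircuit] at h
    refine le_trans h (hM₁ _ ?_)
    omega
  have hQ0 : (0 : ℝ) ≤ 4 * (2 ^ (j + 2) : ℕ) * (Q + 1) := by positivity
  have hST : S₀.gates.length ≤ T := by
    refine S₀.length_gates_le.trans ((hPS _).trans (le_of_eq ?_))
    rw [eT]
    congr 1
    simp [Fin.sum_univ_five]
    omega
  have hunit : ∀ N (l : List Gate), (gatesOp N l)ᴴ * gatesOp N l = 1 :=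
    conjTranspose_gatesOp_mul_self
  -- The two first oracles are the tests for b' = b and for b' the complement of b. The factor 2000
  -- of the averaging and the 4 of the spread make up the 8000 in the choice of j.
  obtain ⟨s, hs⟩ := OAlg.exists_prAccept_near hQ0
    (spread_testCircuit Jq hanc (Equiv.refl _) q hqQ)
    (spread_testCircuit Jq hanc (complement (j + 2)) q hqQ)
    ((spread_pointCircuit j).mono (le_mul_of_one_le_right (by positivity) (by simp)))
    (fun _ => hunit _ _) (fun _ => hunit _ _) (fun _ => hunit _ _) S₀ (by
      have hc : (Fintype.card (Bits (j + 2) × Bits (j + 2)) : ℝ) = 2 ^ (j + 2) * 2 ^ (j + 2) := by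
        simp
      rw [hc]
      have hj' : 8000 * (T ^ 2 * (Q + 1)) ≤ 2 ^ (j + 2) := by
        have : (rT ^ 2 * (rQ + 1)).eval j = T ^ 2 * (Q + 1) := by simp [hT, hQ]
        rw [this] at hj
        exact hj.trans (Nat.pow_le_pow_right (by norm_num) (by omega))
      have hj'' : (8000 : ℝ) * ((T : ℝ) ^ 2 * (Q + 1)) ≤ 2 ^ (j + 2) := by exact_mod_cast hj'
      have hST' : (S₀.gates.length : ℝ) ^ 2 ≤ (T : ℝ) ^ 2 :=
        pow_le_pow_left₀ (Nat.cast_nonneg _) (Nat.cast_le.2 hST) 2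
      calc 2000 * (S₀.gates.length : ℝ) ^ 2 * (4 * (2 ^ (j + 2) : ℕ) * (Q + 1))
          ≤ 2000 * (T : ℝ) ^ 2 * (4 * (2 ^ (j + 2) : ℕ) * (Q + 1)) := by gcongr
        _ = 8000 * ((T : ℝ) ^ 2 * (Q + 1)) * 2 ^ (j + 2) := by push_cast; ring
        _ ≤ _ := by gcongr)
  have a1 := abs_le.1 (hacc1 s s.2)
  have a2 := abs_le.1 (hacc1 s (complement (j + 2) s.2))
  have b1 := abs_le.1 (hacc2 s s.2)
  have b2 := abs_le.1 (hacc2 s (complement (j + 2) s.2))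
  rw [if_pos rfl] at a1
  rw [if_neg (ne_complement s.2)] at a2
  simp only [Equiv.refl_apply] at hs
  -- The simulator accepts with probability at least 17/20 in the first case and at most 3/20 in the
  -- second, yet the first exceeds the second by at most 1/4.
  linarith [a1.1, a2.2, b1.2, b2.1]

end QObf

end

theorem mainTheorem3 :
    ∃ C : QObf.CircuitPairFamily, C.IsPolyTime ∧
      ∀ C' : QObf.StatePairFamily, ¬ C'.IsObfuscationOf C := by
  refine ⟨QObf.randomPairs, QObf.randomPairs_isPolyTime, ?_⟩
  rintro C' ⟨O, J, -, hJ, hE, hF, hV⟩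
  exact QObf.not_exists_obfuscator hJ hE hF hV
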